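/- **Setting.** A (symmetric) link function $L$ with values in a set $I$ is a sequence of functions $L_n:\{1,\dots,n\}^2\to I$, $n\ge 1$, with $L_n(i,j)=L_n(j,i)$. Put $k_n^L=\#\{L_n(i,j):1\le i,j\le n\}$ and $\alpha_n^L=\max_{t}\#\{(i,j):L_n(i,j)=t\}$. * *Property B*: $\Delta_L=\sup_n\sup_{t}\sup_{1\le k\le n}\#\{l\le n: L_n(k,l)=t\}<\infty$. * *(Lcond)*: $k_n^L\to\infty$ and $k_n^L\alpha_n^L=O(n^2)$. * A word $w$ of length $h$ is a sequence of $h$ letters whose first occurrences are in alphabetical order; it is pair-matched if each of its letters occurs exactly twice. A circuit of length $h$ is a map $\pi:\{0,\dots,h\}\to\{1,\dots,n\}$ with $\pi(0)=\pi(h)$. Let $\Pi_L(w)$ be the set of circuits of length $h$ such that, for all $i,j$, $w[i]=w[j]\Leftrightarrow L_n(\pi(i-1),\pi(i))=L_n(\pi(j-1),\pi(j))$, and let $\Pi_L^*(w)$ be defined with $\Rightarrow$ in place of $\Leftrightarrow$. * $p_L(w)$ exists, for a pair-matched word $w$ of length $2k$, if $p_L(w)=\lim_n n^{-(1+k)}\#\Pi_L(w)$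 exists as a finite limit. An input sequence is a family $(x_t)_{t\in I}$ of independent real random variables with mean $0$ and variance $1$ that are (A1) uniformly bounded, or (A2) identically distributed, or (A3) have uniformly bounded moments of every order. A probability measure $\mu$ on $\mathbb R$ is called *the LSD for the link $L$* if, for every input sequence satisfying (A1), (A2) or (A3), the distribution functions of the empirical spectral measures of the matrices $n^{-1/2}(x_{L_n(i,j)})_{i,j\le n}$ converge to that of $\mu$ at all continuity points of the latter, in the following sense: almost surely under (A1) and under (A3); almost surely under (A2) whenever $\#\bigcup_{m\le n}\{L_m(i,j):i,j\le m\}=O(k_n^L)$ (which holds if $L_n$ does not depend on $n$, or if the value sets increase with $n$); and in probability under (A2) in all cases. **Proposition.** Let $L_X$ be a symmetric link function that satisfies Property B and (Lcond), and suppose that $p_X(w)$ exists for every pair-matched word $w$. Let $L_Y=\rho\circ L_X$, where $\rho=\rho_n$ (possibly depending on $n$) is injective on the set of values of $L_{X,n}$, for every $n$. Then $L_Y$ satisfies Property B and (Lcond); $\Pi_X^*(w)=\Pi_Y^*(w)$ for every word $w$ and every $n$; and there is a probability measure $\mathcal L_X$ which is the LSD for the link $L_X$ and also the LSD for the link $L_Y$.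 **Example.** The Toeplitz link $L_T(i,j)=|i-j|$ satisfies Property B and (Lcond), $p_T(w)$ exists for every pair-matched word $w$, and there is a probability measure $\mathcal L_T$ which is the LSD both for the Toeplitz link and for the link $(i,j)\mapsto (i-j)^2$. -/

import Mathlib

open MeasureTheory ProbabilityTheory Filter Topology Asymptotics
open scoped ENNReal

universe u v w

noncomputable section

/-! ### Link functions -/

/-- A symmetric link function: a sequence `L n` of symmetric functions on pairs of indices with
values in a set `ι` of labels (for instance `ℕ` or `ℕ × ℕ`). The index set `{1, …, n}` is
represented by `Fin n`. The functions may depend on `n`. -/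
structure SymmLink (ι : Type u) where
  toFun : ∀ n : ℕ, Fin n → Fin n → ι
  symm : ∀ n i j, toFun n i j = toFun n j i

namespace SymmLink

variable {ι : Type u} {κ : Type v}

/-- The composed link `ρ ∘ L`, where the transformation may depend on `n`. -/
def map (L : SymmLink ι) (ρ : ℕ → ι → κ) : SymmLink κ where
  toFun n i j := ρ n (L.toFun n i j)
  symm n i j := by rw [L.symm]

/-- The set of values `{L n (i, j) : 1 ≤ i, j ≤ n}`. -/
def values (L : SymmLink ι) (n : ℕ) : Set ι :=
  Set.range fun p : Fin n × Fin n => L.toFun n p.1 p.2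

/-- `Δ_L`: the largest number of times a label occurs in a row, over all `n`. -/
def rowMultiplicity (L : SymmLink ι) : ℕ∞ :=
  ⨆ (n : ℕ) (t ∈ L.values n) (k : Fin n), Set.encard {l : Fin n | L.toFun n k l = t}

/-- Property B. -/
def PropertyB (L : SymmLink ι) : Prop := L.rowMultiplicity < ⊤

/-- `k_n`: the number of distinct labels in the `n × n` matrix. -/
def numValues (L : SymmLink ι) (n : ℕ) : ℕ := (L.values n).ncard

/-- `α_n`: the largest number of occurrences of a label in the `n × n` matrix. -/
def maxOccurrences (L : SymmLink ι) (n : ℕ) : ℕ :=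
  ⨆ t : ι, Set.ncard {p : Fin n × Fin n | L.toFun n p.1 p.2 = t}

/-- The conditions `k_n → ∞` and `k_n α_n = O(n²)`. -/
def LinkCond (L : SymmLink ι) : Prop :=
  Tendsto L.numValues atTop atTop ∧
    (fun n : ℕ => (L.numValues n : ℝ) * (L.maxOccurrences n : ℝ)) =O[atTop]
      fun n : ℕ => (n : ℝ) ^ 2

/-- The number of distinct labels used by the first `n` matrices together is `O(k_n)`. This holds
with constant `1` when the sets of values increase with `n`, in particular when the link function
does not depend on `n`. -/
def CumulativeValuesBound (L : SymmLink ι) : Prop :=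
  (fun n : ℕ => ((⋃ m ∈ Finset.range (n + 1), L.values m).ncard : ℝ)) =O[atTop]
    fun n : ℕ => (L.numValues n : ℝ)

end SymmLink

/-! ### Words and circuits -/

/-- A word of length `h`, with letters `a = 0, b = 1, c = 2, …`: the first occurrences of the
letters are in alphabetical order, so that every letter is preceded by all earlier letters. -/
structure Word (h : ℕ) where
  letter : Fin h → ℕ
  alphabetical : ∀ i, ∀ m < letter i, ∃ j < i, letter j = m

/-- Every letter occurs exactly twice. -/
def Word.PairMatched {h : ℕ} (W : Word h) : Prop :=
  ∀ i, Set.ncard {j | W.letter j = W.letter i} = 2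

namespace SymmLink

variable {ι : Type u}

/-- The `L`-value `L(π(i-1), π(i))` of the `i`-th step of a path `π` (with `i` counted from `0`). -/
def stepValue (L : SymmLink ι) {n h : ℕ} (π : Fin (h + 1) → Fin n) (i : Fin h) : ι :=
  L.toFun n (π i.castSucc) (π i.succ)

/-- `Π(w)`: the circuits of length `h` in `{1, …, n}` whose `L`-values match exactly as the
letters of `w` do. -/
def circuits (L : SymmLink ι) {h : ℕ} (W : Word h) (n : ℕ) : Set (Fin (h + 1) → Fin n) :=
  {π | π 0 = π (Fin.last h) ∧
    ∀ i j, W.letter i = W.letter j ↔ L.stepValue π i = L.stepValue π j}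

/-- `Π*(w)`: the circuits whose `L`-values match at least where the letters of `w` do. -/
def circuitsStar (L : SymmLink ι) {h : ℕ} (W : Word h) (n : ℕ) : Set (Fin (h + 1) → Fin n) :=
  {π | π 0 = π (Fin.last h) ∧
    ∀ i j, W.letter i = W.letter j → L.stepValue π i = L.stepValue π j}

/-- The limit `p(w) = lim n^{-(1+k)} #Π(w)` exists for every `k` and every pair-matched word `w`
of length `2k`. -/
def WordLimitsExist (L : SymmLink ι) : Prop :=
  ∀ (k : ℕ) (W : Word (2 * k)), W.PairMatched →
    ∃ p : ℝ, Tendsto (fun n : ℕ => ((L.circuits W n).ncard : ℝ) / (n : ℝ) ^ (1 + k)) atTop (𝓝 p)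

end SymmLink

/-! ### Input sequences -/

section Input

variable {ι : Type u} {Ω : Type w} [MeasurableSpace Ω]

/-- Independent, with mean `0` and variance `1`. -/
structure IsStandardizedInput (x : ι → Ω → ℝ) (P : Measure Ω) : Prop where
  measurable : ∀ t, Measurable (x t)
  indep : iIndepFun x P
  memLp : ∀ t, MemLp (x t) 2 P
  mean : ∀ t, ∫ ω, x t ω ∂P = 0
  variance : ∀ t, variance (x t) P = 1

/-- (A1): independent, uniformly bounded, mean `0`, variance `1`. -/
def InputA1 (x : ι → Ω → ℝ) (P : Measure Ω) : Prop :=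
  IsStandardizedInput x P ∧ ∃ C : ℝ, ∀ t, ∀ᵐ ω ∂P, |x t ω| ≤ C

/-- (A2): independent and identically distributed, mean `0`, variance `1`. -/
def InputA2 (x : ι → Ω → ℝ) (P : Measure Ω) : Prop :=
  IsStandardizedInput x P ∧ ∀ s t, IdentDistrib (x s) (x t) P P

/-- (A3): independent, mean `0`, variance `1`, uniformly bounded moments of all orders. -/
def InputA3 (x : ι → Ω → ℝ) (P : Measure Ω) : Prop :=
  IsStandardizedInput x P ∧
    ∀ k : ℕ, ∃ C : ℝ, ∀ t, Integrable (fun ω => |x t ω| ^ k) P ∧ ∫ ω, |x t ω| ^ k ∂P ≤ C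

end Input

/-! ### Patterned matrices and limiting spectral distributions -/

/-- The empirical spectral measure `n⁻¹ ∑ δ_{λ_i}` of a real symmetric matrix. -/
def empiricalSpectralMeasure {n : ℕ} (A : Matrix (Fin n) (Fin n) ℝ) (hA : A.IsHermitian) :
    Measure ℝ :=
  (n : ℝ≥0∞)⁻¹ • ∑ i, Measure.dirac (hA.eigenvalues i)

namespace SymmLink

variable {ι : Type u}

/-- The scaled patterned matrix `n^{-1/2} (x_{L(i,j)})`. -/
def scaledMatrix (L : SymmLink ι) (x : ι → ℝ) (n : ℕ) : Matrix (Fin n) (Fin n) ℝ :=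
  Matrix.of fun i j => (Real.sqrt n)⁻¹ * x (L.toFun n i j)

theorem scaledMatrix_isHermitian (L : SymmLink ι) (x : ι → ℝ) (n : ℕ) :
    (L.scaledMatrix x n).IsHermitian := by
  ext i j
  simp [scaledMatrix, L.symm n j i]

/-- The distribution function of the empirical spectral measure of `n^{-1/2} (x_{L(i,j)})`. -/
def esd (L : SymmLink ι) (x : ι → ℝ) (n : ℕ) (s : ℝ) : ℝ :=
  (empiricalSpectralMeasure (L.scaledMatrix x n) (L.scaledMatrix_isHermitian x n)).real (Set.Iic s)

variable {Ω : Type w} [MeasurableSpace Ω]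

/-- Weak convergence of the ESD to `μ`, almost surely. -/
def ESDTendstoAlmostSurely (L : SymmLink ι) (x : ι → Ω → ℝ) (P : Measure Ω) (μ : Measure ℝ) :
    Prop :=
  ∀ᵐ ω ∂P, ∀ s : ℝ, ContinuousAt (fun r => μ.real (Set.Iic r)) s →
    Tendsto (fun n => L.esd (fun t => x t ω) n s) atTop (𝓝 (μ.real (Set.Iic s)))

/-- Weak convergence of the ESD to `μ`, in probability. -/
def ESDTendstoInProbability (L : SymmLink ι) (x : ι → Ω → ℝ) (P : Measure Ω) (μ : Measure ℝ) :
    Prop :=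
  ∀ s : ℝ, ContinuousAt (fun r => μ.real (Set.Iic r)) s →
    TendstoInMeasure P (fun n ω => L.esd (fun t => x t ω) n s) atTop
      (fun _ => μ.real (Set.Iic s))

/-- The non-random law `μ` is the LSD of `n^{-1/2} (x_{L(i,j)})`, for every input sequence:
the convergence is almost sure under (A1) and under (A3), and also under (A2) if the matrices
together use only `O(k_n)` variables up to size `n`; under (A2) it is always in probability. -/
def IsLSD (L : SymmLink ι) (μ : Measure ℝ) : Prop :=
  IsProbabilityMeasure μ ∧
  ∀ (Ω : Type w) [MeasurableSpace Ω] (P : Measure Ω) [IsProbabilityMeasure P] (x : ι → Ω → ℝ),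
    (InputA1 x P → L.ESDTendstoAlmostSurely x P μ) ∧
    (InputA3 x P → L.ESDTendstoAlmostSurely x P μ) ∧
    (InputA2 x P → L.CumulativeValuesBound → L.ESDTendstoAlmostSurely x P μ) ∧
    (InputA2 x P → L.ESDTendstoInProbability x P μ)

end SymmLink

/-! ### Two links -/

/-- The Toeplitz link `|i - j|`. -/
def toeplitzLink : SymmLink ℕ where
  toFun _ i j := ((i : ℤ) - (j : ℤ)).natAbs
  symm n i j := by rw [← Int.natAbs_neg, neg_sub]

/-- The link `(i - j)²`. -/
def squaredDifferenceLink : SymmLink ℕ where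
  toFun _ i j := (((i : ℤ) - (j : ℤ)) ^ 2).natAbs
  symm n i j := by rw [← neg_sub, neg_sq]

end

/-!
The argument is the moment method. The trace of the `h`-th power of the matrix is a sum over closed
circuits of length `h`. A label that occurs only once in a circuit makes the mean of its term
vanish, and by Property B the circuits in which every label is repeated, but not exactly twice, are
fewer by a factor `√n`. So only pair-matched circuits survive, and whatever the input, the mean
`2k`-th moment converges to the sum of `p_L(w)` over the pair-matched words `w` of length `2k`.
Quadruples of matched circuits linked by common labels again lose powers of `n`: the fourth central
moments of the normalized traces are `O(n⁻²)`, and the convergence is almost sure. There are at most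
`(2k)^k` pair-matched words of length `2k`, each contributing at most `Δ_L^(2k)`, so the limit
moments determine the limit law.

Identically distributed inputs are truncated and standardized. By (Lcond) each label is used
`O(n² / k_n)` times, so the normalized Frobenius distance to the truncated matrix is bounded by an
average over `O(k_n)` labels, and the law of large numbers makes it small. Without the bound on the
union of the value sets only its mean is small, whence convergence in probability.

The limit moments depend only on which labels of a circuit coincide, so an injective relabelling
preserves them. For the Toeplitz link, the closed paths whose steps are matched in absolute value
are, up to `O(n^k)` of them, those with opposite signs at matched positions; these are the lattice
points of a dilated polytope, whose volume is `p_T(w)`.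
-/

/-! ### Counting walks by the coincidences of their labels -/

lemma ncard_le_mul_ncard_image {A B : Type*} [Finite A] [Finite B] (S : Set A) (f : A → B)
    (m : ℕ) (h : ∀ b ∈ f '' S, {a ∈ S | f a = b}.ncard ≤ m) :
    S.ncard ≤ m * (f '' S).ncard := by
  classical
  have := Fintype.ofFinite A
  have := Fintype.ofFinite B
  simp only [Set.ncard_eq_toFinset_card', Set.toFinset_image] at h ⊢
  refine Finset.card_le_mul_card_image S.toFinset m fun b hb => ?_
  convert h b (by simpa using hb) using 2
  ext a
  simp

section Walks

variable {V ι α : Type*}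

lemma ncard_le_mul_ncard_image_init [Finite V] {l M : ℕ} (S : Set (Fin (l + 1) → V))
    (hM : ∀ p : Fin l → V, {y | (Fin.snoc p y : Fin (l + 1) → V) ∈ S}.ncard ≤ M) :
    S.ncard ≤ M * ((Fin.init : (Fin (l + 1) → V) → Fin l → V) '' S).ncard := by
  refine ncard_le_mul_ncard_image S _ M fun p _ => ?_
  refine (Set.ncard_le_ncard_of_injOn (fun π => π (Fin.last l)) ?_ ?_).trans (hM p)
  · rintro π ⟨hπ, rfl⟩
    simpa using hπ
  · rintro π ⟨-, hπ⟩ π' ⟨-, hπ'⟩ hlast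
    rw [← Fin.snoc_init_self π, ← Fin.snoc_init_self π', hπ, hπ']
    exact congrArg _ hlast

/-- The walks whose steps have the prescribed label `v a` at the letters `a ∈ K` of the word `w`,
and equal labels at equal letters. The prescribed labels record the part of a larger family of
walks that has been chosen already. -/
def walksWithWord (ℓ : V → V → ι) {l : ℕ} (w : Fin l → α) (K : Set α) (v : α → ι) :
    Set (Fin (l + 1) → V) :=
  {π | (∀ i, w i ∈ K → ℓ (π i.castSucc) (π i.succ) = v (w i)) ∧
    ∀ i j, w i = w j → ℓ (π i.castSucc) (π i.succ) = ℓ (π j.castSucc) (π j.succ)}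

lemma image_init_walksWithWord_subset (ℓ : V → V → ι) {l : ℕ} (w : Fin (l + 1) → α) (K : Set α)
    (v : α → ι) : Fin.init '' walksWithWord ℓ w K v ⊆ walksWithWord ℓ (Fin.init w) K v := by
  rintro _ ⟨π, ⟨hv, heq⟩, rfl⟩
  exact ⟨fun i hi => hv i.castSucc hi, fun i j hij => heq i.castSucc j.castSucc hij⟩

lemma step_snoc (ℓ : V → V → ι) {l : ℕ} (p : Fin (l + 1) → V) (y : V) :
    (∀ i : Fin l, ℓ ((Fin.snoc p y : Fin (l + 2) → V) i.castSucc.castSucc)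
        ((Fin.snoc p y : Fin (l + 2) → V) i.castSucc.succ) = ℓ (p i.castSucc) (p i.succ)) ∧
      ℓ ((Fin.snoc p y : Fin (l + 2) → V) (Fin.last l).castSucc)
        ((Fin.snoc p y : Fin (l + 2) → V) (Fin.last l).succ) = ℓ (p (Fin.last l)) y := by
  refine ⟨fun i => ?_, ?_⟩
  · rw [← Fin.castSucc_succ, Fin.snoc_castSucc, Fin.snoc_castSucc]
  · rw [Fin.snoc_castSucc, Fin.succ_last, Fin.snoc_last]

/-- The label of the last step is determined by the earlier ones. -/
lemma ncard_snoc_mem_walksWithWord_le {ℓ : V → V → ι} {D : ℕ}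
    (hD : ∀ x t, {y | ℓ x y = t}.ncard ≤ D) [Finite V] {l : ℕ} {w : Fin (l + 1) → α} {K : Set α}
    {v : α → ι} (hlast : w (Fin.last l) ∈ K ∪ Set.range (Fin.init w)) (p : Fin (l + 1) → V) :
    {y | (Fin.snoc p y : Fin (l + 2) → V) ∈ walksWithWord ℓ w K v}.ncard ≤ D := by
  rcases hlast with hK | ⟨i, hi⟩
  · refine (Set.ncard_le_ncard fun y hy => ?_).trans (hD (p (Fin.last l)) (v (w (Fin.last l))))
    exact (step_snoc ℓ p y).2.symm.trans (hy.1 _ hK)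
  · refine (Set.ncard_le_ncard fun y hy => ?_).trans
      (hD (p (Fin.last l)) (ℓ (p i.castSucc) (p i.succ)))
    exact (step_snoc ℓ p y).2.symm.trans
      ((hy.2 _ i.castSucc hi.symm).trans ((step_snoc ℓ p y).1 i))

lemma ncard_range_init_sdiff_add_one_le {l : ℕ} {w : Fin (l + 1) → α} {K : Set α}
    (hlast : w (Fin.last l) ∉ K ∪ Set.range (Fin.init w)) :
    (Set.range (Fin.init w) \ K).ncard + 1 ≤ (Set.range w \ K).ncard := by
  refine Set.ncard_lt_ncard ?_ ((Set.finite_range w).sdiff)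
  have hsub : Set.range (Fin.init w) \ K ⊆ Set.range w \ K :=
    Set.sdiff_subset_sdiff_left (Set.range_comp_subset_range _ w)
  rw [Set.ssubset_iff_of_subset hsub]
  exact ⟨w (Fin.last l), ⟨⟨_, rfl⟩, fun h => hlast (Or.inl h)⟩, fun h => hlast (Or.inr h.1)⟩

/-- A step with a new label has at most `Nat.card V` continuations, any other step at most `D`. -/
lemma ncard_walksWithWord_le [Finite V] {ℓ : V → V → ι} {D : ℕ}
    (hD : ∀ x t, {y | ℓ x y = t}.ncard ≤ D) {l : ℕ} (w : Fin l → α) (K : Set α) (v : α → ι) :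
    (walksWithWord ℓ w K v).ncard ≤ Nat.card V ^ (1 + (Set.range w \ K).ncard) * D ^ l := by
  rcases isEmpty_or_nonempty V with hV | ⟨⟨x⟩⟩
  · simp [Set.eq_empty_of_isEmpty (walksWithWord ℓ w K v)]
  have hVpos : 0 < Nat.card V := Nat.card_pos_iff.2 ⟨⟨x⟩, ‹_›⟩
  have hDpos : 1 ≤ D := by
    refine le_trans ?_ (hD x (ℓ x x))
    exact (Set.ncard_pos).2 ⟨x, rfl⟩
  induction l with
  | zero =>
    calc _ ≤ (Set.univ : Set (Fin 1 → V)).ncard := Set.ncard_le_ncard (Set.subset_univ _)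
      _ = _ := by simp [Set.ncard_univ, Set.range_eq_empty w, Nat.card_fun]
  | succ l ih =>
    have hinit : (Fin.init '' walksWithWord ℓ w K v).ncard ≤
        Nat.card V ^ (1 + (Set.range (Fin.init w) \ K).ncard) * D ^ l :=
      (Set.ncard_le_ncard (image_init_walksWithWord_subset ℓ w K v)).trans (ih (Fin.init w))
    by_cases hlast : w (Fin.last l) ∈ K ∪ Set.range (Fin.init w)
    · calc (walksWithWord ℓ w K v).ncard
          ≤ D * (Nat.card V ^ (1 + (Set.range (Fin.init w) \ K).ncard) * D ^ l) :=
            (ncard_le_mul_ncard_image_init _ (ncard_snoc_mem_walksWithWord_le hD hlast)).trans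
              (by gcongr)
        _ ≤ D * (Nat.card V ^ (1 + (Set.range w \ K).ncard) * D ^ l) := by
            gcongr
            · exact (Set.finite_range w).sdiff
            · exact Set.range_comp_subset_range _ w
        _ = _ := by ring
    · calc (walksWithWord ℓ w K v).ncard
          ≤ Nat.card V * (Nat.card V ^ (1 + (Set.range (Fin.init w) \ K).ncard) * D ^ l) :=
            (ncard_le_mul_ncard_image_init _ fun _ => Set.ncard_le_card _).trans (by gcongr)
        _ = Nat.card V ^ (1 + ((Set.range (Fin.init w) \ K).ncard + 1)) * D ^ l := by ring
        _ ≤ Nat.card V ^ (1 + (Set.range w \ K).ncard) * D ^ (l + 1) := by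
            gcongr ?_ ^ (1 + ?_) * ?_ ^ ?_
            exacts [ncard_range_init_sdiff_add_one_le hlast, Nat.le_succ l]

/-- The label of the step from `c i` to `c (i + 1)`, indices being cyclic: a function on
`Fin (m + 1)` encodes a closed walk of length `m + 1` by its vertices without the final one. -/
def cyclicStep (ℓ : V → V → ι) {m : ℕ} (c : Fin (m + 1) → V) (i : Fin (m + 1)) : ι :=
  ℓ (c i) (c (i + 1))

/-- The closed counterpart of `walksWithWord`. -/
def closedWalksWithWord (ℓ : V → V → ι) {m : ℕ} (w : Fin (m + 1) → α) (K : Set α) (v : α → ι) :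
    Set (Fin (m + 1) → V) :=
  {c | (∀ i, w i ∈ K → cyclicStep ℓ c i = v (w i)) ∧
    ∀ i j, w i = w j → cyclicStep ℓ c i = cyclicStep ℓ c j}

lemma closedWalksWithWord_subset (ℓ : V → V → ι) {m : ℕ} (w : Fin (m + 1) → α) (K : Set α)
    (v : α → ι) : closedWalksWithWord ℓ w K v ⊆ walksWithWord ℓ (Fin.init w) K v := by
  rintro c ⟨hv, heq⟩
  have hstep (i : Fin m) : ℓ (c i.castSucc) (c i.succ) = cyclicStep ℓ c i.castSucc := by
    rw [cyclicStep, Fin.coeSucc_eq_succ]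
  exact ⟨fun i hi => (hstep i).trans (hv _ hi),
    fun i j hij => (hstep i).trans ((heq _ _ hij).trans (hstep j).symm)⟩

lemma ncard_closedWalksWithWord_le [Finite V] {ℓ : V → V → ι} {D : ℕ}
    (hD : ∀ x t, {y | ℓ x y = t}.ncard ≤ D) {m : ℕ} (w : Fin (m + 1) → α) (K : Set α)
    (v : α → ι) :
    (closedWalksWithWord ℓ w K v).ncard ≤
      Nat.card V ^ (1 + (Set.range w \ K).ncard) * D ^ m := by
  rcases isEmpty_or_nonempty V with hV | hV
  · simp [Set.eq_empty_of_isEmpty (closedWalksWithWord ℓ w K v)]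
  calc (closedWalksWithWord ℓ w K v).ncard
      ≤ Nat.card V ^ (1 + (Set.range (Fin.init w) \ K).ncard) * D ^ m :=
        (Set.ncard_le_ncard (closedWalksWithWord_subset ℓ w K v)).trans
          (ncard_walksWithWord_le hD _ K v)
    _ ≤ Nat.card V ^ (1 + (Set.range w \ K).ncard) * D ^ m := by
        gcongr
        · exact Nat.card_pos
        · exact (Set.finite_range w).sdiff
        · exact Set.range_comp_subset_range _ w

lemma ncard_closedWalksWithWord_le_of_last [Finite V] {ℓ : V → V → ι} {D : ℕ}
    (hD : ∀ x t, {y | ℓ x y = t}.ncard ≤ D) {m : ℕ} (w : Fin (m + 1) → α) (K : Set α)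
    (v : α → ι) (hlast : w (Fin.last m) ∉ K ∪ Set.range (Fin.init w)) :
    (closedWalksWithWord ℓ w K v).ncard ≤ Nat.card V ^ (Set.range w \ K).ncard * D ^ m := by
  rcases isEmpty_or_nonempty V with hV | hV
  · simp [Set.eq_empty_of_isEmpty (closedWalksWithWord ℓ w K v)]
  calc (closedWalksWithWord ℓ w K v).ncard
      ≤ Nat.card V ^ (1 + (Set.range (Fin.init w) \ K).ncard) * D ^ m :=
        (Set.ncard_le_ncard (closedWalksWithWord_subset ℓ w K v)).trans
          (ncard_walksWithWord_le hD _ K v)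
    _ ≤ Nat.card V ^ (Set.range w \ K).ncard * D ^ m := by
        gcongr
        · exact Nat.card_pos
        · rw [add_comm]
          exact ncard_range_init_sdiff_add_one_le hlast

lemma cyclicStep_comp_add_right (ℓ : V → V → ι) {m : ℕ} (c : Fin (m + 1) → V)
    (s i : Fin (m + 1)) : cyclicStep ℓ (fun i => c (i + s)) i = cyclicStep ℓ c (i + s) := by
  simp only [cyclicStep, add_right_comm]

/-- Rotating the closed walk makes the letter with a single occurrence the last one, whose label is
then determined by the vertices: this saves a factor `Nat.card V`. -/
lemma ncard_closedWalksWithWord_le_of_unique [Finite V] {ℓ : V → V → ι} {D : ℕ}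
    (hD : ∀ x t, {y | ℓ x y = t}.ncard ≤ D) {m : ℕ} (w : Fin (m + 1) → α) (K : Set α)
    (v : α → ι) {i₀ : Fin (m + 1)} (hK : w i₀ ∉ K) (hunique : ∀ i, w i = w i₀ → i = i₀) :
    (closedWalksWithWord ℓ w K v).ncard ≤ Nat.card V ^ (Set.range w \ K).ncard * D ^ m := by
  obtain ⟨s, rfl⟩ : ∃ s, Fin.last m + s = i₀ := ⟨i₀ - Fin.last m, by simp⟩
  rw [← (Equiv.addRight s).surjective.range_comp w]
  refine le_trans ?_ (ncard_closedWalksWithWord_le_of_last hD (w ∘ Equiv.addRight s) K v ?_)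
  · refine Set.ncard_le_ncard_of_injOn (fun c i => c (i + s)) ?_ ?_
    · rintro c ⟨hv, heq⟩
      simp only [closedWalksWithWord, Set.mem_ofPred_eq, cyclicStep_comp_add_right]
      exact ⟨fun i hi => hv _ hi, fun i j hij => heq _ _ hij⟩
    · exact ((Equiv.addRight s).surjective.injective_comp_right).injOn
  · rintro (h | ⟨i, hi⟩)
    · exact hK h
    · exact (Fin.castSucc_lt_last i).ne (add_right_cancel (hunique _ hi))

section Families

variable {J : Type*} {m : ℕ}

/-- The families of closed walks, indexed by `J`, with equal labels at equal letters of the words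
`w j`. -/
def closedWalkFamilies (ℓ : V → V → ι) (w : J → Fin (m + 1) → α) :
    Set (J → Fin (m + 1) → V) :=
  {c | ∀ j i j' i', w j i = w j' i' → cyclicStep ℓ (c j) i = cyclicStep ℓ (c j') i'}

/-- The letters of the words with index in `P`. -/
def lettersIn (w : J → Fin (m + 1) → α) (P : Finset J) : Set α := ⋃ j ∈ P, Set.range (w j)

/-- The partial families of closed walks with index set `P` number at most
`n ^ (#P + #letters - s)`, up to a power of `D`: each of the walks contributes its starting point,
each letter a label, and `s` is the number of factors `n` that are saved. -/
def FamilyBound (ℓ : V → V → ι) (w : J → Fin (m + 1) → α) (D s : ℕ) (P : Finset J) : Prop :=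
  (P.restrict '' closedWalkFamilies ℓ w).ncard * Nat.card V ^ s ≤
    Nat.card V ^ (P.card + (lettersIn w P).ncard) * D ^ (m * P.card)

variable {ℓ : V → V → ι} {w : J → Fin (m + 1) → α} {D : ℕ}

lemma familyBound_empty [Finite V] : FamilyBound ℓ w D 0 ∅ := by
  simpa [FamilyBound, lettersIn] using
    Set.ncard_le_card (Finset.restrict ∅ '' closedWalkFamilies ℓ w)

lemma finite_lettersIn (w : J → Fin (m + 1) → α) (P : Finset J) : (lettersIn w P).Finite :=
  P.finite_toSet.biUnion fun _ _ => Set.finite_range _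

lemma ncard_lettersIn_insert [DecidableEq J] (w : J → Fin (m + 1) → α) (P : Finset J) (j : J) :
    (lettersIn w (insert j P)).ncard =
      (lettersIn w P).ncard + (Set.range (w j) \ lettersIn w P).ncard := by
  rw [← Set.ncard_union_eq Set.disjoint_sdiff_right (finite_lettersIn w P)
    ((Set.finite_range _).sdiff), Set.union_sdiff_self, lettersIn, Finset.set_biUnion_insert,
    Set.union_comm, lettersIn]

lemma exists_labels_of_mem_closedWalkFamilies {c₀ : J → Fin (m + 1) → V}
    (hc₀ : c₀ ∈ closedWalkFamilies ℓ w) (P : Finset J) (j : J) : ∃ v : α → ι,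
    ∀ c ∈ closedWalkFamilies ℓ w, P.restrict c = P.restrict c₀ →
      c j ∈ closedWalksWithWord ℓ (w j) (lettersIn w P) v := by
  have : Nonempty ι := ⟨cyclicStep ℓ (c₀ j) 0⟩
  have hlabel (a : α) : ∃ t : ι, ∀ k ∈ P, ∀ i, w k i = a → cyclicStep ℓ (c₀ k) i = t := by
    by_cases ha : ∃ k ∈ P, ∃ i, w k i = a
    · obtain ⟨k, -, i, rfl⟩ := ha
      exact ⟨cyclicStep ℓ (c₀ k) i, fun k' _ i' h => hc₀ _ _ _ _ h⟩
    · exact ⟨Classical.arbitrary ι, fun k hk i h => (ha ⟨k, hk, i, h⟩).elim⟩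
  choose v hv using hlabel
  refine ⟨v, fun c hc hres => ⟨fun i hi => ?_, fun i i' h => hc _ _ _ _ h⟩⟩
  obtain ⟨k, hk, i', hi'⟩ : ∃ k ∈ P, ∃ i', w k i' = w j i := by simpa [lettersIn] using hi
  have hck : c k = c₀ k := congrFun hres ⟨k, hk⟩
  rw [hc _ _ _ _ hi'.symm, hck]
  exact hv _ k hk i' hi'

section DecidableEq

variable [DecidableEq J]

lemma ncard_restrict_insert_le [Finite V] {P : Finset J} {j : J} {M : ℕ}
    (hM : ∀ v : α → ι, (closedWalksWithWord ℓ (w j) (lettersIn w P) v).ncard ≤ M) :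
    ((insert j P).restrict '' closedWalkFamilies ℓ w).ncard ≤
      M * (P.restrict '' closedWalkFamilies ℓ w).ncard := by
  let forget := Finset.restrict₂ (π := fun _ : J => Fin (m + 1) → V) (P.subset_insert j)
  have himage : forget '' ((insert j P).restrict '' closedWalkFamilies ℓ w) =
      P.restrict '' closedWalkFamilies ℓ w := by
    rw [← Set.image_comp, Finset.restrict₂_comp_restrict]
  rw [← himage]
  refine ncard_le_mul_ncard_image _ forget M ?_
  rintro _ ⟨_, ⟨c₀, hc₀, rfl⟩, rfl⟩
  obtain ⟨v, hv⟩ := exists_labels_of_mem_closedWalkFamilies hc₀ P j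
  refine (Set.ncard_le_ncard_of_injOn (fun b => b ⟨j, P.mem_insert_self j⟩) ?_ ?_).trans (hM v)
  · rintro _ ⟨⟨c, hc, rfl⟩, hres⟩
    exact hv c hc hres
  · rintro b ⟨-, hb⟩ b' ⟨-, hb'⟩ hbj
    funext ⟨k, hk⟩
    rcases Finset.mem_insert.1 hk with rfl | hkP
    · exact hbj
    · exact congrFun (hb.trans hb'.symm) ⟨k, hkP⟩

lemma FamilyBound.insert_member [Finite V] (hD : ∀ x t, {y | ℓ x y = t}.ncard ≤ D) {s : ℕ}
    {P : Finset J} (h : FamilyBound ℓ w D s P) {j : J} (hj : j ∉ P) :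
    FamilyBound ℓ w D s (insert j P) := by
  unfold FamilyBound at *
  rw [Finset.card_insert_of_notMem hj, ncard_lettersIn_insert]
  set N := (P.restrict '' closedWalkFamilies ℓ w).ncard
  set r := (Set.range (w j) \ lettersIn w P).ncard
  calc _ ≤ Nat.card V ^ (1 + r) * D ^ m * N * Nat.card V ^ s := by
        gcongr
        exact ncard_restrict_insert_le fun v => ncard_closedWalksWithWord_le hD _ _ v
    _ = Nat.card V ^ (1 + r) * D ^ m * (N * Nat.card V ^ s) := by ring
    _ ≤ Nat.card V ^ (1 + r) * D ^ m *
        (Nat.card V ^ (P.card + (lettersIn w P).ncard) * D ^ (m * P.card)) := by gcongr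
    _ = _ := by ring

lemma FamilyBound.insert_of_unique [Finite V] (hD : ∀ x t, {y | ℓ x y = t}.ncard ≤ D) {s : ℕ}
    {P : Finset J} (h : FamilyBound ℓ w D s P) {j : J} (hj : j ∉ P) {i₀ : Fin (m + 1)}
    (hK : w j i₀ ∉ lettersIn w P) (hunique : ∀ i, w j i = w j i₀ → i = i₀) :
    FamilyBound ℓ w D (s + 1) (insert j P) := by
  unfold FamilyBound at *
  rw [Finset.card_insert_of_notMem hj, ncard_lettersIn_insert]
  set N := (P.restrict '' closedWalkFamilies ℓ w).ncard
  set r := (Set.range (w j) \ lettersIn w P).ncard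
  calc _ ≤ Nat.card V ^ r * D ^ m * N * Nat.card V ^ (s + 1) := by
        gcongr
        exact ncard_restrict_insert_le fun v =>
          ncard_closedWalksWithWord_le_of_unique hD _ _ v hK hunique
    _ = Nat.card V ^ (1 + r) * D ^ m * (N * Nat.card V ^ s) := by ring
    _ ≤ Nat.card V ^ (1 + r) * D ^ m *
        (Nat.card V ^ (P.card + (lettersIn w P).ncard) * D ^ (m * P.card)) := by gcongr
    _ = _ := by ring

lemma FamilyBound.union [Finite V] (hD : ∀ x t, {y | ℓ x y = t}.ncard ≤ D) {s : ℕ}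
    {P : Finset J} (h : FamilyBound ℓ w D s P) (Q : Finset J) : FamilyBound ℓ w D s (Q ∪ P) := by
  induction Q using Finset.induction_on with
  | empty => simpa using h
  | insert j Q _ ih =>
    rw [Finset.insert_union]
    by_cases hj : j ∈ Q ∪ P
    · rwa [Finset.insert_eq_of_mem hj]
    · exact ih.insert_member hD hj

end DecidableEq

lemma FamilyBound.ncard_le [Finite V] [Fintype J] (hD : ∀ x t, {y | ℓ x y = t}.ncard ≤ D)
    {s : ℕ} {P : Finset J} (h : FamilyBound ℓ w D s P) :
    (closedWalkFamilies ℓ w).ncard * Nat.card V ^ s ≤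
      Nat.card V ^ (Fintype.card J + (lettersIn w Finset.univ).ncard) *
        D ^ (m * Fintype.card J) := by
  classical
  have hinj : Function.Injective
      (Finset.univ.restrict : (J → Fin (m + 1) → V) → _) := fun c c' hc =>
    funext fun j => congrFun hc ⟨j, Finset.mem_univ j⟩
  have huniv : FamilyBound ℓ w D s Finset.univ := by
    simpa only [Finset.union_eq_left.2 (Finset.subset_univ P)] using h.union hD Finset.univ
  rwa [FamilyBound, Set.ncard_image_of_injective _ hinj, Finset.card_univ] at huniv

end Families

end Walks

/-! ### Quadruples of closed walks -/

section Letters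

variable {E α : Type*}

/-- The number of occurrences of the letter `a` in the word `f`, whose positions may form any type;
it is meant for finitely many positions. -/
noncomputable def letterCount (f : E → α) (a : α) : ℕ := {e | f e = a}.ncard

/-- Every letter occurs at least twice. -/
def IsMatched (f : E → α) : Prop := ∀ e, 2 ≤ letterCount f (f e)

lemma letterCount_eq_card [Fintype E] [DecidableEq α] (f : E → α) (a : α) :
    letterCount f a = (Finset.univ.filter fun e => f e = a).card := by
  rw [letterCount, ← Set.ncard_coe_finset, Finset.coe_filter]
  simp only [Finset.mem_univ, true_and]

variable [Finite E] {f : E → α}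

lemma two_le_letterCount {e e' : E} (hne : e' ≠ e) (he : f e' = f e) :
    2 ≤ letterCount f (f e) :=
  (Set.one_lt_ncard).2 ⟨e', he, e, rfl, hne⟩

lemma eq_or_eq_of_letterCount_le_two {e e' x : E} (h : letterCount f (f e) ≤ 2) (hne : e' ≠ e)
    (he : f e' = f e) (hx : f x = f e) : x = e ∨ x = e' := by
  by_contra! hxe
  exact h.not_gt ((Set.two_lt_ncard).2 ⟨x, hx, e, rfl, e', he, hxe.1, hxe.2, hne.symm⟩)

lemma sum_letterCount {T : Finset α} (hT : ∀ e, f e ∈ T) :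
    ∑ a ∈ T, letterCount f a = Nat.card E := by
  classical
  have := Fintype.ofFinite E
  simp only [letterCount_eq_card, Nat.card_eq_fintype_card, ← Finset.card_univ]
  exact (Finset.card_eq_sum_card_fiberwise fun e _ => hT e).symm

lemma not_isMatched_iff : ¬ IsMatched f ↔ ∃ e₀, ∀ e, f e = f e₀ → e = e₀ := by
  simp only [IsMatched, not_forall, not_le]
  refine exists_congr fun e₀ => ⟨fun h e he => by_contra fun hne =>
    h.not_ge (two_le_letterCount hne he), fun h => Nat.lt_succ_of_le ?_⟩
  exact (Set.ncard_le_one_iff).2 fun he he' => (h _ he).trans (h _ he').symm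

/-- The occurrences of a letter beyond the second are lost for the number of letters. -/
lemma IsMatched.sum_letterCount_add_le (hf : IsMatched f) {T : Finset α}
    (hT : ∀ a ∈ T, a ∈ Set.range f) :
    ∑ a ∈ T, letterCount f a + 2 * (Set.range f).ncard ≤ Nat.card E + 2 * T.card := by
  classical
  set R := (Set.finite_range f).toFinset with hR
  have hsub : T ⊆ R := fun a ha => by simpa [hR] using hT a ha
  have hrest : 2 * (R \ T).card ≤ ∑ a ∈ R \ T, letterCount f a := by
    rw [mul_comm, ← smul_eq_mul, ← Finset.sum_const]
    refine Finset.sum_le_sum fun a ha => ?_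
    obtain ⟨e, rfl⟩ : a ∈ Set.range f := by simpa [hR] using (Finset.mem_sdiff.1 ha).1
    exact hf e
  have htotal := sum_letterCount (f := f) (T := R) fun e => by simp [hR]
  rw [← Finset.sum_sdiff hsub] at htotal
  have hcard := Finset.card_sdiff_add_card_eq_card hsub
  rw [Set.ncard_eq_toFinset_card (Set.range f) (Set.finite_range f)]
  lia

end Letters

section Quadruples

variable {J F α : Type*}

/-- Each of the words `w j` has a letter in common with another one. -/
def IsCrossMatched (w : J → F → α) : Prop := ∀ j, ∃ i, ∃ j' ≠ j, ∃ i', w j' i' = w j i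

lemma sum_letterCount_le_letterCount_uncurry [Finite J] [Finite F] (w : J → F → α)
    (S : Finset J) (a : α) :
    ∑ j ∈ S, letterCount (w j) a ≤ letterCount (Function.uncurry w) a := by
  classical
  have := Fintype.ofFinite F
  rw [Finset.sum_congr rfl fun j _ => letterCount_eq_card (w j) a, ← Finset.card_sigma,
    ← Set.ncard_coe_finset]
  refine Set.ncard_le_ncard_of_injOn (fun e => (e.1, e.2)) ?_ ?_
  · rintro ⟨j, i⟩ he
    simpa using (Finset.mem_sigma.1 he).2
  · rintro ⟨j, i⟩ - ⟨j', i'⟩ - he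
    obtain ⟨rfl, rfl⟩ := Prod.mk.inj he
    rfl

lemma two_mul_card_le_letterCount_uncurry [Finite J] [Finite F] {w : J → F → α}
    (hw : ∀ j, IsMatched (w j)) {S : Finset J} {a : α} (hS : ∀ j ∈ S, a ∈ Set.range (w j)) :
    2 * S.card ≤ letterCount (Function.uncurry w) a := by
  refine le_trans ?_ (sum_letterCount_le_letterCount_uncurry w S a)
  rw [mul_comm, ← smul_eq_mul, ← Finset.sum_const]
  refine Finset.sum_le_sum fun j hj => ?_
  obtain ⟨i, rfl⟩ := hS j hj
  exact hw j i

lemma exists_ne_and_ne (a b : Fin 4) : ∃ j : Fin 4, j ≠ a ∧ j ≠ b := by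
  revert a b; decide

lemma ncard_range_uncurry_add_two_le [Finite F] {w : Fin 4 → F → α}
    (hw : ∀ j, IsMatched (w j)) (hcross : IsCrossMatched w) :
    (Set.range (Function.uncurry w)).ncard + 2 ≤ 2 * Nat.card F := by
  classical
  have hmatched : IsMatched (Function.uncurry w) := fun ⟨j, i⟩ => by
    simpa using two_mul_card_le_letterCount_uncurry (a := w j i) hw (S := {j}) (by simp)
  have hrange {j : Fin 4} {a : α} (ha : a ∈ Set.range (w j)) :
      a ∈ Set.range (Function.uncurry w) := by
    obtain ⟨i, rfl⟩ := ha
    exact ⟨(j, i), rfl⟩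
  have hcard : Nat.card (Fin 4 × F) = 4 * Nat.card F := by simp
  obtain ⟨i, k, hk, hak⟩ := hcross 0
  obtain ⟨j, hj0, hjk⟩ := exists_ne_and_ne 0 k
  obtain ⟨i', l, hl, hbl⟩ := hcross j
  set a := w 0 i
  set b := w j i'
  have ha0 : a ∈ Set.range (w 0) := ⟨i, rfl⟩
  have hbj : b ∈ Set.range (w j) := ⟨i', rfl⟩
  by_cases hab : a = b
  · have hcount := two_mul_card_le_letterCount_uncurry hw (S := {0, k, j}) (a := a)
      (by simpa using ⟨ha0, hak, hab ▸ hbj⟩)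
    have hexcess := hmatched.sum_letterCount_add_le (T := {a}) (by simpa using hrange ha0)
    simp only [Finset.sum_singleton, Finset.card_singleton] at hexcess
    rw [Finset.card_insert_of_notMem (by simp [hk.symm, hj0.symm]),
      Finset.card_pair hjk.symm] at hcount
    lia
  · have hcounta := two_mul_card_le_letterCount_uncurry hw (S := {0, k}) (a := a)
      (by simpa using ⟨ha0, hak⟩)
    have hcountb := two_mul_card_le_letterCount_uncurry hw (S := {j, l}) (a := b)
      (by simpa using ⟨hbj, hbl⟩)
    have hexcess := hmatched.sum_letterCount_add_le (T := {a, b})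
      (by simpa [-Set.mem_range] using ⟨hrange ha0, hrange hbj⟩)
    rw [Finset.sum_pair hab, Finset.card_pair hab] at hexcess
    rw [Finset.card_pair hk.symm] at hcounta
    rw [Finset.card_pair hl.symm] at hcountb
    lia

lemma exists_pair_unique_occurrences [Finite F] {w : Fin 4 → F → α} (hcross : IsCrossMatched w)
    (hcount : ∀ e, letterCount (Function.uncurry w) (Function.uncurry w e) ≤ 2) :
    ∃ j k, k ≠ j ∧ ∃ i i', (∀ x, w j x = w j i → x = i) ∧ (∀ x, w k x = w k i' → x = i') ∧
      ∀ x, w j x ≠ w k i' := by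
  have hpair {j k l : Fin 4} {i i' x : F} (hkj : k ≠ j) (he : w k i' = w j i)
      (hx : w l x = w j i) : (l = j ∧ x = i) ∨ (l = k ∧ x = i') := by
    simpa using eq_or_eq_of_letterCount_le_two (f := Function.uncurry w) (e := (j, i))
      (e' := (k, i')) (x := (l, x)) (hcount _) (by simp [hkj]) he hx
  obtain ⟨i, p, hp, i', he⟩ := hcross 0
  obtain ⟨k, hk0, hkp⟩ := exists_ne_and_ne 0 p
  obtain ⟨y, q, hq, y', hy⟩ := hcross k
  by_cases hq0 : q = 0
  · refine ⟨k, p, hkp.symm, y, i', ?_, ?_, ?_⟩ <;> grind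
  · refine ⟨0, k, hk0, i, y, ?_, ?_, ?_⟩ <;> grind

variable {V ι : Type*} {m : ℕ} {ℓ : V → V → ι} {D : ℕ}

lemma lettersIn_univ [Fintype J] (w : J → Fin (m + 1) → α) :
    lettersIn w Finset.univ = Set.range (Function.uncurry w) := by
  ext a
  simp [lettersIn]

lemma FamilyBound.ncard_le_of_ncard_range_le [Finite V]
    (hD : ∀ x t, {y | ℓ x y = t}.ncard ≤ D) {w : Fin 4 → Fin (m + 1) → α} {s : ℕ}
    {P : Finset (Fin 4)} (hP : FamilyBound ℓ w D s P)
    (hs : (Set.range (Function.uncurry w)).ncard + 2 ≤ 2 * (m + 1) + s) :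
    (closedWalkFamilies ℓ w).ncard ≤ Nat.card V ^ (2 * (m + 1) + 2) * D ^ (4 * m) := by
  rcases isEmpty_or_nonempty V with hV | hV
  · simp [Set.eq_empty_of_isEmpty (closedWalkFamilies ℓ w)]
  have hV_pos : 0 < Nat.card V := Nat.card_pos
  refine Nat.le_of_mul_le_mul_right (c := Nat.card V ^ s) ?_ (by positivity)
  calc (closedWalkFamilies ℓ w).ncard * Nat.card V ^ s
      ≤ Nat.card V ^ (4 + (Set.range (Function.uncurry w)).ncard) * D ^ (4 * m) := by
        simpa [lettersIn_univ, mul_comm m] using hP.ncard_le hD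
    _ ≤ Nat.card V ^ (2 * (m + 1) + 2 + s) * D ^ (4 * m) := by
        gcongr ?_ * _
        exact Nat.pow_le_pow_right hV_pos (by lia)
    _ = _ := by ring

/-- Occurrences of letters beyond the second save vertices; if there are too few of them, then walks
closed up by a letter without another occurrence in the walk do. -/
theorem ncard_closedWalkFamilies_four_le [Finite V] (hD : ∀ x t, {y | ℓ x y = t}.ncard ≤ D)
    {w : Fin 4 → Fin (m + 1) → α} (hw : IsMatched (Function.uncurry w))
    (hcross : IsCrossMatched w) :
    (closedWalkFamilies ℓ w).ncard ≤ Nat.card V ^ (2 * (m + 1) + 2) * D ^ (4 * m) := by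
  have hempty := familyBound_empty (ℓ := ℓ) (w := w) (D := D)
  have hcard : Nat.card (Fin 4 × Fin (m + 1)) = 4 * (m + 1) := by simp
  have hletters := hw.sum_letterCount_add_le (T := ∅) (by simp)
  rw [Finset.sum_empty, Finset.card_empty, hcard] at hletters
  by_cases hself : ∀ j, IsMatched (w j)
  · exact hempty.ncard_le_of_ncard_range_le hD
      (by simpa using ncard_range_uncurry_add_two_le hself hcross)
  by_cases hfew : (Set.range (Function.uncurry w)).ncard + 1 ≤ 2 * (m + 1)
  · obtain ⟨j, hj⟩ := not_forall.1 hself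
    obtain ⟨i, hi⟩ := not_isMatched_iff.1 hj
    have hone := hempty.insert_of_unique hD (j := j) (by simp) (by simp [lettersIn]) hi
    exact hone.ncard_le_of_ncard_range_le hD (by lia)
  · have htwice (e) : letterCount (Function.uncurry w) (Function.uncurry w e) ≤ 2 := by
      have := hw.sum_letterCount_add_le (T := {Function.uncurry w e})
        fun a ha => ⟨e, (Finset.mem_singleton.1 ha).symm⟩
      rw [Finset.sum_singleton, Finset.card_singleton, hcard] at this
      lia
    obtain ⟨j, k, hkj, i, i', hi, hi', hne⟩ := exists_pair_unique_occurrences hcross htwice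
    have hone := hempty.insert_of_unique hD (j := j) (by simp) (by simp [lettersIn]) hi
    have htwo := hone.insert_of_unique hD (j := k) (by simpa using hkj)
      (by simpa [lettersIn] using hne) hi'
    exact htwo.ncard_le_of_ncard_range_le hD (by lia)

end Quadruples

/-! ### Words -/

section Words

variable {h : ℕ}

/-- The letter of `f i` is the rank of its first occurrence among the first occurrences. -/
lemma exists_word {α : Type*} (f : Fin h → α) :
    ∃ W : Word h, ∀ i j, W.letter i = W.letter j ↔ f i = f j := by
  classical
  let first (i : Fin h) : Fin h := wellFounded_lt.min {j | f j = f i} ⟨i, rfl⟩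
  have first_le (i) : first i ≤ i := wellFounded_lt.min_le (s := {j | f j = f i}) rfl
  have map_first (i) : f (first i) = f i := wellFounded_lt.min_mem {j | f j = f i} _
  have first_congr {i j} (hij : f i = f j) : first i = first j := by simp only [first, hij]
  let R := Finset.univ.image first
  let rank := R.orderIsoOfFin rfl
  let occ (i : Fin h) : R := ⟨first i, Finset.mem_image_of_mem _ (Finset.mem_univ i)⟩
  refine ⟨⟨fun i => rank.symm (occ i), fun i m hm => ?_⟩, fun i j => ?_⟩
  · let q := rank ⟨m, hm.trans (rank.symm (occ i)).2⟩
    obtain ⟨j, -, hj⟩ := Finset.mem_image.1 q.2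
    have hqi : q < occ i := (rank.lt_symm_apply).1 hm
    have hqq : occ q = q := Subtype.ext (hj ▸ first_congr (map_first j))
    exact ⟨q, lt_of_lt_of_le hqi (first_le i), by simp [hqq, q]⟩
  · rw [Fin.val_inj, rank.symm.injective.eq_iff, Subtype.mk_eq_mk]
    exact ⟨fun hij => by rw [← map_first i, hij, map_first j], first_congr⟩

namespace Word

lemma ext_letter {W W' : Word h} (he : ∀ i, W.letter i = W'.letter i) : W = W' := by
  cases W; cases W'; congr; exact funext he

lemma letter_le_of_agree {W W' : Word h} {i : Fin h} (hlt : ∀ j < i, W.letter j = W'.letter j)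
    (hfirst : ∀ j < i, W.letter j ≠ W.letter i) : W'.letter i ≤ W.letter i := by
  by_contra! hcon
  obtain ⟨j, hj, he⟩ := W'.alphabetical i _ hcon
  exact hfirst j hj (by rw [hlt j hj, he])

/-- A first occurrence is forced to carry the next letter of the alphabet. -/
lemma eq_of_agree_at_repetitions {W W' : Word h}
    (h₁ : ∀ i, (∀ j < i, W.letter j = W'.letter j) → (∃ j < i, W.letter j = W.letter i) →
      W.letter i = W'.letter i)
    (h₂ : ∀ i, (∀ j < i, W'.letter j = W.letter j) → (∃ j < i, W'.letter j = W'.letter i) →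
      W'.letter i = W.letter i) : W = W' := by
  refine ext_letter fun i => ?_
  induction i using WellFoundedLT.induction with
  | ind i ih =>
    have ih' : ∀ j < i, W'.letter j = W.letter j := fun j hj => (ih j hj).symm
    by_cases hrep : ∃ j < i, W.letter j = W.letter i
    · exact h₁ i ih hrep
    by_cases hrep' : ∃ j < i, W'.letter j = W'.letter i
    · exact (h₂ i ih' hrep').symm
    push Not at hrep hrep'
    exact le_antisymm (letter_le_of_agree ih' hrep') (letter_le_of_agree ih hrep)

lemma eq_of_forall_iff {W W' : Word h}
    (he : ∀ i j, W.letter i = W.letter j ↔ W'.letter i = W'.letter j) : W = W' := by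
  refine eq_of_agree_at_repetitions ?_ ?_
  · rintro i ih ⟨j, hj, hji⟩
    rw [← hji, ih j hj, (he j i).1 hji]
  · rintro i ih ⟨j, hj, hji⟩
    rw [← hji, ih j hj, (he j i).2 hji]

namespace PairMatched

lemma letter_lt {k : ℕ} {W : Word (2 * k)} (hW : W.PairMatched) (i : Fin (2 * k)) :
    W.letter i < k := by
  classical
  have hcard : 2 * (Finset.univ.image W.letter).card = 2 * k := by
    refine Eq.trans ?_ ((sum_letterCount (f := W.letter) fun e =>
      Finset.mem_image_of_mem _ (Finset.mem_univ e)).trans (Nat.card_fin _))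
    rw [mul_comm, ← smul_eq_mul, ← Finset.sum_const]
    refine Finset.sum_congr rfl fun a ha => ?_
    obtain ⟨j, -, rfl⟩ := Finset.mem_image.1 ha
    exact (hW j).symm
  have hsub : Finset.range (W.letter i + 1) ⊆ Finset.univ.image W.letter := fun a ha => by
    rcases (Nat.lt_succ_iff.1 (Finset.mem_range.1 ha)).eq_or_lt with rfl | hlt
    · exact Finset.mem_image_of_mem _ (Finset.mem_univ i)
    · obtain ⟨j, -, rfl⟩ := W.alphabetical i a hlt
      exact Finset.mem_image_of_mem _ (Finset.mem_univ j)
  have := Finset.card_le_card hsub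
  rw [Finset.card_range] at this
  lia

lemma eq_of_repetition {W : Word h} (hW : W.PairMatched) {j i p : Fin h} (hji : j < i)
    (hj : W.letter j = W.letter i) (hip : i ≤ p) (hp : W.letter p = W.letter i) : p = i := by
  obtain ⟨x, y, -, hxy⟩ := Set.ncard_eq_two.1 (hW i)
  have hmem {z} (hz : W.letter z = W.letter i) : z = x ∨ z = y := by
    have : z ∈ {z | W.letter z = W.letter i} := hz
    rwa [hxy] at this
  have := hmem hj
  have := hmem hp
  have := hmem (z := i) rfl
  grind

end PairMatched

lemma exists_last_occurrence {k : ℕ} (W : Word (2 * k)) (a : Fin k) :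
    ∃ p, ∀ i, W.letter i = a → W.letter p = a ∧ i ≤ p := by
  by_cases ha : {i | W.letter i = a}.Nonempty
  · obtain ⟨p, hp, hmax⟩ := Set.exists_max_image _ id (Set.toFinite _) ha
    exact ⟨p, fun i hi => ⟨hp, hmax i hi⟩⟩
  · exact ⟨⟨a, by lia⟩, fun i hi => (ha ⟨i, hi⟩).elim⟩

/-- The injection maps a word to the positions of the second occurrences of its letters. -/
lemma exists_injective_pairMatched (k : ℕ) :
    ∃ s : {W : Word (2 * k) // W.PairMatched} → Fin k → Fin (2 * k), Function.Injective s := by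
  choose s hs using fun W : {W : Word (2 * k) // W.PairMatched} => exists_last_occurrence W.1
  refine ⟨s, fun W W' hWW' => Subtype.ext ?_⟩
  have hrep {U U' : {W : Word (2 * k) // W.PairMatched}} (hUU' : s U = s U') (i : Fin (2 * k))
      (ih : ∀ j < i, U.1.letter j = U'.1.letter j) (hi : ∃ j < i, U.1.letter j = U.1.letter i) :
      U.1.letter i = U'.1.letter i := by
    obtain ⟨j, hji, hj⟩ := hi
    let a : Fin k := ⟨U.1.letter i, U.2.letter_lt i⟩
    obtain ⟨hlast, hle⟩ := hs U a i rfl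
    have hsi : s U a = i := U.2.eq_of_repetition hji hj hle hlast
    have hlast' := (hs U' a j ((ih j hji).symm.trans hj)).1
    rw [← hUU', hsi] at hlast'
    exact hlast'.symm
  exact eq_of_agree_at_repetitions (hrep hWW') (hrep hWW'.symm)

instance finite_pairMatched (k : ℕ) : Finite {W : Word (2 * k) // W.PairMatched} := by
  obtain ⟨s, hs⟩ := exists_injective_pairMatched k
  exact Finite.of_injective s hs

lemma card_pairMatched_le (k : ℕ) :
    Nat.card {W : Word (2 * k) // W.PairMatched} ≤ (2 * k) ^ k := by
  obtain ⟨s, hs⟩ := exists_injective_pairMatched k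
  simpa [Nat.card_fun] using Nat.card_le_card_of_injective s hs

end Word

end Words

/-! ### Pair-matched circuits -/

namespace SymmLink

variable {ι : Type u}

lemma PropertyB.exists_bound {L : SymmLink ι} (hB : L.PropertyB) :
    ∃ D : ℕ, 1 ≤ D ∧ ∀ n (k : Fin n) t, {l | L.toFun n k l = t}.ncard ≤ D := by
  obtain ⟨D, hD⟩ := ENat.ne_top_iff_exists.1 (ne_of_lt hB)
  refine ⟨max 1 D, le_max_left _ _, fun n k t => ?_⟩
  by_cases ht : t ∈ L.values n
  · have hle : Set.encard {l | L.toFun n k l = t} ≤ L.rowMultiplicity :=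
      le_iSup_of_le n (le_iSup_of_le t (le_iSup_of_le ht (le_iSup_of_le k le_rfl)))
    rw [← hD, ← Set.Finite.cast_ncard_eq (Set.toFinite _), ENat.natCast_le_natCast] at hle
    exact hle.trans (le_max_right _ _)
  · have hempty : {l | L.toFun n k l = t} = ∅ :=
      Set.eq_empty_of_forall_notMem fun l hl => ht ⟨(k, l), hl⟩
    simp [hempty]

/-- The circuits of length `h` in `{1, …, n}` in which each label occurs exactly twice. -/
def pairCircuits (L : SymmLink ι) (h n : ℕ) : Set (Fin (h + 1) → Fin n) :=
  {π | π 0 = π (Fin.last h) ∧ ∀ i, letterCount (L.stepValue π) (L.stepValue π i) = 2}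

lemma pairCircuits_eq_iUnion (L : SymmLink ι) (k n : ℕ) :
    L.pairCircuits (2 * k) n = ⋃ W : {W : Word (2 * k) // W.PairMatched}, L.circuits W.1 n := by
  ext π
  rw [Set.mem_iUnion]
  constructor
  · rintro ⟨hclosed, hcount⟩
    obtain ⟨W, hW⟩ := exists_word (L.stepValue π)
    exact ⟨⟨W, fun i => by simpa only [hW, letterCount] using hcount i⟩, hclosed, hW⟩
  · rintro ⟨⟨W, hmatched⟩, hclosed, hW⟩
    exact ⟨hclosed, fun i => by simpa only [letterCount, ← hW] using hmatched i⟩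

lemma ncard_pairCircuits (L : SymmLink ι) (k n : ℕ)
    [Fintype {W : Word (2 * k) // W.PairMatched}] :
    (L.pairCircuits (2 * k) n).ncard =
      ∑ W : {W : Word (2 * k) // W.PairMatched}, (L.circuits W.1 n).ncard := by
  rw [pairCircuits_eq_iUnion, Set.ncard_iUnion_of_finite (fun _ => Set.toFinite _) ?_,
    finsum_eq_sum_of_fintype]
  refine fun W W' hne => Set.disjoint_left.2 fun π hπ hπ' => hne (Subtype.ext ?_)
  exact Word.eq_of_forall_iff fun i j => (hπ.2 i j).trans (hπ'.2 i j).symm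

lemma pairCircuits_odd (L : SymmLink ι) (k n : ℕ) : L.pairCircuits (2 * k + 1) n = ∅ := by
  classical
  refine Set.eq_empty_of_forall_notMem fun π hπ => ?_
  have hsum := sum_letterCount (T := Finset.univ.image (L.stepValue π))
    fun i => Finset.mem_image_of_mem _ (Finset.mem_univ i)
  rw [Finset.sum_congr rfl (g := fun _ => 2), Finset.sum_const, smul_eq_mul, Nat.card_fin] at hsum
  · lia
  · intro a ha
    obtain ⟨j, -, rfl⟩ := Finset.mem_image.1 ha
    exact hπ.2 j

section Bound

variable {L : SymmLink ι} {D : ℕ}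

lemma ncard_circuits_le (hD : ∀ n (k : Fin n) t, {l | L.toFun n k l = t}.ncard ≤ D) {k : ℕ}
    {W : Word (2 * k)} (hW : W.PairMatched) (n : ℕ) :
    (L.circuits W n).ncard ≤ n ^ (1 + k) * D ^ (2 * k) := by
  rcases Nat.eq_zero_or_pos n with rfl | hn
  · simp [Set.eq_empty_of_isEmpty (L.circuits W 0)]
  let v : ℕ → ι := fun _ => L.toFun n ⟨0, hn⟩ ⟨0, hn⟩
  have hsub : L.circuits W n ⊆ walksWithWord (L.toFun n) W.letter ∅ v :=
    fun π hπ => ⟨fun i hi => hi.elim, fun i j => (hπ.2 i j).1⟩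
  have hletters : (Set.range W.letter \ ∅).ncard ≤ k := by
    refine (Set.ncard_le_ncard ?_ (Set.finite_Iio k)).trans_eq (Set.ncard_Iio_nat k)
    rintro _ ⟨⟨i, rfl⟩, -⟩
    exact hW.letter_lt i
  calc (L.circuits W n).ncard ≤ Nat.card (Fin n) ^ (1 + (Set.range W.letter \ ∅).ncard) *
        D ^ (2 * k) := (Set.ncard_le_ncard hsub).trans (ncard_walksWithWord_le (hD n) _ _ v)
    _ ≤ n ^ (1 + k) * D ^ (2 * k) := by
        rw [Nat.card_fin]
        gcongr

lemma ncard_pairCircuits_le (hD : ∀ n (k : Fin n) t, {l | L.toFun n k l = t}.ncard ≤ D)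
    (k n : ℕ) :
    (L.pairCircuits (2 * k) n).ncard ≤ (2 * k) ^ k * (n ^ (1 + k) * D ^ (2 * k)) := by
  have := Fintype.ofFinite {W : Word (2 * k) // W.PairMatched}
  rw [ncard_pairCircuits]
  calc _ ≤ ∑ _W : {W : Word (2 * k) // W.PairMatched}, n ^ (1 + k) * D ^ (2 * k) :=
        Finset.sum_le_sum fun W _ => ncard_circuits_le hD W.2 n
    _ ≤ _ := by
        rw [Finset.sum_const, smul_eq_mul, Finset.card_univ, ← Nat.card_eq_fintype_card]
        gcongr
        exact Word.card_pairMatched_le k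

end Bound

/-- The normalized numbers of pair-matched circuits converge, for every length, to `β`. -/
def HasPairLimits (L : SymmLink ι) (β : ℕ → ℝ) : Prop :=
  ∀ h, Tendsto (fun n : ℕ => ((L.pairCircuits h n).ncard : ℝ) / (n * √n ^ h)) atTop (𝓝 (β h))

lemma mul_sqrt_pow_two_mul (n k : ℕ) : (n : ℝ) * √n ^ (2 * k) = (n : ℝ) ^ (1 + k) := by
  rw [pow_mul, Real.sq_sqrt (Nat.cast_nonneg n)]; ring

variable {L : SymmLink ι}

lemma WordLimitsExist.exists_hasPairLimits (hL : L.WordLimitsExist) :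
    ∃ β : ℕ → ℝ, L.HasPairLimits β := by
  suffices ∀ h, ∃ b : ℝ, Tendsto (fun n : ℕ =>
      ((L.pairCircuits h n).ncard : ℝ) / (n * √n ^ h)) atTop (𝓝 b) from
    ⟨_, fun h => (this h).choose_spec⟩
  intro h
  obtain ⟨k, rfl | rfl⟩ := Nat.even_or_odd' h
  · have := Fintype.ofFinite {W : Word (2 * k) // W.PairMatched}
    choose p hp using hL k
    refine ⟨∑ W : {W : Word (2 * k) // W.PairMatched}, p W.1 W.2, ?_⟩
    simp only [mul_sqrt_pow_two_mul, ncard_pairCircuits, Nat.cast_sum, Finset.sum_div]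
    exact tendsto_finsetSum _ fun W _ => hp W.1 W.2
  · exact ⟨0, by simp [pairCircuits_odd]⟩

lemma HasPairLimits.le {β : ℕ → ℝ} (hβ : L.HasPairLimits β) {D : ℕ}
    (hD : ∀ n (k : Fin n) t, {l | L.toFun n k l = t}.ncard ≤ D) (k : ℕ) :
    β (2 * k) ≤ ((2 * k) ^ k : ℕ) * (D : ℝ) ^ (2 * k) := by
  refine le_of_tendsto (hβ (2 * k)) ?_
  filter_upwards [eventually_gt_atTop 0] with n hn
  rw [mul_sqrt_pow_two_mul, div_le_iff₀ (pow_pos (Nat.cast_pos.2 hn) _)]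
  calc ((L.pairCircuits (2 * k) n).ncard : ℝ)
      ≤ (((2 * k) ^ k * (n ^ (1 + k) * D ^ (2 * k)) : ℕ) : ℝ) :=
        Nat.cast_le.2 (ncard_pairCircuits_le hD k n)
    _ = _ := by push_cast; ring

end SymmLink

/-! ### Products of independent inputs -/

lemma prod_abs_le_one_add_sum {E : Type*} [Fintype E] (a : E → ℝ) :
    ∏ e, |a e| ≤ 1 + ∑ e, |a e| ^ Fintype.card E := by
  rcases isEmpty_or_nonempty E with hE | hE
  · simp
  obtain ⟨e₀, -, he₀⟩ := Finset.exists_max_image Finset.univ (fun e => |a e|)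
    Finset.univ_nonempty
  calc ∏ e, |a e| ≤ ∏ _e : E, |a e₀| :=
        Finset.prod_le_prod (fun e _ => abs_nonneg _) fun e he => he₀ e he
    _ = |a e₀| ^ Fintype.card E := by simp
    _ ≤ ∑ e, |a e| ^ Fintype.card E :=
        Finset.single_le_sum (f := fun e => |a e| ^ Fintype.card E) (fun e _ => by positivity)
          (Finset.mem_univ e₀)
    _ ≤ _ := le_add_of_nonneg_left zero_le_one

section ProductMoments

variable {Ω : Type*} [MeasurableSpace Ω] {P : Measure Ω} [IsProbabilityMeasure P]
  {E : Type*} [Fintype E] {Y : E → Ω → ℝ}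

lemma integrable_prod_of_integrable_pow (hY : ∀ e, Measurable (Y e))
    (hint : ∀ e, Integrable (fun ω => |Y e ω| ^ Fintype.card E) P) :
    Integrable (fun ω => ∏ e, Y e ω) P := by
  refine ((integrable_const (1 : ℝ)).add (integrable_finsetSum Finset.univ fun e _ =>
    hint e)).mono' (Finset.measurable_fun_prod _ fun e _ => hY e).aestronglyMeasurable
    (ae_of_all _ fun ω => ?_)
  rw [Real.norm_eq_abs, Finset.abs_prod]
  simpa using prod_abs_le_one_add_sum fun e => Y e ω

lemma integral_prod_abs_le {M : ℝ}
    (hint : ∀ e, Integrable (fun ω => |Y e ω| ^ Fintype.card E) P)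
    (hM : ∀ e, ∫ ω, |Y e ω| ^ Fintype.card E ∂P ≤ M) :
    ∫ ω, ∏ e, |Y e ω| ∂P ≤ 1 + Fintype.card E * M := by
  have hsum := integrable_finsetSum Finset.univ fun e _ => hint e
  calc ∫ ω, ∏ e, |Y e ω| ∂P ≤ ∫ ω, (1 + ∑ e, |Y e ω| ^ Fintype.card E) ∂P :=
        integral_mono_of_nonneg
          (ae_of_all _ fun ω => Finset.prod_nonneg fun e _ => abs_nonneg _)
          ((integrable_const 1).add hsum) (ae_of_all _ fun ω => prod_abs_le_one_add_sum _)
    _ = 1 + ∑ e, ∫ ω, |Y e ω| ^ Fintype.card E ∂P := by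
        rw [integral_add (integrable_const 1) hsum, integral_finsetSum _ fun e _ => hint e]
        simp
    _ ≤ 1 + ∑ _e : E, M := by gcongr with e; exact hM e
    _ = _ := by simp

end ProductMoments

section GeneratedSigmaAlgebra

variable {ι Ω : Type*} {x : ι → Ω → ℝ}

/-- The σ-algebra generated by the variables with index in `S`. -/
abbrev sigmaOf (x : ι → Ω → ℝ) (S : Set ι) : MeasurableSpace Ω :=
  ⨆ t ∈ S, MeasurableSpace.comap (x t) inferInstance

lemma measurable_sigmaOf {S : Set ι} {t : ι} (ht : t ∈ S) : Measurable[sigmaOf x S] (x t) :=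
  (comap_measurable (x t)).mono (le_iSup₂_of_le t ht le_rfl) le_rfl

lemma measurable_sigmaOf_prod {S : Set ι} {E : Type*} (s : Finset E) {f : E → ι}
    (hf : ∀ e ∈ s, f e ∈ S) : Measurable[sigmaOf x S] fun ω => ∏ e ∈ s, x (f e) ω :=
  Finset.measurable_fun_prod (m := sigmaOf x S) s fun e he => measurable_sigmaOf (hf e he)

end GeneratedSigmaAlgebra

section Products

variable {ι : Type u} {Ω : Type w} [mΩ : MeasurableSpace Ω] {P : Measure Ω} {x : ι → Ω → ℝ}
  {E J F : Type*} [Fintype E] [Fintype F]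

/-- The product of the inputs along a sequence of labels, minus its mean. -/
noncomputable def centeredProduct (x : ι → Ω → ℝ) (P : Measure Ω) (f : E → ι) (ω : Ω) : ℝ :=
  ∏ e, x (f e) ω - ∫ ω', ∏ e, x (f e) ω' ∂P

lemma measurable_sigmaOf_centeredProduct {S : Set ι} {f : E → ι} (hf : ∀ e, f e ∈ S) :
    Measurable[sigmaOf x S] (centeredProduct x P f) :=
  Measurable.sub_const (m := sigmaOf x S) (measurable_sigmaOf_prod _ fun e _ => hf e) _

lemma measurable_sigmaOf_prod_centeredProduct {S : Set ι} (s : Finset J) {f : J → F → ι}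
    (hf : ∀ j ∈ s, ∀ i, f j i ∈ S) :
    Measurable[sigmaOf x S] fun ω => ∏ j ∈ s, centeredProduct x P (f j) ω :=
  Finset.measurable_fun_prod (m := sigmaOf x S) s fun j hj =>
    measurable_sigmaOf_centeredProduct (hf j hj)

variable [Fintype J]

namespace IsStandardizedInput

variable (hx : IsStandardizedInput x P)

include hx

lemma integral_mul_eq_zero_of_disjoint {S T : Set ι} (hST : Disjoint S T) {U W : Ω → ℝ}
    (hU : Measurable[sigmaOf x S] U) (hW : Measurable[sigmaOf x T] W)
    (hmean : ∫ ω, U ω ∂P = 0) : ∫ ω, U ω * W ω ∂P = 0 := by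
  have hle (t) : MeasurableSpace.comap (x t) inferInstance ≤ mΩ := (hx.measurable t).comap_le
  have hle_sigmaOf (S : Set ι) : sigmaOf x S ≤ mΩ := iSup₂_le fun t _ => hle t
  have hUW : IndepFun U W P := by
    rw [IndepFun_iff_Indep]
    exact indep_of_indep_of_le_left (indep_of_indep_of_le_right
      (indep_iSup_of_disjoint hle hx.indep hST) hW.comap_le) hU.comap_le
  rw [hUW.integral_fun_mul_eq_mul_integral (hU.mono (hle_sigmaOf S) le_rfl).aestronglyMeasurable
    (hW.mono (hle_sigmaOf T) le_rfl).aestronglyMeasurable, hmean, zero_mul]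

lemma integral_prod_eq_zero_of_not_isMatched {f : E → ι} (hf : ¬ IsMatched f) :
    ∫ ω, ∏ e, x (f e) ω ∂P = 0 := by
  classical
  obtain ⟨e₀, he₀⟩ := not_isMatched_iff.1 hf
  rw [← hx.integral_mul_eq_zero_of_disjoint (S := {f e₀}) (T := {f e₀}ᶜ) disjoint_compl_right
    (measurable_sigmaOf (Set.mem_singleton (f e₀)))
    (measurable_sigmaOf_prod (Finset.univ.erase e₀) (f := f) fun e he hee₀ =>
      (Finset.mem_erase.1 he).1 (he₀ e hee₀)) (hx.mean _)]
  congr with ω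
  exact (Finset.mul_prod_erase Finset.univ (fun e => x (f e) ω) (Finset.mem_univ e₀)).symm

lemma integral_sq (t : ι) : ∫ ω, x t ω ^ 2 ∂P = 1 := by
  rw [← hx.variance t, variance_of_integral_eq_zero (hx.measurable t).aemeasurable (hx.mean t)]

lemma integral_prod_eq_one_of_letterCount_eq_two {f : E → ι}
    (hf : ∀ e, letterCount f (f e) = 2) : ∫ ω, ∏ e, x (f e) ω ∂P = 1 := by
  classical
  set I := Finset.univ.image f
  have hprod (ω) : ∏ e, x (f e) ω = ∏ a : I, x a ω ^ 2 := by
    rw [Finset.prod_comp (fun a => x a ω) f, Finset.prod_coe_sort I fun a => x a ω ^ 2]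
    refine Finset.prod_congr rfl fun a ha => ?_
    obtain ⟨e, -, rfl⟩ := Finset.mem_image.1 ha
    simp only [← hf e, letterCount_eq_card]
  have hind : iIndepFun (fun a : I => x a) P := hx.indep.precomp Subtype.val_injective
  simp only [hprod]
  rw [hind.integral_fun_prod_comp (f := fun _ y => y ^ 2)
    (fun a => (hx.measurable a).aemeasurable) (fun a => by fun_prop)]
  simp [hx.integral_sq]

lemma measurable_prod (f : E → ι) : Measurable fun ω => ∏ e, x (f e) ω :=
  Finset.measurable_fun_prod _ fun e _ => hx.measurable (f e)

lemma measurable_centeredProduct (f : E → ι) : Measurable (centeredProduct x P f) :=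
  (hx.measurable_prod f).sub_const _

lemma integral_prod_centeredProduct_eq_zero_of_not_isMatched {f : J → F → ι}
    (hf : ¬ IsMatched (Function.uncurry f)) :
    ∫ ω, ∏ j, centeredProduct x P (f j) ω ∂P = 0 := by
  classical
  obtain ⟨⟨j₀, i₀⟩, he₀⟩ := not_isMatched_iff.1 hf
  have hunique (j i) (hji : f j i = f j₀ i₀) : j = j₀ ∧ i = i₀ := by
    simpa using he₀ (j, i) hji
  have hmean : ∫ ω, ∏ i, x (f j₀ i) ω ∂P = 0 :=
    hx.integral_prod_eq_zero_of_not_isMatched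
      (not_isMatched_iff.2 ⟨i₀, fun i hi => (hunique j₀ i hi).2⟩)
  rw [← hx.integral_mul_eq_zero_of_disjoint (S := {f j₀ i₀}) (T := {f j₀ i₀}ᶜ)
    disjoint_compl_right (measurable_sigmaOf (Set.mem_singleton (f j₀ i₀)))
    (Measurable.mul (m := sigmaOf x {f j₀ i₀}ᶜ)
      (measurable_sigmaOf_prod (Finset.univ.erase i₀) (f := f j₀)
        fun i hi hii₀ => (Finset.mem_erase.1 hi).1 (hunique j₀ i hii₀).2)
      (measurable_sigmaOf_prod_centeredProduct (P := P) (Finset.univ.erase j₀) (f := f)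
        fun j hj i hji => (Finset.mem_erase.1 hj).1 (hunique j i hji).1)) (hx.mean _)]
  congr with ω
  rw [← Finset.mul_prod_erase Finset.univ (fun j => centeredProduct x P (f j) ω)
    (Finset.mem_univ j₀), Pi.mul_apply, ← mul_assoc,
    Finset.mul_prod_erase Finset.univ (fun i => x (f j₀ i) ω) (Finset.mem_univ i₀)]
  simp only [centeredProduct, hmean, sub_zero]

end IsStandardizedInput

/-- The absolute moments of all inputs exist, and those of order `k` are at most `C k`. -/
def HasMomentBounds (x : ι → Ω → ℝ) (P : Measure Ω) (C : ℕ → ℝ) : Prop :=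
  ∀ k, 0 ≤ C k ∧ ∀ t, Integrable (fun ω => |x t ω| ^ k) P ∧ ∫ ω, |x t ω| ^ k ∂P ≤ C k

lemma InputA3.exists_hasMomentBounds (hx : InputA3 x P) : ∃ C : ℕ → ℝ, HasMomentBounds x P C := by
  choose C hC using hx.2
  exact ⟨fun k => max 0 (C k), fun k => ⟨le_max_left _ _, fun t =>
    ⟨(hC k t).1, (hC k t).2.trans (le_max_right _ _)⟩⟩⟩

variable [IsProbabilityMeasure P] (hx : IsStandardizedInput x P) {C : ℕ → ℝ}
  (hC : HasMomentBounds x P C)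

include hx hC

lemma integrable_prod_inputs (f : E → ι) : Integrable (fun ω => ∏ e, x (f e) ω) P :=
  integrable_prod_of_integrable_pow (fun _ => hx.measurable _) fun _ => ((hC _).2 _).1

lemma integral_centeredProduct (f : E → ι) : ∫ ω, centeredProduct x P f ω ∂P = 0 := by
  unfold centeredProduct
  rw [integral_sub (integrable_prod_inputs hx hC f) (integrable_const _)]
  simp

lemma integral_prod_centeredProduct_eq_zero_of_not_isCrossMatched {f : J → F → ι}
    (hf : ¬ IsCrossMatched f) : ∫ ω, ∏ j, centeredProduct x P (f j) ω ∂P = 0 := by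
  classical
  simp only [IsCrossMatched, not_forall, not_exists, not_and] at hf
  obtain ⟨j₀, hj₀⟩ := hf
  rw [← hx.integral_mul_eq_zero_of_disjoint (S := Set.range (f j₀)) (T := (Set.range (f j₀))ᶜ)
    disjoint_compl_right
    (measurable_sigmaOf_centeredProduct (P := P) (f := f j₀) fun i => ⟨i, rfl⟩)
    (measurable_sigmaOf_prod_centeredProduct (P := P) (Finset.univ.erase j₀) (f := f) ?_)
    (integral_centeredProduct hx hC _)]
  · congr with ω
    exact (Finset.mul_prod_erase Finset.univ (fun j => centeredProduct x P (f j) ω)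
      (Finset.mem_univ j₀)).symm
  · rintro j hj i' ⟨i, hi⟩
    exact hj₀ i j (Finset.mem_erase.1 hj).1 i' hi.symm

omit hx in
lemma abs_integral_prod_inputs_le (f : E → ι) :
    |∫ ω, ∏ e, x (f e) ω ∂P| ≤ 1 + Fintype.card E * C (Fintype.card E) := by
  refine (abs_integral_le_integral_abs).trans ?_
  simp only [Finset.abs_prod]
  exact integral_prod_abs_le (fun _ => ((hC _).2 _).1) fun _ => ((hC _).2 _).2

omit hx in
lemma abs_centeredProduct_pow_four_le (f : E → ι) (ω : Ω) :
    |centeredProduct x P f ω| ^ 4 ≤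
      8 * (∏ e, |x (f e) ω ^ 4| + (1 + Fintype.card E * C (Fintype.card E)) ^ 4) := by
  set B : ℝ := 1 + Fintype.card E * C (Fintype.card E)
  have hmean : |∫ ω', ∏ e, x (f e) ω' ∂P| ≤ B := abs_integral_prod_inputs_le hC f
  calc |centeredProduct x P f ω| ^ 4 ≤ (|∏ e, x (f e) ω| + B) ^ 4 := by
        gcongr
        exact (abs_sub _ _).trans (by gcongr)
    _ ≤ 2 ^ (4 - 1) * (|∏ e, x (f e) ω| ^ 4 + B ^ 4) :=
        add_pow_le (abs_nonneg _) ((abs_nonneg _).trans hmean) 4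
    _ = 8 * (∏ e, |x (f e) ω ^ 4| + B ^ 4) := by
        rw [← abs_pow, ← Finset.prod_pow, Finset.abs_prod]; norm_num

lemma exists_centeredProduct_moment_bound (E : Type*) [Fintype E] : ∃ M : ℝ, ∀ f : E → ι,
    Integrable (fun ω => |centeredProduct x P f ω| ^ 4) P ∧
      ∫ ω, |centeredProduct x P f ω| ^ 4 ∂P ≤ M := by
  set B : ℝ := 1 + Fintype.card E * C (Fintype.card E)
  refine ⟨8 * (1 + Fintype.card E * C (4 * Fintype.card E) + B ^ 4), fun f => ?_⟩
  have hpow (e : E) : (fun ω => |x (f e) ω ^ 4| ^ Fintype.card E) =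
      fun ω => |x (f e) ω| ^ (4 * Fintype.card E) := by
    simp only [abs_pow, pow_mul]
  have hint (e : E) : Integrable (fun ω => |x (f e) ω ^ 4| ^ Fintype.card E) P := by
    rw [hpow]; exact ((hC _).2 _).1
  have hprod : Integrable (fun ω => ∏ e, |x (f e) ω ^ 4|) P := by
    refine integrable_prod_of_integrable_pow (fun e => ?_) (by simpa only [abs_abs] using hint)
    exact ((hx.measurable (f e)).pow_const 4).abs
  have hdom : Integrable (fun ω => 8 * (∏ e, |x (f e) ω ^ 4| + B ^ 4)) P :=
    (hprod.add (integrable_const _)).const_mul _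
  have hle (ω) := abs_centeredProduct_pow_four_le hC f ω
  refine ⟨hdom.mono' ((hx.measurable_centeredProduct f).abs.pow_const 4).aestronglyMeasurable
    (ae_of_all _ fun ω => ?_), ?_⟩
  · rw [Real.norm_of_nonneg (by positivity)]
    exact hle ω
  calc ∫ ω, |centeredProduct x P f ω| ^ 4 ∂P ≤ ∫ ω, 8 * (∏ e, |x (f e) ω ^ 4| + B ^ 4) ∂P :=
        integral_mono_of_nonneg (ae_of_all _ fun ω => by positivity) hdom (ae_of_all _ hle)
    _ = 8 * (∫ ω, ∏ e, |x (f e) ω ^ 4| ∂P + B ^ 4) := by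
        rw [integral_const_mul, integral_add hprod (integrable_const _)]
        simp
    _ ≤ _ := by
        gcongr
        exact integral_prod_abs_le hint fun e => by rw [hpow]; exact ((hC _).2 _).2

lemma exists_quadruple_moment_bound (F : Type*) [Fintype F] : ∃ M : ℝ, ∀ f : Fin 4 → F → ι,
    Integrable (fun ω => ∏ j, centeredProduct x P (f j) ω) P ∧
      |∫ ω, ∏ j, centeredProduct x P (f j) ω ∂P| ≤ M := by
  obtain ⟨M, hM⟩ := exists_centeredProduct_moment_bound hx hC F
  refine ⟨1 + Fintype.card (Fin 4) * M, fun f => ⟨integrable_prod_of_integrable_pow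
    (fun j => hx.measurable_centeredProduct (f j)) fun j => (hM (f j)).1, ?_⟩⟩
  refine (abs_integral_le_integral_abs).trans ?_
  simp only [Finset.abs_prod]
  exact integral_prod_abs_le (fun j => (hM (f j)).1) fun j => (hM (f j)).2

end Products

/-! ### Moments of sums over closed walks -/

lemma ncard_le_card_mul_of_forall_exists_mem {A B : Type*} [Finite A] [Fintype B] {S : Set A}
    {T : B → Set A} {N : ℕ} (hS : ∀ a ∈ S, ∃ b, a ∈ T b ∧ (T b).ncard ≤ N) :
    S.ncard ≤ Fintype.card B * N := by
  classical
  set good := Finset.univ.filter fun b => (T b).ncard ≤ N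
  have hsub : S ⊆ ⋃ b ∈ good, T b := fun a ha => by
    obtain ⟨b, hab, hb⟩ := hS a ha
    exact Set.mem_biUnion (by simpa [good] using hb) hab
  calc S.ncard ≤ ∑ b ∈ good, (T b).ncard :=
        (Set.ncard_le_ncard hsub).trans (Finset.set_ncard_biUnion_le _ _)
    _ ≤ good.card • N := Finset.sum_le_card_nsmul _ _ _ fun b hb => (Finset.mem_filter.1 hb).2
    _ ≤ _ := Nat.mul_le_mul_right N (Finset.card_le_univ _)

lemma sum_le_ncard_mul {A : Type*} [Fintype A] {S : Set A} {f : A → ℝ} {M : ℝ}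
    (hM : ∀ a ∈ S, f a ≤ M) (hzero : ∀ a ∉ S, f a = 0) : ∑ a, f a ≤ S.ncard * M := by
  classical
  rw [Set.ncard_eq_toFinset_card', ← nsmul_eq_mul,
    ← Finset.sum_subset (Finset.subset_univ S.toFinset) fun a _ ha => hzero a (by simpa using ha)]
  exact Finset.sum_le_card_nsmul _ _ _ fun a ha => hM a (by simpa using ha)

lemma exists_word_eq_iff {E ι : Type*} [Nonempty E] (f : E → ι) :
    ∃ w : E → E, ∀ e e', w e = w e' ↔ f e = f e' := by
  have hinv (e : E) : f (Function.invFun f (f e)) = f e := Function.invFun_eq ⟨e, rfl⟩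
  refine ⟨fun e => Function.invFun f (f e), fun e e' => ⟨fun h => ?_, fun h => congrArg _ h⟩⟩
  rw [← hinv e, ← hinv e']
  exact congrArg f h

lemma letterCount_congr {E α β : Type*} {f : E → α} {g : E → β}
    (h : ∀ e e', f e = f e' ↔ g e = g e') (e : E) :
    letterCount f (f e) = letterCount g (g e) := by
  simp only [letterCount, h]

section WalkSums

variable {V : Type*} {ι : Type u} {m : ℕ} {ℓ : V → V → ι} {D : ℕ}

/-- Quadruples of closed walks in which every label occurs at least twice and every walk shares a
label with another one: those which contribute to the fourth central moment of `walkSum`. -/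
def linkedQuadruples (ℓ : V → V → ι) (m : ℕ) : Set (Fin 4 → Fin (m + 1) → V) :=
  {c | IsMatched (Function.uncurry fun j => cyclicStep ℓ (c j)) ∧
    IsCrossMatched fun j => cyclicStep ℓ (c j)}

lemma ncard_linkedQuadruples_le [Finite V] (hD : ∀ x t, {y | ℓ x y = t}.ncard ≤ D) :
    (linkedQuadruples ℓ m).ncard ≤ Fintype.card (Fin 4 × Fin (m + 1) → Fin 4 × Fin (m + 1)) *
      (Nat.card V ^ (2 * (m + 1) + 2) * D ^ (4 * m)) := by
  refine ncard_le_card_mul_of_forall_exists_mem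
    (T := fun w => closedWalkFamilies ℓ (Function.curry w)) fun c ⟨hmatched, hcross⟩ => ?_
  obtain ⟨w, hw⟩ := exists_word_eq_iff (Function.uncurry fun j => cyclicStep ℓ (c j))
  refine ⟨w, fun j i j' i' => (hw (j, i) (j', i')).1,
    ncard_closedWalkFamilies_four_le hD (fun e => ?_) fun j => ?_⟩
  · rw [Function.uncurry_curry, letterCount_congr hw]
    exact hmatched e
  · obtain ⟨i, j', hj', i', h⟩ := hcross j
    exact ⟨i, j', hj', i', (hw (j', i') (j, i)).2 h⟩

/-- Closed walks in which every label occurs exactly twice. -/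
def pairWalks (ℓ : V → V → ι) (m : ℕ) : Set (Fin (m + 1) → V) :=
  {c | ∀ i, letterCount (cyclicStep ℓ c) (cyclicStep ℓ c i) = 2}

/-- Closed walks in which every label occurs at least twice, and some label more than twice. -/
def excessWalks (ℓ : V → V → ι) (m : ℕ) : Set (Fin (m + 1) → V) :=
  {c | IsMatched (cyclicStep ℓ c)} \ pairWalks ℓ m

lemma two_mul_ncard_range_lt_of_isMatched {E α : Type*} [Finite E] {f : E → α} (hf : IsMatched f)
    {e : E} (he : letterCount f (f e) ≠ 2) : 2 * (Set.range f).ncard < Nat.card E := by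
  have hcount := hf.sum_letterCount_add_le (T := {f e}) fun a ha => ⟨e, by simp_all⟩
  have htwo := hf e
  simp only [Finset.sum_singleton, Finset.card_singleton] at hcount
  omega

lemma ncard_excessWalks_le [Finite V] (hD : ∀ x t, {y | ℓ x y = t}.ncard ≤ D) :
    (excessWalks ℓ m).ncard ≤ Fintype.card (Fin (m + 1) → Fin (m + 1)) *
      (Nat.card V ^ (1 + m / 2) * D ^ m) := by
  rcases (excessWalks ℓ m).eq_empty_or_nonempty with hempty | ⟨c₀, -⟩
  · simp [hempty]
  have hpos : 0 < Nat.card V := Nat.card_pos_iff.2 ⟨⟨c₀ 0⟩, inferInstance⟩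
  refine ncard_le_card_mul_of_forall_exists_mem
    (T := fun w => closedWalksWithWord ℓ w ∅ (cyclicStep ℓ c₀)) fun c ⟨hmatched, hpairs⟩ => ?_
  obtain ⟨w, hw⟩ := exists_word_eq_iff (cyclicStep ℓ c)
  refine ⟨w, ⟨fun i hi => hi.elim, fun i j => (hw i j).1⟩,
    (ncard_closedWalksWithWord_le hD w ∅ _).trans ?_⟩
  obtain ⟨i, hi⟩ := not_forall.1 hpairs
  have hrange := two_mul_ncard_range_lt_of_isMatched (f := w)
    (fun e => (hmatched e).trans_eq (letterCount_congr hw e).symm)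
    (e := i) (by rwa [letterCount_congr hw])
  rw [Nat.card_eq_fintype_card, Fintype.card_fin] at hrange
  rw [Set.sdiff_empty]
  gcongr ?_ * _
  exact Nat.pow_le_pow_right hpos (by omega)

variable [Fintype V]

/-- The sum over all closed walks of length `m + 1` of the products of `y` along their labels; for
the matrix `(y (ℓ i j))` it is the trace of the power `m + 1`. -/
noncomputable def walkSum (ℓ : V → V → ι) (m : ℕ) (y : ι → ℝ) : ℝ :=
  ∑ c : Fin (m + 1) → V, ∏ i, y (cyclicStep ℓ c i)

variable {Ω : Type w} [MeasurableSpace Ω] {P : Measure Ω} {x : ι → Ω → ℝ}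
  (hx : IsStandardizedInput x P)

include hx

lemma measurable_walkSum : Measurable fun ω => walkSum ℓ m fun t => x t ω :=
  Finset.measurable_fun_sum _ fun c _ => hx.measurable_prod (cyclicStep ℓ c)

variable [IsProbabilityMeasure P] {C : ℕ → ℝ} (hC : HasMomentBounds x P C)

include hC

lemma integral_walkSum : ∫ ω, walkSum ℓ m (fun t => x t ω) ∂P =
    ∑ c : Fin (m + 1) → V, ∫ ω, ∏ i, x (cyclicStep ℓ c i) ω ∂P :=
  integral_finsetSum _ fun _ _ => integrable_prod_inputs hx hC _

lemma walkSum_sub_integral_pow (k : ℕ) (ω : Ω) :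
    (walkSum ℓ m (fun t => x t ω) - ∫ ω', walkSum ℓ m (fun t => x t ω') ∂P) ^ k =
      ∑ c : Fin k → Fin (m + 1) → V, ∏ j, centeredProduct x P (cyclicStep ℓ (c j)) ω := by
  rw [integral_walkSum hx hC, walkSum, ← Finset.sum_sub_distrib, Fintype.sum_pow]
  rfl

omit [Fintype V] in
lemma integral_prod_centeredProduct_eq_zero_of_notMem_linkedQuadruples
    {c : Fin 4 → Fin (m + 1) → V} (hc : c ∉ linkedQuadruples ℓ m) :
    ∫ ω, ∏ j, centeredProduct x P (cyclicStep ℓ (c j)) ω ∂P = 0 := by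
  rcases not_and_or.1 hc with hc | hc
  · exact hx.integral_prod_centeredProduct_eq_zero_of_not_isMatched hc
  · exact integral_prod_centeredProduct_eq_zero_of_not_isCrossMatched hx hC hc

omit [Fintype V] in
lemma exists_fourth_moment_bound (m D : ℕ) : ∃ K : ℝ,
    ∀ (n : ℕ) (ℓ : Fin n → Fin n → ι), (∀ x t, {y | ℓ x y = t}.ncard ≤ D) →
      Integrable (fun ω => (walkSum ℓ m (fun t => x t ω) -
        ∫ ω', walkSum ℓ m (fun t => x t ω') ∂P) ^ 4) P ∧
      ∫ ω, (walkSum ℓ m (fun t => x t ω) - ∫ ω', walkSum ℓ m (fun t => x t ω') ∂P) ^ 4 ∂P ≤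
        K * (n : ℝ) ^ (2 * (m + 1) + 2) := by
  obtain ⟨M, hM⟩ := exists_quadruple_moment_bound hx hC (Fin (m + 1))
  set N := Fintype.card (Fin 4 × Fin (m + 1) → Fin 4 × Fin (m + 1))
  refine ⟨N * D ^ (4 * m) * |M|, fun n ℓ hD => ?_⟩
  have hint (c : Fin 4 → Fin (m + 1) → Fin n) := (hM fun j => cyclicStep ℓ (c j)).1
  have hbound (c : Fin 4 → Fin (m + 1) → Fin n) := (hM fun j => cyclicStep ℓ (c j)).2
  simp only [walkSum_sub_integral_pow hx hC]
  refine ⟨integrable_finsetSum _ fun c _ => hint c, ?_⟩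
  rw [integral_finsetSum _ fun c _ => hint c]
  calc ∑ c : Fin 4 → Fin (m + 1) → Fin n,
        ∫ ω, ∏ j, centeredProduct x P (cyclicStep ℓ (c j)) ω ∂P
      ≤ (linkedQuadruples ℓ m).ncard * |M| :=
        sum_le_ncard_mul
          (fun c _ => (le_abs_self _).trans ((hbound c).trans (le_abs_self M)))
          fun c => integral_prod_centeredProduct_eq_zero_of_notMem_linkedQuadruples hx hC
    _ ≤ (N * (n ^ (2 * (m + 1) + 2) * D ^ (4 * m)) : ℕ) * |M| := by
        gcongr
        exact (ncard_linkedQuadruples_le hD).trans_eq (by rw [Nat.card_fin])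
    _ = _ := by push_cast; ring

omit [Fintype V] in
lemma exists_mean_bound (m D : ℕ) : ∃ K : ℝ,
    ∀ (n : ℕ) (ℓ : Fin n → Fin n → ι), (∀ x t, {y | ℓ x y = t}.ncard ≤ D) →
      |∫ ω, walkSum ℓ m (fun t => x t ω) ∂P - (pairWalks ℓ m).ncard| ≤
        K * (n : ℝ) ^ (1 + m / 2) := by
  classical
  set B : ℝ := 1 + Fintype.card (Fin (m + 1)) * C (Fintype.card (Fin (m + 1)))
  set N := Fintype.card (Fin (m + 1) → Fin (m + 1))
  have hB : 0 ≤ B := by have := (hC (Fintype.card (Fin (m + 1)))).1; positivity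
  refine ⟨N * D ^ m * B, fun n ℓ hD => ?_⟩
  have hcount : ((pairWalks ℓ m).ncard : ℝ) =
      ∑ c : Fin (m + 1) → Fin n, if c ∈ pairWalks ℓ m then 1 else 0 := by
    simp [Set.ncard_eq_toFinset_card', Set.toFinset_card, Fintype.card_subtype]
  have hterm (c : Fin (m + 1) → Fin n) (hc : c ∉ excessWalks ℓ m) :
      ∫ ω, ∏ i, x (cyclicStep ℓ c i) ω ∂P = if c ∈ pairWalks ℓ m then 1 else 0 := by
    split_ifs with hpair
    · exact hx.integral_prod_eq_one_of_letterCount_eq_two hpair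
    · exact hx.integral_prod_eq_zero_of_not_isMatched fun h => hc ⟨h, hpair⟩
  rw [integral_walkSum hx hC, hcount, ← Finset.sum_sub_distrib]
  calc |∑ c : Fin (m + 1) → Fin n, (∫ ω, ∏ i, x (cyclicStep ℓ c i) ω ∂P -
        if c ∈ pairWalks ℓ m then 1 else 0)|
      ≤ ∑ c : Fin (m + 1) → Fin n, |∫ ω, ∏ i, x (cyclicStep ℓ c i) ω ∂P -
        if c ∈ pairWalks ℓ m then 1 else 0| := Finset.abs_sum_le_sum_abs _ _
    _ ≤ (excessWalks ℓ m).ncard * B :=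
        sum_le_ncard_mul (fun c hc => by
          rw [if_neg hc.2, sub_zero]
          exact abs_integral_prod_inputs_le hC _) fun c hc => by rw [hterm c hc, sub_self, abs_zero]
    _ ≤ (N * (n ^ (1 + m / 2) * D ^ m) : ℕ) * B := by
        gcongr
        exact (ncard_excessWalks_le hD).trans_eq (by rw [Nat.card_fin])
    _ = _ := by push_cast; ring

end WalkSums

lemma ae_tendsto_zero_of_fourth_moment {Ω : Type*} [MeasurableSpace Ω] {P : Measure Ω}
    {Z : ℕ → Ω → ℝ} (hmeas : ∀ n, Measurable (Z n))
    (hint : ∀ n, Integrable (fun ω => Z n ω ^ 4) P) {b : ℕ → ℝ} (hb : Summable b)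
    (hle : ∀ n, ∫ ω, Z n ω ^ 4 ∂P ≤ b n) : ∀ᵐ ω ∂P, Tendsto (fun n => Z n ω) atTop (𝓝 0) := by
  have hnonneg (n ω) : 0 ≤ Z n ω ^ 4 := by positivity
  have hmeas4 (n) : AEMeasurable (fun ω => ENNReal.ofReal (Z n ω ^ 4)) P :=
    ((hmeas n).pow_const 4).ennreal_ofReal.aemeasurable
  have hsum : ∫⁻ ω, ∑' n, ENNReal.ofReal (Z n ω ^ 4) ∂P ≠ ⊤ := by
    rw [lintegral_tsum hmeas4]
    refine ne_top_of_le_ne_top hb.tsum_ofReal_ne_top (ENNReal.tsum_le_tsum fun n => ?_)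
    rw [← ofReal_integral_eq_lintegral_ofReal (hint n) (ae_of_all _ (hnonneg n))]
    exact ENNReal.ofReal_le_ofReal (hle n)
  filter_upwards [ae_lt_top' (AEMeasurable.tsum hmeas4) hsum] with ω hω
  have hpow : Tendsto (fun n => Z n ω ^ 4) atTop (𝓝 0) := by
    have := (ENNReal.tendsto_toReal ENNReal.zero_ne_top).comp
      (ENNReal.tendsto_atTop_zero_of_tsum_ne_top hω.ne)
    simpa [Function.comp_def, ENNReal.toReal_ofReal (hnonneg _ _)] using this
  rw [← isLittleO_one_iff ℝ] at hpow ⊢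
  exact IsLittleO.of_pow (n := 4) (by simpa [Pi.pow_def] using hpow) four_ne_zero

namespace SymmLink

variable {ι : Type u}

lemma stepValue_eq_cyclicStep_init (L : SymmLink ι) {m n : ℕ} {π : Fin (m + 1 + 1) → Fin n}
    (hπ : π 0 = π (Fin.last (m + 1))) :
    L.stepValue π = cyclicStep (L.toFun n) (Fin.init π : Fin (m + 1) → Fin n) := by
  funext i
  simp only [stepValue, cyclicStep, Fin.init]
  congr 1
  induction i using Fin.lastCases with
  | last => simp [← hπ]
  | cast j => rw [Fin.coeSucc_eq_succ, Fin.succ_castSucc]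

lemma ncard_pairCircuits_succ (L : SymmLink ι) (m n : ℕ) :
    (L.pairCircuits (m + 1) n).ncard = (pairWalks (L.toFun n) m).ncard := by
  refine Set.ncard_congr (fun π _ => Fin.init π) ?_ ?_ ?_
  · rintro π ⟨hclosed, hpair⟩
    rwa [L.stepValue_eq_cyclicStep_init hclosed] at hpair
  · rintro π π' ⟨hclosed, -⟩ ⟨hclosed', -⟩ h
    rw [← Fin.snoc_init_self π, ← Fin.snoc_init_self π', h, ← hclosed, ← hclosed']
    congr 1
    exact congrFun h 0
  · intro c hc
    have hclosed : (Fin.snoc c (c 0) : Fin (m + 1 + 1) → Fin n) 0 =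
        (Fin.snoc c (c 0) : Fin (m + 1 + 1) → Fin n) (Fin.last (m + 1)) := by
      rw [Fin.snoc_last]
      exact Fin.snoc_castSucc (α := fun _ => Fin n) (c 0) c 0
    refine ⟨Fin.snoc c (c 0), ⟨hclosed, ?_⟩, Fin.init_snoc _ _⟩
    rw [L.stepValue_eq_cyclicStep_init hclosed, Fin.init_snoc]
    exact hc

variable {L : SymmLink ι} {D : ℕ} (hD : ∀ n (k : Fin n) t, {l | L.toFun n k l = t}.ncard ≤ D)
  {Ω : Type w} [MeasurableSpace Ω] {P : Measure Ω} [IsProbabilityMeasure P] {x : ι → Ω → ℝ}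

include hD

lemma ae_tendsto_walkSum_sub_integral (hx : InputA3 x P) (m : ℕ) :
    ∀ᵐ ω ∂P, Tendsto (fun n : ℕ => (walkSum (L.toFun n) m (fun t => x t ω) -
      ∫ ω', walkSum (L.toFun n) m (fun t => x t ω') ∂P) / (n * √n ^ (m + 1))) atTop (𝓝 0) := by
  obtain ⟨C, hC⟩ := hx.exists_hasMomentBounds
  obtain ⟨K, hK⟩ := exists_fourth_moment_bound hx.1 hC m D
  have hscale (n : ℕ) :
      ((n : ℝ) * √n ^ (m + 1)) ^ 4 = n ^ (2 * (m + 1) + 2) * (n : ℝ) ^ 2 := by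
    calc ((n : ℝ) * √n ^ (m + 1)) ^ 4 = n ^ 4 * (√n ^ 2) ^ (2 * (m + 1)) := by ring
      _ = _ := by rw [Real.sq_sqrt (Nat.cast_nonneg n)]; ring
  refine ae_tendsto_zero_of_fourth_moment (b := fun n => K * (1 / (n : ℝ) ^ 2))
    (fun n => ((measurable_walkSum hx.1).sub_const _).div_const _) (fun n => ?_)
    ((Real.summable_one_div_nat_pow.2 one_lt_two).mul_left K) fun n => ?_
  · simp only [div_pow]
    exact (hK n _ (hD n)).1.div_const _
  · simp only [div_pow]
    rw [integral_div, hscale]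
    rcases Nat.eq_zero_or_pos n with rfl | hn
    · simp
    rw [div_le_iff₀ (by positivity)]
    refine (hK n _ (hD n)).2.trans_eq ?_
    field_simp

lemma tendsto_integral_walkSum_sub_ncard_pairCircuits (hx : InputA3 x P) (m : ℕ) :
    Tendsto (fun n : ℕ => (∫ ω, walkSum (L.toFun n) m (fun t => x t ω) ∂P -
      (L.pairCircuits (m + 1) n).ncard) / (n * √n ^ (m + 1))) atTop (𝓝 0) := by
  obtain ⟨C, hC⟩ := hx.exists_hasMomentBounds
  obtain ⟨K, hK⟩ := exists_mean_bound hx.1 hC m D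
  have hlim : Tendsto (fun n : ℕ => |K| * (√n)⁻¹) atTop (𝓝 0) := by
    simpa [Function.comp_def] using (tendsto_inv_atTop_zero.comp
      (Real.tendsto_sqrt_atTop.comp tendsto_natCast_atTop_atTop)).const_mul |K|
  refine squeeze_zero_norm' ?_ hlim
  filter_upwards [eventually_gt_atTop 0] with n hn
  have hsqrt : 1 ≤ √(n : ℝ) := Real.one_le_sqrt.2 (by exact_mod_cast hn)
  have hpow : (n : ℝ) ^ (m / 2) ≤ √n ^ m := by
    calc (n : ℝ) ^ (m / 2) = √n ^ (2 * (m / 2)) := by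
          rw [pow_mul, Real.sq_sqrt (Nat.cast_nonneg n)]
      _ ≤ √n ^ m := pow_le_pow_right₀ hsqrt (by omega)
  rw [Real.norm_eq_abs, abs_div, abs_of_nonneg (a := (n : ℝ) * √n ^ (m + 1)) (by positivity),
    div_le_iff₀ (by positivity), ncard_pairCircuits_succ]
  calc _ ≤ K * (n : ℝ) ^ (1 + m / 2) := hK n _ (hD n)
    _ ≤ |K| * (n * √n ^ m) := by
        rw [pow_add, pow_one]
        gcongr
        exact le_abs_self _
    _ = _ := by rw [pow_succ]; field_simp

theorem ae_tendsto_walkSum {β : ℕ → ℝ} (hβ : L.HasPairLimits β) (hx : InputA3 x P) (m : ℕ) :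
    ∀ᵐ ω ∂P, Tendsto (fun n : ℕ => walkSum (L.toFun n) m (fun t => x t ω) /
      (n * √n ^ (m + 1))) atTop (𝓝 (β (m + 1))) := by
  filter_upwards [ae_tendsto_walkSum_sub_integral hD hx m] with ω hω
  have hlim := (hω.add (tendsto_integral_walkSum_sub_ncard_pairCircuits hD hx m)).add (hβ (m + 1))
  simp only [zero_add] at hlim
  refine hlim.congr fun n => ?_
  ring

end SymmLink

/-! ### Traces of powers and empirical spectral measures -/

section Trace

variable {R V : Type*} [CommSemiring R] [Fintype V] [DecidableEq V]

lemma sum_prod_path_mul_eq_mulVec (M : Matrix V V R) (m : ℕ) (g : V → R) (a : V) :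
    ∑ c : Fin m → V, (∏ i : Fin m, M ((Fin.cons a c : Fin (m + 1) → V) i.castSucc)
      ((Fin.cons a c : Fin (m + 1) → V) i.succ)) * g ((Fin.cons a c : Fin (m + 1) → V) (Fin.last m))
      = ((M ^ m).mulVec g) a := by
  induction m generalizing a with
  | zero => simp
  | succ m ih =>
    rw [pow_succ', ← Matrix.mulVec_mulVec, Matrix.mulVec, dotProduct]
    simp only [← ih]
    rw [← (Fin.consEquiv fun _ => V).sum_comp, Fintype.sum_prod_type]
    refine Finset.sum_congr rfl fun b _ => ?_
    rw [Finset.mul_sum]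
    refine Finset.sum_congr rfl fun c _ => ?_
    rw [Fin.prod_univ_succ, ← mul_assoc]
    rfl

lemma trace_pow_succ (M : Matrix V V R) (m : ℕ) :
    (M ^ (m + 1)).trace = ∑ c : Fin (m + 1) → V, ∏ i, M (c i) (c (i + 1)) := by
  have hlast (c : Fin (m + 1) → V) : ∏ i, M (c i) (c (i + 1)) =
      (∏ i : Fin m, M (c i.castSucc) (c i.succ)) * M (c (Fin.last m)) (c 0) := by
    rw [Fin.prod_univ_castSucc]
    simp only [Fin.coeSucc_eq_succ, Fin.last_add_one]
  simp only [hlast]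
  rw [← (Fin.consEquiv fun _ => V).sum_comp, Fintype.sum_prod_type, Matrix.trace]
  refine Finset.sum_congr rfl fun a _ => ?_
  rw [Matrix.diag_apply, pow_succ]
  exact (sum_prod_path_mul_eq_mulVec M m (fun v => M v a) a).symm

end Trace

section Eigenvalues

variable {V : Type*} [Fintype V]

lemma sum_sq_eq_trace (X : Matrix V V ℝ) : ∑ i, ∑ j, X i j ^ 2 = (star X * X).trace := by
  rw [Finset.sum_comm, Matrix.trace]
  refine Finset.sum_congr rfl fun j _ => ?_
  simp [Matrix.mul_apply, Matrix.star_apply, sq]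

variable [DecidableEq V]

lemma trace_pow_eq_sum_eigenvalues_pow {A : Matrix V V ℝ} (hA : A.IsHermitian) (k : ℕ) :
    (A ^ k).trace = ∑ i, hA.eigenvalues i ^ k := by
  conv_lhs => rw [hA.spectral_theorem, ← map_pow, Unitary.conjStarAlgAut_apply,
    Matrix.trace_mul_comm, ← mul_assoc, Unitary.coe_star_mul_self, one_mul, Matrix.diagonal_pow,
    Matrix.trace_diagonal]
  simp

lemma sum_sq_star_mul_mul (X : Matrix V V ℝ) (U W : Matrix.unitaryGroup V ℝ) :
    ∑ i, ∑ j, (star (U : Matrix V V ℝ) * X * W) i j ^ 2 = ∑ i, ∑ j, X i j ^ 2 := by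
  rw [sum_sq_eq_trace, sum_sq_eq_trace]
  simp only [star_mul, star_star]
  calc _ = (star (W : Matrix V V ℝ) * (star X * ((U : Matrix V V ℝ) * star (U : Matrix V V ℝ)) * X
        * W)).trace := by simp only [mul_assoc]
    _ = _ := by
      rw [(Unitary.mem_iff.1 U.2).2, mul_one, Matrix.trace_mul_comm, mul_assoc,
        (Unitary.mem_iff.1 W.2).2, mul_one]

lemma sum_sq_unitary_row (U : Matrix.unitaryGroup V ℝ) (i : V) :
    ∑ j, (U : Matrix V V ℝ) i j ^ 2 = 1 := by
  have hdiag := congrFun (congrFun (Unitary.mem_iff.1 U.2).2 i) i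
  simpa [Matrix.mul_apply, Matrix.star_apply, sq] using hdiag

lemma sum_sq_unitary_col (U : Matrix.unitaryGroup V ℝ) (j : V) :
    ∑ i, (U : Matrix V V ℝ) i j ^ 2 = 1 := by
  simpa using sum_sq_unitary_row (star U) j

/-- The Frobenius norm of `A - B`, computed in eigenbases of `A` and of `B`. -/
lemma exists_unitary_sum_sq_sub_eq {A B : Matrix V V ℝ} (hA : A.IsHermitian)
    (hB : B.IsHermitian) : ∃ Q : Matrix.unitaryGroup V ℝ, ∑ i, ∑ j, (A i j - B i j) ^ 2 =
      ∑ i, ∑ j, ((Q : Matrix V V ℝ) i j * (hA.eigenvalues i - hB.eigenvalues j)) ^ 2 := by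
  set U := hA.eigenvectorUnitary
  set W := hB.eigenvectorUnitary
  have hAU : star (U : Matrix V V ℝ) * A =
      Matrix.diagonal hA.eigenvalues * star (U : Matrix V V ℝ) := by
    conv_lhs => rw [hA.spectral_theorem, Unitary.conjStarAlgAut_apply, ← mul_assoc, ← mul_assoc,
      Unitary.coe_star_mul_self, one_mul]
    rfl
  have hBW : B * (W : Matrix V V ℝ) = W * Matrix.diagonal hB.eigenvalues := by
    conv_lhs => rw [hB.spectral_theorem, Unitary.conjStarAlgAut_apply, mul_assoc,
      Unitary.coe_star_mul_self, mul_one]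
    rfl
  have hconj : star (U : Matrix V V ℝ) * (A - B) * W =
      Matrix.diagonal hA.eigenvalues * (star (U : Matrix V V ℝ) * W) -
        (star (U : Matrix V V ℝ) * W) * Matrix.diagonal hB.eigenvalues := by
    rw [mul_sub, sub_mul, hAU, mul_assoc _ B, hBW, mul_assoc, mul_assoc]
  have hfrob := sum_sq_star_mul_mul (A - B) U W
  rw [hconj] at hfrob
  simp only [Matrix.sub_apply, Matrix.diagonal_mul, Matrix.mul_diagonal] at hfrob
  refine ⟨star U * W, hfrob.symm.trans ?_⟩
  refine Finset.sum_congr rfl fun i _ => Finset.sum_congr rfl fun j _ => ?_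
  rw [Submonoid.coe_mul, Unitary.coe_star]
  ring

/-- The squares of the entries of a unitary matrix couple the two spectra. -/
lemma abs_sum_eigenvalues_sub_le {A B : Matrix V V ℝ} (hA : A.IsHermitian) (hB : B.IsHermitian)
    {f : ℝ → ℝ} {K : NNReal} (hf : LipschitzWith K f) :
    |∑ i, f (hA.eigenvalues i) - ∑ i, f (hB.eigenvalues i)| ≤
      K * (√(Fintype.card V) * √(∑ i, ∑ j, (A i j - B i j) ^ 2)) := by
  obtain ⟨Q, hfrob⟩ := exists_unitary_sum_sq_sub_eq hA hB
  set q : V × V → ℝ := fun p => (Q : Matrix V V ℝ) p.1 p.2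
  set d : V × V → ℝ := fun p => hA.eigenvalues p.1 - hB.eigenvalues p.2
  have hsumA : ∑ i, f (hA.eigenvalues i) = ∑ p, q p ^ 2 * f (hA.eigenvalues p.1) := by
    simp [q, Fintype.sum_prod_type, ← Finset.sum_mul, sum_sq_unitary_row]
  have hsumB : ∑ j, f (hB.eigenvalues j) = ∑ p, q p ^ 2 * f (hB.eigenvalues p.2) := by
    simp [q, Fintype.sum_prod_type_right, ← Finset.sum_mul, sum_sq_unitary_col]
  have hmass : ∑ p, |q p| ^ 2 = Fintype.card V := by
    simp [q, Fintype.sum_prod_type, sum_sq_unitary_row]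
  have hdist : ∑ p, |q p * d p| ^ 2 = ∑ i, ∑ j, (A i j - B i j) ^ 2 := by
    simp only [sq_abs, hfrob, Fintype.sum_prod_type, q, d]
  rw [hsumA, hsumB, ← Finset.sum_sub_distrib]
  simp only [← mul_sub]
  calc |∑ p, q p ^ 2 * (f (hA.eigenvalues p.1) - f (hB.eigenvalues p.2))|
      ≤ ∑ p, K * (|q p| * |q p * d p|) := by
        refine (Finset.abs_sum_le_sum_abs _ _).trans (Finset.sum_le_sum fun p _ => ?_)
        rw [abs_mul, abs_pow, abs_mul]
        calc |q p| ^ 2 * |f (hA.eigenvalues p.1) - f (hB.eigenvalues p.2)|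
            ≤ |q p| ^ 2 * (K * |d p|) := by gcongr; exact hf.dist_le_mul _ _
          _ = _ := by ring
    _ ≤ K * (√(∑ p, |q p| ^ 2) * √(∑ p, |q p * d p| ^ 2)) := by
        rw [← Finset.mul_sum]
        gcongr
        exact Real.sum_mul_le_sqrt_mul_sqrt _ _ _
    _ = _ := by rw [hmass, hdist]

end Eigenvalues

section EmpiricalMeasure

variable {n : ℕ} {A B : Matrix (Fin n) (Fin n) ℝ}

lemma isProbabilityMeasure_empiricalSpectralMeasure (hA : A.IsHermitian) (hn : 0 < n) :
    IsProbabilityMeasure (empiricalSpectralMeasure A hA) := by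
  constructor
  simp only [empiricalSpectralMeasure, Measure.smul_apply, Measure.finsetSum_apply, measure_univ,
    smul_eq_mul, Finset.sum_const, Finset.card_univ, Fintype.card_fin, nsmul_eq_mul, mul_one]
  exact ENNReal.inv_mul_cancel (by exact_mod_cast hn.ne') (ENNReal.natCast_ne_top n)

lemma integral_empiricalSpectralMeasure (hA : A.IsHermitian) (f : ℝ → ℝ) :
    ∫ s, f s ∂empiricalSpectralMeasure A hA = (n : ℝ)⁻¹ * ∑ i, f (hA.eigenvalues i) := by
  rw [empiricalSpectralMeasure, integral_smul_measure, integral_finsetSum_measure]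
  · simp
  · exact fun i _ => integrable_dirac (by simp)

lemma integrable_empiricalSpectralMeasure (hA : A.IsHermitian) (hn : 0 < n) (f : ℝ → ℝ) :
    Integrable f (empiricalSpectralMeasure A hA) := by
  refine Integrable.smul_measure ?_ (by simpa using hn.ne')
  exact integrable_finsetSum_measure.2 fun i _ => integrable_dirac (by simp)

lemma abs_integral_empiricalSpectralMeasure_sub_le (hA : A.IsHermitian) (hB : B.IsHermitian)
    {f : ℝ → ℝ} {K : NNReal} (hf : LipschitzWith K f) :
    |∫ s, f s ∂empiricalSpectralMeasure A hA - ∫ s, f s ∂empiricalSpectralMeasure B hB| ≤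
      K * √((n : ℝ)⁻¹ * ∑ i, ∑ j, (A i j - B i j) ^ 2) := by
  rcases Nat.eq_zero_or_pos n with rfl | hn
  · simp [integral_empiricalSpectralMeasure]
  rw [integral_empiricalSpectralMeasure, integral_empiricalSpectralMeasure, ← mul_sub, abs_mul,
    abs_of_nonneg (a := (n : ℝ)⁻¹) (by positivity), Real.sqrt_mul (by positivity), Real.sqrt_inv]
  calc _ ≤ (n : ℝ)⁻¹ * (K * (√n * √(∑ i, ∑ j, (A i j - B i j) ^ 2))) := by
        gcongr
        simpa using abs_sum_eigenvalues_sub_le hA hB hf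
    _ = K * ((n : ℝ)⁻¹ * √n * √(∑ i, ∑ j, (A i j - B i j) ^ 2)) := by ring
    _ = _ := by
        congr 3
        rw [inv_mul_eq_div, Real.sqrt_div_self']
        simp

lemma SymmLink.integral_pow_empiricalSpectralMeasure {ι : Type u} (L : SymmLink ι) (x : ι → ℝ)
    (n m : ℕ) : ∫ s, s ^ (m + 1) ∂empiricalSpectralMeasure (L.scaledMatrix x n)
      (L.scaledMatrix_isHermitian x n) = walkSum (L.toFun n) m x / (n * √n ^ (m + 1)) := by
  rw [integral_empiricalSpectralMeasure _ (fun s => s ^ (m + 1)),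
    ← trace_pow_eq_sum_eigenvalues_pow, trace_pow_succ, walkSum]
  simp only [scaledMatrix, Matrix.of_apply, Finset.prod_mul_distrib, Finset.prod_const,
    Finset.card_univ, Fintype.card_fin, ← Finset.mul_sum]
  simp only [cyclicStep, div_eq_mul_inv, mul_inv, inv_pow]
  ring

end EmpiricalMeasure

/-! ### The method of moments -/

lemma hasDerivAt_exp_I_mul_sub_taylor (N : ℕ) (y : ℝ) :
    HasDerivAt (fun y : ℝ => Complex.exp (Complex.I * y) -
        ∑ j ∈ Finset.range (N + 1), (Complex.I * y) ^ j / (j.factorial : ℂ))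
      (Complex.I * (Complex.exp (Complex.I * y) -
        ∑ j ∈ Finset.range N, (Complex.I * y) ^ j / (j.factorial : ℂ))) y := by
  have hlin : HasDerivAt (fun y : ℝ => Complex.I * (y : ℂ)) Complex.I y := by
    simpa using (Complex.ofRealCLM.hasDerivAt (x := y)).const_mul Complex.I
  have htaylor : HasDerivAt (fun y : ℝ => ∑ j ∈ Finset.range (N + 1),
      (Complex.I * (y : ℂ)) ^ j / (j.factorial : ℂ))
      (∑ j ∈ Finset.range (N + 1),
        (j : ℂ) * (Complex.I * (y : ℂ)) ^ (j - 1) * Complex.I / (j.factorial : ℂ)) y :=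
    HasDerivAt.fun_sum fun j _ => (hlin.pow j).div_const _
  refine (hlin.cexp.sub htaylor).congr_deriv (Eq.symm ?_)
  rw [Finset.sum_range_succ', mul_sub, Finset.mul_sum]
  simp only [Nat.cast_zero, zero_mul, zero_div, add_zero, Nat.add_sub_cancel]
  congr 1
  · ring
  · refine Finset.sum_congr rfl fun j _ => ?_
    have hj : (j.factorial : ℂ) ≠ 0 := by exact_mod_cast j.factorial_ne_zero
    have hj' : (j + 1 : ℂ) ≠ 0 := by exact_mod_cast j.succ_ne_zero
    rw [Nat.factorial_succ]
    push_cast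
    field_simp

lemma norm_exp_I_mul_sub_taylor_le_of_nonneg (N : ℕ) {y : ℝ} (hy : 0 ≤ y) :
    ‖Complex.exp (Complex.I * y) -
      ∑ j ∈ Finset.range N, (Complex.I * y) ^ j / (j.factorial : ℂ)‖ ≤ y ^ N / N.factorial := by
  induction N generalizing y with
  | zero => simp [mul_comm Complex.I, Complex.norm_exp_ofReal_mul_I]
  | succ N ih =>
    have hbound (t : ℝ) : HasDerivAt (fun t : ℝ => t ^ (N + 1) / ((N + 1).factorial : ℝ))
        (t ^ N / (N.factorial : ℝ)) t := by
      refine ((hasDerivAt_pow (N + 1) t).div_const ((N + 1).factorial : ℝ)).congr_deriv ?_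
      have hN : (N.factorial : ℝ) ≠ 0 := by exact_mod_cast N.factorial_ne_zero
      rw [Nat.factorial_succ]
      push_cast
      field_simp
    refine image_norm_le_of_norm_deriv_right_le_deriv_boundary
      (fun t _ => (hasDerivAt_exp_I_mul_sub_taylor N t).continuousAt.continuousWithinAt)
      (fun t _ => (hasDerivAt_exp_I_mul_sub_taylor N t).hasDerivWithinAt) ?_
      hbound (fun t ht => ?_) (Set.right_mem_Icc.2 hy)
    · simp [Finset.sum_range_succ']
    · rw [norm_mul, Complex.norm_I, one_mul]
      exact ih ht.1

lemma norm_exp_I_mul_sub_taylor_le (N : ℕ) (y : ℝ) :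
    ‖Complex.exp (Complex.I * y) -
      ∑ j ∈ Finset.range N, (Complex.I * y) ^ j / (j.factorial : ℂ)‖ ≤ |y| ^ N / N.factorial := by
  rcases le_total 0 y with hy | hy
  · rw [abs_of_nonneg hy]
    exact norm_exp_I_mul_sub_taylor_le_of_nonneg N hy
  · rw [abs_of_nonpos hy, ← RCLike.norm_conj]
    refine le_of_eq_of_le ?_ (norm_exp_I_mul_sub_taylor_le_of_nonneg N (neg_nonneg.2 hy))
    congr 1
    simp [← Complex.exp_conj]

/-- The Taylor polynomial at `0`, with `n` terms, of the characteristic function of a law with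
finite moments. -/
noncomputable def charFunTaylor (ν : Measure ℝ) (n : ℕ) (t : ℝ) : ℂ :=
  ∑ j ∈ Finset.range n, (Complex.I * t) ^ j / (j.factorial : ℂ) * ((∫ s, s ^ j ∂ν : ℝ) : ℂ)

lemma charFun_sub_charFunTaylor {ν : Measure ℝ} [IsProbabilityMeasure ν]
    (hν : ∀ j : ℕ, Integrable (fun s : ℝ => s ^ j) ν) (n : ℕ) (t : ℝ) :
    charFun ν t - charFunTaylor ν n t =
      ∫ s, (Complex.exp (Complex.I * (t * s : ℝ)) - ∑ j ∈ Finset.range n,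
        (Complex.I * (t * s : ℝ)) ^ j / (j.factorial : ℂ)) ∂ν := by
  have hterm (j : ℕ) (s : ℝ) : (Complex.I * (t * s : ℝ)) ^ j / (j.factorial : ℂ) =
      (Complex.I * t) ^ j / (j.factorial : ℂ) * ((s ^ j : ℝ) : ℂ) := by
    push_cast
    ring
  have hint (j : ℕ) : Integrable (fun s : ℝ => (Complex.I * t) ^ j / (j.factorial : ℂ) *
      ((s ^ j : ℝ) : ℂ)) ν := ((hν j).ofReal (𝕜 := ℂ)).const_mul _
  have hexp : Integrable (fun s : ℝ => Complex.exp (Complex.I * (t * s : ℝ))) ν := by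
    refine Integrable.of_bound (C := 1) (by fun_prop) (ae_of_all _ fun s => ?_)
    rw [mul_comm, Complex.norm_exp_ofReal_mul_I]
  simp only [hterm]
  rw [integral_sub hexp (integrable_finsetSum _ fun j _ => hint j),
    integral_finsetSum _ fun j _ => hint j, charFun_apply_real]
  congr 1
  · congr with s
    push_cast
    ring_nf
  · exact Finset.sum_congr rfl fun j _ => by rw [integral_const_mul, integral_complex_ofReal]

lemma norm_charFun_sub_charFunTaylor_le {ν : Measure ℝ} [IsProbabilityMeasure ν]
    (hν : ∀ j : ℕ, Integrable (fun s : ℝ => s ^ j) ν) (k : ℕ) (t : ℝ) :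
    ‖charFun ν t - charFunTaylor ν (2 * k) t‖ ≤
      |t| ^ (2 * k) / (2 * k).factorial * ∫ s, s ^ (2 * k) ∂ν := by
  rw [charFun_sub_charFunTaylor hν, ← integral_const_mul]
  refine norm_integral_le_of_norm_le ((hν (2 * k)).const_mul _) (ae_of_all _ fun s => ?_)
  refine (norm_exp_I_mul_sub_taylor_le _ _).trans_eq ?_
  rw [abs_mul, mul_pow, (even_two_mul k).pow_abs s]
  ring

lemma norm_charFun_sub_charFun_le {ν ν' : Measure ℝ} [IsProbabilityMeasure ν]
    [IsProbabilityMeasure ν'] (hν : ∀ j : ℕ, Integrable (fun s : ℝ => s ^ j) ν)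
    (hν' : ∀ j : ℕ, Integrable (fun s : ℝ => s ^ j) ν') (k : ℕ) (t : ℝ) :
    ‖charFun ν t - charFun ν' t‖ ≤
      ‖charFunTaylor ν (2 * k) t - charFunTaylor ν' (2 * k) t‖ +
        |t| ^ (2 * k) / (2 * k).factorial * (∫ s, s ^ (2 * k) ∂ν + ∫ s, s ^ (2 * k) ∂ν') := by
  calc ‖charFun ν t - charFun ν' t‖
      = ‖(charFunTaylor ν (2 * k) t - charFunTaylor ν' (2 * k) t) +
          ((charFun ν t - charFunTaylor ν (2 * k) t) -
            (charFun ν' t - charFunTaylor ν' (2 * k) t))‖ := by congr 1; ring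
    _ ≤ _ := by
      rw [mul_add]
      exact (norm_add_le _ _).trans <| add_le_add le_rfl <| (norm_sub_le _ _).trans <|
        add_le_add (norm_charFun_sub_charFunTaylor_le hν k t)
          (norm_charFun_sub_charFunTaylor_le hν' k t)

section Moments

variable {α : Type*} {F : Filter α} {β : ℕ → ℝ} {ν ν' : α → Measure ℝ}

lemma tendsto_charFunTaylor (hβ : ∀ j, Tendsto (fun a => ∫ s, s ^ j ∂ν a) F (𝓝 (β j)))
    (n : ℕ) (t : ℝ) :
    Tendsto (fun a => charFunTaylor (ν a) n t) F
      (𝓝 (∑ j ∈ Finset.range n, (Complex.I * t) ^ j / (j.factorial : ℂ) * (β j : ℂ))) :=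
  tendsto_finsetSum _ fun j _ => ((Complex.continuous_ofReal.tendsto _).comp (hβ j)).const_mul _

/-- Letting `a → ∞` before `k → ∞`, only the two remainders of order `2 * k` are left. -/
lemma tendsto_charFun_sub_of_moments [∀ a, IsProbabilityMeasure (ν a)]
    [∀ a, IsProbabilityMeasure (ν' a)] (hν : ∀ a (j : ℕ), Integrable (fun s : ℝ => s ^ j) (ν a))
    (hν' : ∀ a (j : ℕ), Integrable (fun s : ℝ => s ^ j) (ν' a))
    (hβ : ∀ j, Tendsto (fun a => ∫ s, s ^ j ∂ν a) F (𝓝 (β j)))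
    (hβ' : ∀ j, Tendsto (fun a => ∫ s, s ^ j ∂ν' a) F (𝓝 (β j))) (t : ℝ)
    (hgrow : Tendsto (fun k : ℕ => |t| ^ (2 * k) / (2 * k).factorial * β (2 * k)) atTop (𝓝 0)) :
    Tendsto (fun a => charFun (ν a) t - charFun (ν' a) t) F (𝓝 0) := by
  rw [Metric.tendsto_nhds]
  intro ε hε
  obtain ⟨k, hk⟩ := ((hgrow.const_mul 2).eventually_lt_const (u := ε) (by simpa using hε)).exists
  have hbound : Tendsto (fun a => ‖charFunTaylor (ν a) (2 * k) t - charFunTaylor (ν' a) (2 * k) t‖ +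
      |t| ^ (2 * k) / (2 * k).factorial * (∫ s, s ^ (2 * k) ∂ν a + ∫ s, s ^ (2 * k) ∂ν' a)) F
      (𝓝 (2 * (|t| ^ (2 * k) / (2 * k).factorial * β (2 * k)))) := by
    have h := ((tendsto_charFunTaylor hβ (2 * k) t).sub
      (tendsto_charFunTaylor hβ' (2 * k) t)).norm.add
      (((hβ (2 * k)).add (hβ' (2 * k))).const_mul (|t| ^ (2 * k) / (2 * k).factorial))
    rwa [sub_self, norm_zero, zero_add, ← two_mul, mul_left_comm] at h
  filter_upwards [hbound.eventually_lt_const hk] with a ha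
  rw [dist_zero_right]
  exact (norm_charFun_sub_charFun_le (hν a) (hν' a) k t).trans_lt ha

end Moments

lemma measure_lt_norm_le_of_second_moment {ν : Measure ℝ} [IsFiniteMeasure ν]
    (hν : Integrable (fun s : ℝ => s ^ 2) ν) {r : ℝ} (hr : 0 < r) :
    ν {s | r < ‖s‖} ≤ ENNReal.ofReal ((∫ s, s ^ 2 ∂ν) / r ^ 2) := by
  have hsub : {s : ℝ | r < ‖s‖} ⊆ {s : ℝ | r ^ 2 ≤ s ^ 2} := fun s hs => by
    rw [Set.mem_ofPred_eq, Real.norm_eq_abs] at hs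
    rw [Set.mem_ofPred_eq, ← sq_abs s]
    gcongr
  refine (measure_mono hsub).trans ?_
  rw [← ENNReal.ofReal_toReal (measure_ne_top ν _)]
  refine ENNReal.ofReal_le_ofReal ?_
  rw [le_div_iff₀ (by positivity), mul_comm]
  exact mul_meas_ge_le_integral_of_nonneg (ae_of_all _ fun s => sq_nonneg s) hν (r ^ 2)

lemma isTightMeasureSet_of_second_moment {S : Set (Measure ℝ)} {C : ℝ}
    (hS : ∀ ν ∈ S, IsFiniteMeasure ν ∧ Integrable (fun s : ℝ => s ^ 2) ν ∧ ∫ s, s ^ 2 ∂ν ≤ C) :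
    IsTightMeasureSet S := by
  apply isTightMeasureSet_of_tendsto_measure_norm_gt
  have hlim : Tendsto (fun r : ℝ => ENNReal.ofReal (C / r ^ 2)) atTop (𝓝 0) := by
    rw [← ENNReal.ofReal_zero]
    exact ENNReal.tendsto_ofReal <|
      tendsto_const_nhds.div_atTop (tendsto_pow_atTop two_ne_zero)
  refine tendsto_of_tendsto_of_tendsto_of_le_of_le' tendsto_const_nhds hlim
    (Eventually.of_forall fun _ => zero_le) ?_
  filter_upwards [eventually_gt_atTop 0] with r hr
  refine iSup₂_le fun ν hν => ?_
  obtain ⟨hfin, hint, hle⟩ := hS ν hν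
  exact (measure_lt_norm_le_of_second_moment hint hr).trans (by gcongr)

lemma exists_tendsto_ultrafilter_of_second_moment {α : Type*} {ν : α → ProbabilityMeasure ℝ} {C : ℝ}
    (hint : ∀ a, Integrable (fun s : ℝ => s ^ 2) (ν a : Measure ℝ))
    (hC : ∀ a, ∫ s, s ^ 2 ∂(ν a : Measure ℝ) ≤ C) (U : Ultrafilter α) :
    ∃ μ : ProbabilityMeasure ℝ, Tendsto ν U (𝓝 μ) := by
  have htight : IsTightMeasureSet {((μ : ProbabilityMeasure ℝ) : Measure ℝ) | μ ∈ Set.range ν} := by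
    refine isTightMeasureSet_of_second_moment (C := C) ?_
    rintro _ ⟨_, ⟨a, rfl⟩, rfl⟩
    exact ⟨inferInstance, hint a, hC a⟩
  obtain ⟨μ, -, hμ⟩ := (isCompact_closure_of_isTightMeasureSet htight).ultrafilter_le_nhds
    (U.map ν) (le_principal_iff.2 <| mem_map.2 <| univ_mem' fun a => subset_closure ⟨a, rfl⟩)
  exact ⟨μ, hμ⟩

lemma tendsto_charFun_of_tendsto {α : Type*} {F : Filter α} {ν : α → ProbabilityMeasure ℝ}
    {μ : ProbabilityMeasure ℝ} (hν : Tendsto ν F (𝓝 μ)) (t : ℝ) :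
    Tendsto (fun a => charFun (ν a : Measure ℝ) t) F (𝓝 (charFun (μ : Measure ℝ) t)) := by
  rw [ProbabilityMeasure.tendsto_iff_forall_integral_rclike_tendsto ℂ] at hν
  simp_rw [charFun_eq_integral_innerProbChar]
  exact hν _

/-- The law `μ` is the limit of all sequences of laws whose moments exist and converge to `β`. -/
def IsMomentLimit (β : ℕ → ℝ) (μ : ProbabilityMeasure ℝ) : Prop :=
  ∀ ν : ℕ → ProbabilityMeasure ℝ,
    (∀ i (j : ℕ), Integrable (fun s : ℝ => s ^ j) (ν i : Measure ℝ)) →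
    (∀ j, Tendsto (fun i => ∫ s, s ^ j ∂(ν i : Measure ℝ)) atTop (𝓝 (β j))) →
    Tendsto ν atTop (𝓝 μ)

theorem exists_isMomentLimit_of_moments {ν : ℕ → ProbabilityMeasure ℝ} {β : ℕ → ℝ}
    (hν : ∀ i (j : ℕ), Integrable (fun s : ℝ => s ^ j) (ν i : Measure ℝ))
    (hβ : ∀ j, Tendsto (fun i => ∫ s, s ^ j ∂(ν i : Measure ℝ)) atTop (𝓝 (β j)))
    (hgrow : ∀ t : ℝ, Tendsto (fun k : ℕ => |t| ^ (2 * k) / (2 * k).factorial * β (2 * k))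
      atTop (𝓝 0)) :
    ∃ μ : ProbabilityMeasure ℝ, IsMomentLimit β μ := by
  obtain ⟨C, hC⟩ := (hβ 2).bddAbove_range
  let U : Ultrafilter ℕ := Ultrafilter.of atTop
  have hU : (U : Filter ℕ) ≤ atTop := Ultrafilter.of_le _
  obtain ⟨μ, hμ⟩ :=
    exists_tendsto_ultrafilter_of_second_moment (fun i => hν i 2) (fun i => hC ⟨i, rfl⟩) U
  refine ⟨μ, fun ν' hν' hβ' => ProbabilityMeasure.tendsto_of_tendsto_charFun fun t => ?_⟩
  have hdiff : Tendsto
      (fun p : ℕ × ℕ => charFun (ν p.1 : Measure ℝ) t - charFun (ν' p.2 : Measure ℝ) t)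
      ((U : Filter ℕ) ×ˢ atTop) (𝓝 0) :=
    tendsto_charFun_sub_of_moments (fun p : ℕ × ℕ => hν p.1) (fun p => hν' p.2)
      (fun j => ((hβ j).mono_left hU).comp tendsto_fst) (fun j => (hβ' j).comp tendsto_snd) t
      (hgrow t)
  have hsnd : Tendsto (fun p : ℕ × ℕ => charFun (ν' p.2 : Measure ℝ) t) ((U : Filter ℕ) ×ˢ atTop)
      (𝓝 (charFun (μ : Measure ℝ) t)) := by
    simpa using ((tendsto_charFun_of_tendsto hμ t).comp tendsto_fst).sub hdiff
  rw [← map_snd_prod (U : Filter ℕ) atTop]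
  exact tendsto_map'_iff.2 hsnd

/-! ### The limiting law -/

lemma tendsto_pow_div_factorial_mul_zero {β : ℕ → ℝ} {D : ℕ} (h0 : ∀ h, 0 ≤ β h)
    (hβ : ∀ k, β (2 * k) ≤ ((2 * k) ^ k : ℕ) * (D : ℝ) ^ (2 * k)) (t : ℝ) :
    Tendsto (fun k : ℕ => |t| ^ (2 * k) / (2 * k).factorial * β (2 * k)) atTop (𝓝 0) := by
  refine squeeze_zero (fun k => mul_nonneg (by positivity) (h0 _)) (fun k => ?_)
    (FloorSemiring.tendsto_pow_div_factorial_atTop (2 * (t ^ 2 * D ^ 2)))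
  have hfac : k.factorial * k ^ k ≤ (2 * k).factorial :=
    calc k.factorial * k ^ k ≤ k.factorial * (k + 1) ^ k := by gcongr; omega
      _ ≤ (k + k).factorial := Nat.factorial_mul_pow_le_factorial
      _ = _ := by rw [two_mul]
  have hfac' : (k.factorial : ℝ) * (k : ℝ) ^ k ≤ (2 * k).factorial := by exact_mod_cast hfac
  calc |t| ^ (2 * k) / (2 * k).factorial * β (2 * k)
      ≤ |t| ^ (2 * k) / (2 * k).factorial * (((2 * k) ^ k : ℕ) * (D : ℝ) ^ (2 * k)) := by
        gcongr
        exact hβ k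
    _ = (2 * (t ^ 2 * D ^ 2)) ^ k * ((k : ℝ) ^ k / (2 * k).factorial) := by
        rw [pow_mul |t|, sq_abs, pow_mul (D : ℝ)]
        push_cast
        simp only [mul_pow]
        ring
    _ ≤ (2 * (t ^ 2 * D ^ 2)) ^ k * (1 / k.factorial) := by
        refine mul_le_mul_of_nonneg_left ?_ (by positivity)
        rw [div_le_div_iff₀ (by positivity) (by positivity)]
        linarith
    _ = _ := by ring

lemma InputA1.inputA3 {ι : Type u} {Ω : Type w} [MeasurableSpace Ω] {P : Measure Ω}
    [IsProbabilityMeasure P] {x : ι → Ω → ℝ} (hx : InputA1 x P) : InputA3 x P := by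
  obtain ⟨hs, C, hC⟩ := hx
  refine ⟨hs, fun k => ⟨|C| ^ k, fun t => ?_⟩⟩
  have hle : ∀ᵐ ω ∂P, |x t ω| ^ k ≤ |C| ^ k := by
    filter_upwards [hC t] with ω hω
    exact pow_le_pow_left₀ (abs_nonneg _) (hω.trans (le_abs_self C)) k
  have hint : Integrable (fun ω => |x t ω| ^ k) P :=
    Integrable.of_bound ((hs.measurable t).abs.pow_const k).aestronglyMeasurable _
      (by simpa using hle)
  exact ⟨hint, by simpa using integral_mono_ae hint (integrable_const (|C| ^ k)) hle⟩

lemma exists_inputA3 (ι : Type u) : ∃ (Ω : Type u) (_ : MeasurableSpace Ω) (P : Measure Ω)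
    (_ : IsProbabilityMeasure P) (x : ι → Ω → ℝ), InputA3 x P := by
  obtain ⟨Ω, _, P, x, hx, hlaw, hind, hP⟩ := exists_iid ι (gaussianReal 0 1)
  have hmemLp (t : ι) (p : NNReal) : MemLp (x t) p P :=
    (memLp_id_gaussianReal p).comp_measurePreserving ((hlaw t).measurePreserving (hx t))
  refine ⟨Ω, _, P, hP, x, ⟨hx, hind, fun t => hmemLp t 2, fun t => ?_, fun t => ?_⟩, fun k =>
    ⟨∫ s, |s| ^ k ∂gaussianReal 0 1, fun t => ⟨?_, ?_⟩⟩⟩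
  · rw [(hlaw t).integral_eq, integral_id_gaussianReal]
  · rw [(hlaw t).variance_eq, variance_id_gaussianReal, NNReal.coe_one]
  · exact (hmemLp t k).integrable_norm_pow'
  · exact ((hlaw t).integral_comp (f := fun s => |s| ^ k) (by fun_prop)).le

lemma measure_singleton_eq_zero_of_continuousAt_measureReal_Iic {μ : Measure ℝ}
    [IsProbabilityMeasure μ] {s : ℝ} (hs : ContinuousAt (fun r => μ.real (Set.Iic r)) s) :
    μ {s} = 0 := by
  simp only [← cdf_eq_real] at hs
  rw [← measure_cdf μ, StieltjesFunction.measure_singleton,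
    ((cdf μ).mono.continuousWithinAt_Iio_iff_leftLim_eq.1 hs.continuousWithinAt), sub_self,
    ENNReal.ofReal_zero]

namespace SymmLink

variable {ι : Type u}

/-- The empirical spectral measure of the matrix of size `n + 1`; the shift makes it a probability
measure for every `n`. -/
noncomputable def spectralLaw (L : SymmLink ι) (y : ι → ℝ) (n : ℕ) : ProbabilityMeasure ℝ :=
  ⟨empiricalSpectralMeasure (L.scaledMatrix y (n + 1)) (L.scaledMatrix_isHermitian y (n + 1)),
    isProbabilityMeasure_empiricalSpectralMeasure _ n.succ_pos⟩

lemma integrable_spectralLaw (L : SymmLink ι) (y : ι → ℝ) (n : ℕ) (f : ℝ → ℝ) :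
    Integrable f (L.spectralLaw y n : Measure ℝ) :=
  integrable_empiricalSpectralMeasure _ n.succ_pos _

lemma tendsto_esd_of_tendsto_spectralLaw {L : SymmLink ι} {y : ι → ℝ}
    {μ : ProbabilityMeasure ℝ} (h : Tendsto (L.spectralLaw y) atTop (𝓝 μ)) {s : ℝ}
    (hs : ContinuousAt (fun r => (μ : Measure ℝ).real (Set.Iic r)) s) :
    Tendsto (fun n => L.esd y n s) atTop (𝓝 ((μ : Measure ℝ).real (Set.Iic s))) := by
  rw [← tendsto_add_atTop_iff_nat 1]
  have hIic := ProbabilityMeasure.tendsto_measure_of_null_frontier_of_tendsto' h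
    (E := Set.Iic s) <| by
      rw [frontier_Iic]
      exact measure_singleton_eq_zero_of_continuousAt_measureReal_Iic hs
  exact (ENNReal.tendsto_toReal (measure_ne_top _ _)).comp hIic

section PairLimits

variable {L : SymmLink ι} {D : ℕ} {β : ℕ → ℝ}

lemma HasPairLimits.nonneg (hβ : L.HasPairLimits β) (h : ℕ) : 0 ≤ β h :=
  ge_of_tendsto (hβ h) (Eventually.of_forall fun n => by positivity)

lemma HasPairLimits.zero (hβ : L.HasPairLimits β) : β 0 = 1 := by
  refine tendsto_nhds_unique (hβ 0) (tendsto_const_nhds.congr' ?_)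
  filter_upwards [eventually_gt_atTop 0] with n hn
  have huniv : L.pairCircuits 0 n = Set.univ :=
    Set.eq_univ_of_forall fun π => ⟨rfl, fun i => i.elim0⟩
  have hn' : (n : ℝ) ≠ 0 := by exact_mod_cast hn.ne'
  simp [huniv, Set.ncard_univ, hn']

lemma tendsto_moment_spectralLaw_of_walkSum (hβ : L.HasPairLimits β) {y : ι → ℝ}
    (hy : ∀ m, Tendsto (fun n : ℕ => walkSum (L.toFun n) m y / (n * √n ^ (m + 1)))
      atTop (𝓝 (β (m + 1)))) (j : ℕ) :
    Tendsto (fun n => ∫ s, s ^ j ∂(L.spectralLaw y n : Measure ℝ)) atTop (𝓝 (β j)) := by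
  cases j with
  | zero => simp [hβ.zero]
  | succ m =>
    simp only [spectralLaw, ProbabilityMeasure.coe_mk, integral_pow_empiricalSpectralMeasure]
    exact (hy m).comp (tendsto_add_atTop_nat 1)

/-- The candidate law is read off one realization of a Gaussian input. -/
theorem exists_isMomentLimit (hD : ∀ n (k : Fin n) t, {l | L.toFun n k l = t}.ncard ≤ D)
    (hβ : L.HasPairLimits β) : ∃ μ : ProbabilityMeasure ℝ, IsMomentLimit β μ := by
  obtain ⟨Ω, _, P, _, x, hx⟩ := exists_inputA3 ι
  obtain ⟨ω, hω⟩ := (ae_all_iff.2 fun m => ae_tendsto_walkSum hD hβ hx m).exists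
  exact exists_isMomentLimit_of_moments (fun n j => L.integrable_spectralLaw (x · ω) n _)
    (tendsto_moment_spectralLaw_of_walkSum hβ hω)
    (tendsto_pow_div_factorial_mul_zero hβ.nonneg (hβ.le hD))

theorem ae_tendsto_spectralLaw (hD : ∀ n (k : Fin n) t, {l | L.toFun n k l = t}.ncard ≤ D)
    (hβ : L.HasPairLimits β) {μ : ProbabilityMeasure ℝ} (hμ : IsMomentLimit β μ)
    {Ω : Type w} [MeasurableSpace Ω] {P : Measure Ω} [IsProbabilityMeasure P] {x : ι → Ω → ℝ}
    (hx : InputA3 x P) :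
    ∀ᵐ ω ∂P, Tendsto (L.spectralLaw fun t => x t ω) atTop (𝓝 μ) := by
  filter_upwards [ae_all_iff.2 fun m => ae_tendsto_walkSum hD hβ hx m] with ω hω
  exact hμ _ (fun n j => L.integrable_spectralLaw _ n _)
    (tendsto_moment_spectralLaw_of_walkSum hβ hω)

end PairLimits

end SymmLink

/-! ### Truncation -/

section Truncation

variable {Ω : Type w} [MeasurableSpace Ω] {P : Measure Ω} {X : Ω → ℝ}

lemma mul_truncation {α : Type*} (f : α → ℝ) (b : ℝ) (a : α) :
    f a * truncation f b a = truncation f b a ^ 2 := by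
  by_cases h : f a ∈ Set.Ioc (-b) b <;> simp [truncation, h, sq]

lemma tendsto_integral_truncation_sq (hX : MemLp X 2 P) :
    Tendsto (fun b : ℝ => ∫ ω, truncation X b ω ^ 2 ∂P) atTop (𝓝 (∫ ω, X ω ^ 2 ∂P)) := by
  refine tendsto_integral_filter_of_dominated_convergence (fun ω => X ω ^ 2)
    (Eventually.of_forall fun b => hX.aestronglyMeasurable.truncation.pow 2)
    (Eventually.of_forall fun b => ae_of_all _ fun ω => ?_) hX.integrable_sq
    (ae_of_all _ fun ω => tendsto_const_nhds.congr' ?_)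
  · rw [Real.norm_eq_abs, abs_pow, ← sq_abs (X ω)]
    exact pow_le_pow_left₀ (abs_nonneg _) (abs_truncation_le_abs_self _ _ _) 2
  · filter_upwards [eventually_gt_atTop |X ω|] with b hb
    rw [truncation_eq_self hb]

lemma integral_sub_sq {Y : Ω → ℝ} (hX : MemLp X 2 P) (hY : MemLp Y 2 P) :
    ∫ ω, (X ω - Y ω) ^ 2 ∂P = ∫ ω, X ω ^ 2 ∂P - 2 * ∫ ω, X ω * Y ω ∂P + ∫ ω, Y ω ^ 2 ∂P := by
  have hXY : Integrable (fun ω => 2 * (X ω * Y ω)) P := (hX.integrable_mul hY).const_mul 2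
  have hdiff : Integrable (fun ω => X ω ^ 2 - 2 * (X ω * Y ω)) P := hX.integrable_sq.sub hXY
  simp only [sub_sq, mul_assoc]
  rw [integral_add hdiff hY.integrable_sq, integral_sub hX.integrable_sq hXY, integral_const_mul]

lemma integral_standardize_sq_eq_one {Y : Ω → ℝ} (hY : AEMeasurable Y P) (hvar : 0 < Var[Y; P]) :
    ∫ ω, ((Y ω - ∫ ω, Y ω ∂P) / √Var[Y; P]) ^ 2 ∂P = 1 := by
  simp only [div_pow, Real.sq_sqrt hvar.le]
  rw [integral_div, ← variance_eq_integral hY, div_self hvar.ne']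

variable [IsProbabilityMeasure P]

lemma variance_truncation (hX : AEStronglyMeasurable X P) (b : ℝ) :
    Var[truncation X b; P] = ∫ ω, truncation X b ω ^ 2 ∂P - (∫ ω, truncation X b ω ∂P) ^ 2 := by
  rw [variance_eq_sub hX.memLp_truncation]
  rfl

lemma integral_standardize_eq_zero {Y : Ω → ℝ} (hY : Integrable Y P) :
    ∫ ω, (Y ω - ∫ ω, Y ω ∂P) / √Var[Y; P] ∂P = 0 := by
  rw [integral_div, integral_sub hY (integrable_const _)]
  simp

/-- For the truncation `Y` of `X` one has `X * Y = Y ^ 2`, so the cross term is a moment of `Y`. -/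
lemma integral_sub_standardize_truncation_sq (hX : MemLp X 2 P) (hmean : ∫ ω, X ω ∂P = 0)
    (hsq : ∫ ω, X ω ^ 2 ∂P = 1) {b : ℝ} (hvar : 0 < Var[truncation X b; P]) :
    ∫ ω, (X ω - (truncation X b ω - ∫ ω, truncation X b ω ∂P) / √Var[truncation X b; P]) ^ 2 ∂P =
      2 - 2 * ((∫ ω, truncation X b ω ^ 2 ∂P) / √Var[truncation X b; P]) := by
  set Y := truncation X b
  set σ := √Var[Y; P]
  have hY : MemLp Y 2 P := hX.aestronglyMeasurable.memLp_truncation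
  have hZ : MemLp (fun ω => (Y ω - ∫ ω, Y ω ∂P) / σ) 2 P := by
    simp only [div_eq_inv_mul]
    exact (hY.sub (memLp_const _)).const_mul σ⁻¹
  have hcross : ∫ ω, X ω * ((Y ω - ∫ ω, Y ω ∂P) / σ) ∂P = (∫ ω, Y ω ^ 2 ∂P) / σ := by
    simp only [mul_div_assoc', mul_sub, Y, mul_truncation]
    rw [integral_div, integral_sub hY.integrable_sq ((hX.integrable one_le_two).mul_const _),
      integral_mul_const, hmean, zero_mul, sub_zero]
  rw [integral_sub_sq hX hZ, hcross, hsq,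
    integral_standardize_sq_eq_one hY.aestronglyMeasurable.aemeasurable hvar]
  ring

lemma tendsto_variance_truncation (hX : MemLp X 2 P) :
    Tendsto (fun b => Var[truncation X b; P]) atTop (𝓝 (Var[X; P])) := by
  simp only [variance_truncation hX.aestronglyMeasurable, variance_eq_sub hX]
  exact (tendsto_integral_truncation_sq hX).sub
    ((tendsto_integral_truncation (hX.integrable one_le_two)).pow 2)

lemma exists_bounded_standardized_approx (hX : MemLp X 2 P) (hmean : ∫ ω, X ω ∂P = 0)
    (hsq : ∫ ω, X ω ^ 2 ∂P = 1) {ε : ℝ} (hε : 0 < ε) :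
    ∃ g : ℝ → ℝ, Measurable g ∧ (∃ C, ∀ s, |g s| ≤ C) ∧ ∫ ω, g (X ω) ∂P = 0 ∧
      ∫ ω, g (X ω) ^ 2 ∂P = 1 ∧ ∫ ω, (X ω - g (X ω)) ^ 2 ∂P ≤ ε := by
  have hvar : Tendsto (fun b => Var[truncation X b; P]) atTop (𝓝 1) := by
    rw [← hsq, ← variance_of_integral_eq_zero hX.aestronglyMeasurable.aemeasurable hmean]
    exact tendsto_variance_truncation hX
  have herr : Tendsto (fun b => 2 - 2 * ((∫ ω, truncation X b ω ^ 2 ∂P) /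
      √Var[truncation X b; P])) atTop (𝓝 0) := by
    simpa [hsq] using
      (((tendsto_integral_truncation_sq hX).div hvar.sqrt (by simp)).const_mul 2).const_sub 2
  obtain ⟨b, hpos, hb⟩ :=
    ((hvar.eventually_const_lt one_pos).and (herr.eventually_lt_const hε)).exists
  set m := ∫ ω, truncation X b ω ∂P
  set σ := √Var[truncation X b; P]
  refine ⟨fun s => (truncation id b s - m) / σ,
    ((measurable_id.indicator measurableSet_Ioc).sub_const m).div_const σ,
    ⟨(|b| + |m|) / σ, fun s => ?_⟩,
    integral_standardize_eq_zero hX.aestronglyMeasurable.integrable_truncation,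
    integral_standardize_sq_eq_one hX.aestronglyMeasurable.truncation.aemeasurable hpos,
    (integral_sub_standardize_truncation_sq hX hmean hsq hpos).trans_le hb.le⟩
  rw [abs_div, abs_of_nonneg (Real.sqrt_nonneg _)]
  gcongr
  exact (abs_sub _ _).trans (add_le_add (abs_truncation_le_bound _ _ _) le_rfl)

lemma InputA2.exists_bounded_approx {ι : Type u} {x : ι → Ω → ℝ} (hx : InputA2 x P) {ε : ℝ}
    (hε : 0 < ε) :
    ∃ g : ℝ → ℝ, Measurable g ∧ InputA1 (fun t ω => g (x t ω)) P ∧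
      ∀ t, ∫ ω, (x t ω - g (x t ω)) ^ 2 ∂P ≤ ε := by
  obtain ⟨hs, hid⟩ := hx
  rcases isEmpty_or_nonempty ι with hι | ⟨⟨t₀⟩⟩
  · exact ⟨fun s => s, measurable_id, ⟨hs, 0, fun t => hι.elim t⟩, fun t => hι.elim t⟩
  obtain ⟨g, hg, ⟨C, hC⟩, hmean, hsq, hdist⟩ :=
    exists_bounded_standardized_approx (hs.memLp t₀) (hs.mean t₀) (hs.integral_sq t₀) hε
  have htransfer (t : ι) {f : ℝ → ℝ} (hf : Measurable f) :
      ∫ ω, f (x t ω) ∂P = ∫ ω, f (x t₀ ω) ∂P := ((hid t t₀).comp hf).integral_eq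
  have hmeas (t : ι) : Measurable fun ω => g (x t ω) := hg.comp (hs.measurable t)
  have hmean' (t : ι) : ∫ ω, g (x t ω) ∂P = 0 := (htransfer t hg).trans hmean
  refine ⟨g, hg, ⟨⟨hmeas, hs.indep.comp (fun _ => g) fun _ => hg, fun t =>
    MemLp.of_bound (hmeas t).aestronglyMeasurable C (ae_of_all _ fun ω => hC _), hmean',
    fun t => ?_⟩, C, fun t => ae_of_all _ fun ω => hC _⟩, fun t => ?_⟩
  · rw [variance_of_integral_eq_zero (hmeas t).aemeasurable (hmean' t)]
    exact (htransfer t (hg.pow_const 2)).trans hsq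
  · exact (htransfer t ((measurable_id.sub hg).pow_const 2)).trans_le hdist

end Truncation

/-! ### Identically distributed inputs -/

lemma bijOn_card_filter_lt {α : Type*} [LinearOrder α] (S : Finset α) :
    Set.BijOn (fun t => {s ∈ S | s < t}.card) S (Finset.range S.card) := by
  have hlt {t t' : α} (ht : t ∈ S) (htt' : t < t') :
      {s ∈ S | s < t}.card < {s ∈ S | s < t'}.card :=
    Finset.card_lt_card <| (Finset.ssubset_iff_of_subset fun s hs => by
      simp only [Finset.mem_filter] at hs ⊢
      exact ⟨hs.1, hs.2.trans htt'⟩).2 ⟨t, by simp [ht, htt'], by simp⟩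
  have hinj : Set.InjOn (fun t => {s ∈ S | s < t}.card) S := fun t ht t' ht' h => by
    rcases lt_trichotomy t t' with htt' | htt' | htt'
    · exact absurd h (hlt ht htt').ne
    · exact htt'
    · exact absurd h (hlt ht' htt').ne'
  have hmaps : Set.MapsTo (fun t => {s ∈ S | s < t}.card) S (Finset.range S.card) := fun t ht =>
    Finset.mem_coe.2 <| Finset.mem_range.2 <|
      Finset.card_lt_card (Finset.filter_ssubset.2 ⟨t, ht, lt_irrefl t⟩)
  exact ⟨hmaps, hinj, Finset.surjOn_of_injOn_of_card_le _ hmaps hinj (by simp)⟩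

/-- Order the points by the first set that contains them, with ties broken arbitrarily; then the
rank of a point is the same in all sets that contain it. -/
lemma exists_rank_bijOn_range_card {ι : Type*} {V : ℕ → Finset ι} (hV : Monotone V) :
    ∃ rank : ι → ℕ, ∀ n, Set.BijOn rank (V n) (Finset.range (V n).card) := by
  classical
  let level (t : ι) : ℕ := sInf {n | t ∈ V n}
  have hmem {n : ℕ} {t : ι} (ht : t ∈ V n) : t ∈ V (level t) :=
    Nat.sInf_mem (s := {n | t ∈ V n}) ⟨n, ht⟩
  have hle {n : ℕ} {t : ι} (ht : t ∈ V n) : level t ≤ n := Nat.sInf_le ht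
  let tieBreak : LinearOrder ι := linearOrderOfSTO WellOrderingRel
  let _ : LinearOrder ι := @LinearOrder.lift' ι (ℕ ×ₗ ι) (@Prod.Lex.instLinearOrder ℕ ι _ tieBreak)
    (fun t => toLex (level t, t)) fun t t' h => congrArg (fun p => (ofLex p).2) h
  have hlevel {s t : ι} (h : s < t) : level s ≤ level t := by
    rcases Prod.lex_def.1 h with h | h
    · exact h.le
    · exact h.1.le
  refine ⟨fun t => {s ∈ V (level t) | s < t}.card, fun n =>
    (bijOn_card_filter_lt (V n)).congr fun t ht => ?_⟩
  refine congrArg Finset.card (Finset.ext fun s => ?_)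
  simp only [Finset.mem_filter]
  exact ⟨fun hs => ⟨hV (hlevel hs.2) (hmem hs.1), hs.2⟩, fun hs => ⟨hV (hle ht) hs.1, hs.2⟩⟩

lemma exists_enumeration {ι : Type*} [DecidableEq ι] {V : ℕ → Finset ι} (hV : Monotone V)
    (hcard : Tendsto (fun n => (V n).card) atTop atTop) :
    ∃ e : ℕ → ι, Function.Injective e ∧ ∀ n, (Finset.range (V n).card).image e = V n := by
  obtain ⟨rank, hrank⟩ := exists_rank_bijOn_range_card hV
  have hsurj (k : ℕ) : ∃ t, rank t = k ∧ ∃ n, t ∈ V n := by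
    obtain ⟨n, hn⟩ := (hcard.eventually_gt_atTop k).exists
    obtain ⟨t, ht, htk⟩ := (hrank n).surjOn (by simpa using hn)
    exact ⟨t, htk, n, ht⟩
  choose e he N hN using hsurj
  have hinv {n : ℕ} {t : ι} (ht : t ∈ V n) : e (rank t) = t :=
    (hrank (max n (N (rank t)))).injOn (hV (le_max_right _ _) (hN _)) (hV (le_max_left _ _) ht)
      (he _)
  refine ⟨e, Function.LeftInverse.injective he, fun n => ?_⟩
  rw [← Finset.coe_inj, Finset.coe_image, ← (hrank n).image_eq, Set.image_image]
  exact (Set.image_congr fun t ht => hinv ht).trans (Set.image_id' _)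

theorem strong_law_ae_of_monotone_finset {ι : Type u} {Ω : Type w} [MeasurableSpace Ω]
    {P : Measure Ω} {z : ι → Ω → ℝ} (hind : iIndepFun z P)
    (hid : ∀ s t, IdentDistrib (z s) (z t) P P) (hint : ∀ t, Integrable (z t) P)
    {V : ℕ → Finset ι} (hV : Monotone V) (hcard : Tendsto (fun n => (V n).card) atTop atTop)
    (t₀ : ι) :
    ∀ᵐ ω ∂P, Tendsto (fun n => (∑ t ∈ V n, z t ω) / (V n).card) atTop
      (𝓝 (∫ ω, z t₀ ω ∂P)) := by
  classical
  obtain ⟨e, he, hVe⟩ := exists_enumeration hV hcard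
  filter_upwards [strong_law_ae_real (fun k => z (e k)) (hint _)
    (fun i j hij => hind.indepFun (he.ne hij)) (fun i => hid _ _)] with ω hω
  rw [(hid t₀ (e 0)).integral_eq]
  refine (hω.comp hcard).congr fun n => ?_
  conv_rhs => rw [← hVe n, Finset.card_image_of_injective _ he, Finset.card_range]
  simp only [Function.comp_def, Finset.sum_image he.injOn]

lemma continuous_integral_empiricalSpectralMeasure (n : ℕ) {f : ℝ → ℝ} {K : NNReal}
    (hf : LipschitzWith K f) :
    Continuous fun M : {M : Fin n → Fin n → ℝ // (Matrix.of M).IsHermitian} =>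
      ∫ s, f s ∂empiricalSpectralMeasure (Matrix.of M.1) M.2 := by
  refine continuous_iff_continuousAt.2 fun M₀ => tendsto_iff_dist_tendsto_zero.2 ?_
  have hcont : Continuous fun M : Fin n → Fin n → ℝ =>
      (K : ℝ) * √((n : ℝ)⁻¹ * ∑ i, ∑ j, (M i j - M₀.1 i j) ^ 2) := by
    fun_prop
  exact squeeze_zero (fun _ => dist_nonneg)
    (fun M => abs_integral_empiricalSpectralMeasure_sub_le M.2 M₀.2 hf)
    (by simpa [Function.comp_def] using (hcont.comp continuous_subtype_val).tendsto M₀)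

namespace SymmLink

variable {ι : Type u} {L : SymmLink ι}

lemma measurable_integral_spectralLaw (L : SymmLink ι) (n : ℕ) {f : ℝ → ℝ} {K : NNReal}
    (hf : LipschitzWith K f) {Ω : Type w} [MeasurableSpace Ω] {x : ι → Ω → ℝ}
    (hx : ∀ t, Measurable (x t)) :
    Measurable fun ω => ∫ s, f s ∂(L.spectralLaw (fun t => x t ω) n : Measure ℝ) := by
  have hM : Measurable fun ω => (⟨fun i j => (√(n + 1 : ℕ))⁻¹ * x (L.toFun (n + 1) i j) ω,
      L.scaledMatrix_isHermitian (fun t => x t ω) (n + 1)⟩ :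
      {M : Fin (n + 1) → Fin (n + 1) → ℝ // (Matrix.of M).IsHermitian}) :=
    Measurable.subtype_mk <| measurable_pi_lambda _ fun i => measurable_pi_lambda _ fun j =>
      (hx (L.toFun (n + 1) i j)).const_mul _
  simpa only [spectralLaw, ProbabilityMeasure.coe_mk, scaledMatrix, Function.comp_def] using
    (continuous_integral_empiricalSpectralMeasure (n + 1) hf).measurable.comp hM

/-- The normalized squared Frobenius distance `n⁻² ‖X - X'‖²` of the patterned matrices of size `n`
with inputs `y` and `y'`; it controls the distance of their spectral laws. -/
noncomputable def sqDist (L : SymmLink ι) (y y' : ι → ℝ) (n : ℕ) : ℝ :=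
  ((n : ℝ) ^ 2)⁻¹ * ∑ i, ∑ j, (y (L.toFun n i j) - y' (L.toFun n i j)) ^ 2

lemma sqDist_nonneg (L : SymmLink ι) (y y' : ι → ℝ) (n : ℕ) : 0 ≤ L.sqDist y y' n := by
  unfold sqDist
  positivity

lemma abs_integral_spectralLaw_sub_le (L : SymmLink ι) (y y' : ι → ℝ) (n : ℕ) {f : ℝ → ℝ}
    {K : NNReal} (hf : LipschitzWith K f) :
    |∫ s, f s ∂(L.spectralLaw y n : Measure ℝ) - ∫ s, f s ∂(L.spectralLaw y' n : Measure ℝ)| ≤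
      K * √(L.sqDist y y' (n + 1)) := by
  refine (abs_integral_empiricalSpectralMeasure_sub_le (L.scaledMatrix_isHermitian y (n + 1))
    (L.scaledMatrix_isHermitian y' (n + 1)) hf).trans (le_of_eq ?_)
  congr 2
  simp only [scaledMatrix, Matrix.of_apply, ← mul_sub, mul_pow, ← Finset.mul_sum, inv_pow]
  rw [Real.sq_sqrt (by positivity), sqDist, ← mul_assoc, ← mul_inv, ← sq]

lemma tendsto_spectralLaw_of_approx {μ : ProbabilityMeasure ℝ} {y : ι → ℝ} {y' : ℕ → ι → ℝ}
    {b : ℕ → ℝ} (hμ : ∀ k, Tendsto (L.spectralLaw (y' k)) atTop (𝓝 μ))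
    (hdist : ∀ k, ∀ᶠ n in atTop, L.sqDist y (y' k) n ≤ b k) (hb : Tendsto b atTop (𝓝 0)) :
    Tendsto (L.spectralLaw y) atTop (𝓝 μ) := by
  refine tendsto_iff_forall_lipschitz_integral_tendsto.2 ?_
  rintro f hfb ⟨K, hf⟩
  refine Metric.tendsto_nhds.2 fun η hη => ?_
  have hlim : Tendsto (fun k => (K : ℝ) * √(b k)) atTop (𝓝 0) := by
    simpa using (hb.sqrt).const_mul (K : ℝ)
  obtain ⟨k, hk⟩ := (hlim.eventually_lt_const (half_pos hη)).exists
  have hk' := tendsto_iff_forall_lipschitz_integral_tendsto.1 (hμ k) f hfb ⟨K, hf⟩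
  filter_upwards [Metric.tendsto_nhds.1 hk' _ (half_pos hη),
    (tendsto_add_atTop_nat 1).eventually (hdist k)] with n hn hnb
  calc dist (∫ s, f s ∂(L.spectralLaw y n : Measure ℝ)) (∫ s, f s ∂(μ : Measure ℝ))
    _ ≤ dist _ _ + dist _ _ := dist_triangle _ (∫ s, f s ∂(L.spectralLaw (y' k) n : Measure ℝ)) _
    _ < η / 2 + η / 2 := by
        refine add_lt_add (((L.abs_integral_spectralLaw_sub_le y (y' k) n hf).trans ?_).trans_lt hk)
          hn
        gcongr
    _ = η := add_halves η

lemma finite_values (L : SymmLink ι) (n : ℕ) : (L.values n).Finite := Set.finite_range _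

lemma ncard_label_le_maxOccurrences (L : SymmLink ι) (n : ℕ) (t : ι) :
    Set.ncard {p : Fin n × Fin n | L.toFun n p.1 p.2 = t} ≤ L.maxOccurrences n := by
  refine le_ciSup (f := fun t => Set.ncard {p : Fin n × Fin n | L.toFun n p.1 p.2 = t})
    ⟨Nat.card (Fin n × Fin n), ?_⟩ t
  rintro _ ⟨t, rfl⟩
  exact Set.ncard_le_card _

lemma sum_labels_le (L : SymmLink ι) (n : ℕ) {z : ι → ℝ} (hz : ∀ t, 0 ≤ z t) {V : Finset ι}
    (hV : L.values n ⊆ V) :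
    ∑ i, ∑ j, z (L.toFun n i j) ≤ L.maxOccurrences n * ∑ t ∈ V, z t := by
  classical
  have hcard (t : ι) : (Finset.univ.filter fun p : Fin n × Fin n => L.toFun n p.1 p.2 = t).card ≤
      L.maxOccurrences n := by
    simpa [← Set.ncard_coe_finset] using L.ncard_label_le_maxOccurrences n t
  rw [← Fintype.sum_prod_type' fun i j => z (L.toFun n i j),
    ← Finset.sum_fiberwise_of_maps_to (t := V) (g := fun p : Fin n × Fin n => L.toFun n p.1 p.2)
      (fun p _ => hV ⟨p, rfl⟩), Finset.mul_sum]
  refine Finset.sum_le_sum fun t _ => ?_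
  rw [Finset.sum_congr rfl (g := fun _ => z t) fun p hp => by rw [(Finset.mem_filter.1 hp).2],
    Finset.sum_const, nsmul_eq_mul]
  exact mul_le_mul_of_nonneg_right (mod_cast hcard t) (hz t)

/-- The set of labels that occur in the matrices of size at most `n`. -/
noncomputable def cumulativeValues (L : SymmLink ι) (n : ℕ) : Finset ι :=
  ((Finset.range (n + 1)).finite_toSet.biUnion fun m _ => L.finite_values m).toFinset

lemma coe_cumulativeValues (L : SymmLink ι) (n : ℕ) :
    (L.cumulativeValues n : Set ι) = ⋃ m ∈ Finset.range (n + 1), L.values m := by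
  simp [cumulativeValues]

lemma values_subset_cumulativeValues (L : SymmLink ι) (n : ℕ) :
    L.values n ⊆ L.cumulativeValues n := by
  rw [coe_cumulativeValues]
  exact Set.subset_biUnion_of_mem (u := L.values) (Finset.self_mem_range_succ n)

lemma monotone_cumulativeValues (L : SymmLink ι) : Monotone L.cumulativeValues := fun m n hmn => by
  rw [← Finset.coe_subset, coe_cumulativeValues, coe_cumulativeValues]
  exact Set.biUnion_subset_biUnion_left fun i hi =>
    Finset.mem_range.2 ((Finset.mem_range.1 hi).trans_le (by lia))

lemma LinkCond.tendsto_card_cumulativeValues (hL : L.LinkCond) :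
    Tendsto (fun n => (L.cumulativeValues n).card) atTop atTop :=
  tendsto_atTop_mono (fun n => by
    rw [← Set.ncard_coe_finset]
    exact Set.ncard_le_ncard (L.values_subset_cumulativeValues n)) hL.1

/-- Each label occurs at most `α_n` times, and `α_n |V_n| = O(k_n α_n) = O(n²)` for the set `V_n` of
labels used so far. -/
lemma LinkCond.exists_eventually_sqDist_le (hL : L.LinkCond) (hcum : L.CumulativeValuesBound) :
    ∃ C : ℝ, ∀ (y y' : ι → ℝ) (b : ℝ), (∀ᶠ n in atTop,
      (∑ t ∈ L.cumulativeValues n, (y t - y' t) ^ 2) / (L.cumulativeValues n).card ≤ b) →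
      ∀ᶠ n in atTop, L.sqDist y y' n ≤ C * b := by
  obtain ⟨C₁, hC₁⟩ := hL.2.bound
  obtain ⟨C₂, hC₂0, hC₂⟩ := hcum.exists_pos
  refine ⟨C₁ * C₂, fun y y' b hb => ?_⟩
  filter_upwards [hb, hC₁, hC₂.bound, eventually_gt_atTop 0,
    hL.tendsto_card_cumulativeValues.eventually_gt_atTop 0] with n hn hn₁ hn₂ hn0 hV0
  simp only [← coe_cumulativeValues, Set.ncard_coe_finset, Real.norm_eq_abs, abs_mul, abs_pow,
    Nat.abs_cast] at hn₁ hn₂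
  set S := ∑ t ∈ L.cumulativeValues n, (y t - y' t) ^ 2
  have hb0 : 0 ≤ b := (by positivity : (0 : ℝ) ≤ S / (L.cumulativeValues n).card).trans hn
  rw [div_le_iff₀ (by exact_mod_cast hV0)] at hn
  calc L.sqDist y y' n
    _ ≤ ((n : ℝ) ^ 2)⁻¹ * (L.maxOccurrences n * S) := by
        unfold sqDist
        gcongr
        exact L.sum_labels_le n (z := fun t => (y t - y' t) ^ 2) (fun t => sq_nonneg _)
          (L.values_subset_cumulativeValues n)
    _ ≤ ((n : ℝ) ^ 2)⁻¹ * (L.maxOccurrences n * (b * (C₂ * L.numValues n))) := by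
        gcongr
        exact hn.trans (by gcongr)
    _ = ((n : ℝ) ^ 2)⁻¹ * (C₂ * b * (L.numValues n * L.maxOccurrences n)) := by ring
    _ ≤ ((n : ℝ) ^ 2)⁻¹ * (C₂ * b * (C₁ * n ^ 2)) := by gcongr
    _ = C₁ * C₂ * b := by field_simp

theorem ae_tendsto_spectralLaw_of_iid {D : ℕ}
    (hD : ∀ n (k : Fin n) t, {l | L.toFun n k l = t}.ncard ≤ D) (hL : L.LinkCond)
    (hcum : L.CumulativeValuesBound) {β : ℕ → ℝ} (hβ : L.HasPairLimits β)
    {μ : ProbabilityMeasure ℝ} (hμ : IsMomentLimit β μ) {Ω : Type w} [MeasurableSpace Ω]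
    {P : Measure Ω} [IsProbabilityMeasure P] {x : ι → Ω → ℝ} (hx : InputA2 x P) :
    ∀ᵐ ω ∂P, Tendsto (L.spectralLaw fun t => x t ω) atTop (𝓝 μ) := by
  obtain ⟨C, hC⟩ := hL.exists_eventually_sqDist_le hcum
  choose g hg hgA1 hgε using fun k : ℕ =>
    hx.exists_bounded_approx (ε := 1 / ((k : ℝ) + 1)) (by positivity)
  have hz (k : ℕ) : Measurable fun s => (s - g k s) ^ 2 := (measurable_id.sub (hg k)).pow_const 2
  have hslln := ae_all_iff.2 fun k => strong_law_ae_of_monotone_finset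
    (z := fun t ω => (x t ω - g k (x t ω)) ^ 2)
    (hx.1.indep.comp (fun _ s => (s - g k s) ^ 2) fun _ => hz k)
    (fun s t => (hx.2 s t).comp (hz k))
    (fun t => ((hx.1.memLp t).sub ((hgA1 k).1.memLp t)).integrable_sq)
    L.monotone_cumulativeValues hL.tendsto_card_cumulativeValues (L.toFun 1 0 0)
  have htrunc := ae_all_iff.2 fun k => ae_tendsto_spectralLaw hD hβ hμ (hgA1 k).inputA3
  filter_upwards [hslln, htrunc] with ω hω htω
  have hmean (k : ℕ) : ∀ᶠ n in atTop, (∑ t ∈ L.cumulativeValues n, (x t ω - g k (x t ω)) ^ 2) /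
      (L.cumulativeValues n).card ≤ 2 * (1 / ((k : ℝ) + 1)) := by
    refine ((hω k).eventually_lt_const ((hgε k _).trans_lt ?_)).mono fun n hn => hn.le
    exact lt_two_mul_self (by positivity)
  refine tendsto_spectralLaw_of_approx (y' := fun k t => g k (x t ω)) htω
    (fun k => hC _ _ _ (hmean k)) ?_
  simpa using ((tendsto_one_div_add_atTop_nhds_zero_nat (𝕜 := ℝ)).const_mul 2).const_mul C

section Probability

variable {Ω : Type w} [MeasurableSpace Ω] {P : Measure Ω} {x x' : ι → Ω → ℝ}

lemma integrable_sqDist (hx : ∀ t, MemLp (x t) 2 P) (hx' : ∀ t, MemLp (x' t) 2 P) (n : ℕ) :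
    Integrable (fun ω => L.sqDist (fun t => x t ω) (fun t => x' t ω) n) P :=
  (integrable_finsetSum _ fun _ _ => integrable_finsetSum _ fun _ _ =>
    ((hx _).sub (hx' _)).integrable_sq).const_mul _

lemma integral_sqDist_le (hx : ∀ t, MemLp (x t) 2 P) (hx' : ∀ t, MemLp (x' t) 2 P) {ε : ℝ}
    (hε : ∀ t, ∫ ω, (x t ω - x' t ω) ^ 2 ∂P ≤ ε) (n : ℕ) :
    ∫ ω, L.sqDist (fun t => x t ω) (fun t => x' t ω) (n + 1) ∂P ≤ ε := by
  have hint (t : ι) : Integrable (fun ω => (x t ω - x' t ω) ^ 2) P :=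
    ((hx t).sub (hx' t)).integrable_sq
  simp only [sqDist]
  rw [integral_const_mul, inv_mul_le_iff₀ (by positivity),
    integral_finsetSum _ fun i _ => integrable_finsetSum _ fun j _ => hint _]
  calc ∑ i, ∫ ω, ∑ j, (x (L.toFun (n + 1) i j) ω - x' (L.toFun (n + 1) i j) ω) ^ 2 ∂P
    _ ≤ ∑ _i : Fin (n + 1), ∑ _j : Fin (n + 1), ε := by
        refine Finset.sum_le_sum fun i _ => ?_
        rw [integral_finsetSum _ fun j _ => hint _]
        exact Finset.sum_le_sum fun j _ => hε _
    _ = ((n + 1 : ℕ) : ℝ) ^ 2 * ε := by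
        simp only [Finset.sum_const, Finset.card_univ, Fintype.card_fin, nsmul_eq_mul]
        ring

variable [IsProbabilityMeasure P] {D : ℕ} {β : ℕ → ℝ} {μ : ProbabilityMeasure ℝ}

lemma dist_integral_spectralLaw_lt (L : SymmLink ι) {y y' : ι → ℝ} {n : ℕ} {f : ℝ → ℝ}
    {K : NNReal} (hf : LipschitzWith K f) {δ : ℝ} (hδ : 0 < δ)
    (h : L.sqDist y y' (n + 1) < (δ / (K + 1)) ^ 2) :
    dist (∫ s, f s ∂(L.spectralLaw y n : Measure ℝ))
      (∫ s, f s ∂(L.spectralLaw y' n : Measure ℝ)) < δ := by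
  have hsqrt : √(L.sqDist y y' (n + 1)) ≤ δ / (K + 1) :=
    (Real.sqrt_le_left (by positivity)).2 h.le
  calc |_ - _| ≤ K * √(L.sqDist y y' (n + 1)) := L.abs_integral_spectralLaw_sub_le y y' n hf
    _ ≤ K * (δ / (K + 1)) := by gcongr
    _ < (K + 1) * (δ / (K + 1)) := by
        gcongr
        exact lt_add_one _
    _ = δ := mul_div_cancel₀ _ (by positivity)

lemma tendstoInMeasure_integral_spectralLaw
    (hD : ∀ n (k : Fin n) t, {l | L.toFun n k l = t}.ncard ≤ D) (hβ : L.HasPairLimits β)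
    (hμ : IsMomentLimit β μ) (hx : InputA2 x P) {f : ℝ → ℝ}
    (hfb : ∃ C : ℝ, ∀ s t, dist (f s) (f t) ≤ C) {K : NNReal} (hf : LipschitzWith K f) :
    TendstoInMeasure P (fun n ω => ∫ s, f s ∂(L.spectralLaw (fun t => x t ω) n : Measure ℝ)) atTop
      (fun _ => ∫ s, f s ∂(μ : Measure ℝ)) := by
  refine tendstoInMeasure_iff_measureReal_dist.2 fun η hη => Metric.tendsto_nhds.2 fun δ hδ => ?_
  set c : ℝ := (η / 2 / (K + 1)) ^ 2
  have hc : 0 < c := by positivity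
  obtain ⟨g, hg, hgA1, hgε⟩ := hx.exists_bounded_approx (ε := c * (δ / 2)) (by positivity)
  have htrunc : TendstoInMeasure P (fun n ω => ∫ s, f s
      ∂(L.spectralLaw (fun t => g (x t ω)) n : Measure ℝ)) atTop
      (fun _ => ∫ s, f s ∂(μ : Measure ℝ)) := by
    refine tendstoInMeasure_of_tendsto_ae (fun n => (L.measurable_integral_spectralLaw n hf
      (fun t => hg.comp (hx.1.measurable t))).aestronglyMeasurable) ?_
    filter_upwards [ae_tendsto_spectralLaw hD hβ hμ hgA1.inputA3] with ω hω
    exact tendsto_iff_forall_lipschitz_integral_tendsto.1 hω f hfb ⟨K, hf⟩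
  filter_upwards [(tendstoInMeasure_iff_measureReal_dist.1 htrunc (η / 2)
    (half_pos hη)).eventually_lt_const (half_pos hδ)] with n hn
  rw [Real.dist_0_eq_abs, abs_of_nonneg measureReal_nonneg]
  have hmarkov : P.real {ω | c ≤ L.sqDist (fun t => x t ω) (fun t => g (x t ω)) (n + 1)} ≤ δ / 2 :=
    le_of_mul_le_mul_left ((mul_meas_ge_le_integral_of_nonneg
      (ae_of_all P fun ω => L.sqDist_nonneg _ _ _) (integrable_sqDist hx.1.memLp hgA1.1.memLp _)
      c).trans (integral_sqDist_le hx.1.memLp hgA1.1.memLp hgε n)) hc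
  calc _ ≤ _ := measureReal_mono fun ω hω => ?_
    _ ≤ _ := measureReal_union_le _ _
    _ < δ / 2 + δ / 2 := add_lt_add_of_le_of_lt hmarkov hn
    _ = δ := add_halves δ
  by_contra! hcon
  simp only [Set.mem_union, Set.mem_ofPred_eq, not_or, not_le] at hcon hω
  have hclose := L.dist_integral_spectralLaw_lt hf (half_pos hη) hcon.1
  have htriangle := dist_triangle (∫ s, f s ∂(L.spectralLaw (fun t => x t ω) n : Measure ℝ))
    (∫ s, f s ∂(L.spectralLaw (fun t => g (x t ω)) n : Measure ℝ)) (∫ s, f s ∂(μ : Measure ℝ))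
  linarith [hcon.2]

end Probability

end SymmLink

/-! ### Convergence in probability of the spectral distribution functions -/

lemma exists_lipschitzWith_between_indicators (s : ℝ) {d : ℝ} (hd : 0 < d) :
    ∃ (f : ℝ → ℝ) (K : NNReal), LipschitzWith K f ∧ (∃ C : ℝ, ∀ r r', dist (f r) (f r') ≤ C) ∧
      (Set.Iic s).indicator 1 ≤ f ∧ f ≤ (Set.Iic (s + d)).indicator 1 := by
  refine ⟨fun r => thickenedIndicator hd (Set.Iic s) r, _,
    NNReal.isometry_coe.lipschitz.comp (lipschitzWith_thickenedIndicator hd _),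
    map_bounded (thickenedIndicator hd (Set.Iic s)), fun r => ?_, fun r => ?_⟩
  · by_cases hr : r ∈ Set.Iic s
    · simp [hr, thickenedIndicator_one hd _ hr]
    · simp [hr]
  · by_cases hr : r ∈ Set.Iic (s + d)
    · rw [Set.indicator_of_mem hr]
      exact NNReal.coe_le_one.2 (thickenedIndicator_le_one hd (Set.Iic s) r)
    · have hr' : r ∉ Metric.thickening d (Set.Iic s) := fun h => by
        obtain ⟨z, hz, hrz⟩ := Metric.mem_thickening_iff.1 h
        rw [Real.dist_eq] at hrz
        exact hr (by linarith [le_abs_self (r - z), Set.mem_Iic.1 hz] : r ≤ s + d)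
      simp [hr, thickenedIndicator_zero hd _ hr']

lemma measureReal_Iic_le_integral_le {f : ℝ → ℝ} {K : NNReal} (hf : LipschitzWith K f) {s t : ℝ}
    (hs : (Set.Iic s).indicator 1 ≤ f) (ht : f ≤ (Set.Iic t).indicator 1) (ν : Measure ℝ)
    [IsFiniteMeasure ν] :
    ν.real (Set.Iic s) ≤ ∫ r, f r ∂ν ∧ ∫ r, f r ∂ν ≤ ν.real (Set.Iic t) := by
  have hint (u : ℝ) : Integrable ((Set.Iic u).indicator (1 : ℝ → ℝ)) ν :=
    (integrable_const (1 : ℝ)).indicator measurableSet_Iic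
  have hf' : Integrable f ν := (hint t).mono' hf.continuous.aestronglyMeasurable <|
    ae_of_all _ fun r => by
      rw [Real.norm_of_nonneg ((Set.indicator_nonneg (fun _ _ => zero_le_one) r).trans (hs r))]
      exact ht r
  rw [← integral_indicator_one measurableSet_Iic, ← integral_indicator_one measurableSet_Iic]
  exact ⟨integral_mono (hint s) hf' hs, integral_mono hf' (hint t) ht⟩

lemma exists_lipschitzWith_dist_measureReal_Iic_lt {μ : Measure ℝ} [IsFiniteMeasure μ] {s : ℝ}
    (hs : ContinuousAt (fun r => μ.real (Set.Iic r)) s) {η : ℝ} (hη : 0 < η) :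
    ∃ (f g : ℝ → ℝ) (K K' : NNReal), LipschitzWith K f ∧ LipschitzWith K' g ∧
      (∃ C : ℝ, ∀ r r', dist (f r) (f r') ≤ C) ∧ (∃ C : ℝ, ∀ r r', dist (g r) (g r') ≤ C) ∧
      ∀ (ν : Measure ℝ) [IsFiniteMeasure ν], dist (∫ r, f r ∂ν) (∫ r, f r ∂μ) < η / 2 →
        dist (∫ r, g r ∂ν) (∫ r, g r ∂μ) < η / 2 →
        dist (ν.real (Set.Iic s)) (μ.real (Set.Iic s)) < η := by
  obtain ⟨d, hd, hμ⟩ := Metric.nhds_basis_closedBall.eventually_iff.1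
    (Metric.continuousAt_iff'.1 hs (η / 2) (half_pos hη))
  have hμadd := hμ (show s + d ∈ Metric.closedBall s d by simp [abs_of_pos hd])
  have hμsub := hμ (show s - d ∈ Metric.closedBall s d by simp [abs_of_pos hd])
  obtain ⟨f, K, hf, hfb, hsf, hfs⟩ := exists_lipschitzWith_between_indicators s hd
  obtain ⟨g, K', hg, hgb, hsg, hgs⟩ := exists_lipschitzWith_between_indicators (s - d) hd
  rw [sub_add_cancel] at hgs
  refine ⟨f, g, K, K', hf, hg, hfb, hgb, fun ν _ hνf hνg => ?_⟩
  have hfν := measureReal_Iic_le_integral_le hf hsf hfs ν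
  have hfμ := measureReal_Iic_le_integral_le hf hsf hfs μ
  have hgν := measureReal_Iic_le_integral_le hg hsg hgs ν
  have hgμ := measureReal_Iic_le_integral_le hg hsg hgs μ
  rw [Real.dist_eq, abs_lt] at *
  constructor <;> linarith

namespace SymmLink

variable {ι : Type u} {L : SymmLink ι}

theorem esdTendstoInProbability_of_iid {D : ℕ}
    (hD : ∀ n (k : Fin n) t, {l | L.toFun n k l = t}.ncard ≤ D) {β : ℕ → ℝ}
    (hβ : L.HasPairLimits β) {μ : ProbabilityMeasure ℝ} (hμ : IsMomentLimit β μ)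
    {Ω : Type w} [MeasurableSpace Ω] {P : Measure Ω} [IsProbabilityMeasure P] {x : ι → Ω → ℝ}
    (hx : InputA2 x P) : L.ESDTendstoInProbability x P μ := by
  refine fun s hs => tendstoInMeasure_iff_measureReal_dist.2 fun η hη => ?_
  rw [← tendsto_add_atTop_iff_nat 1]
  obtain ⟨f, g, K, K', hf, hg, hfb, hgb, hfg⟩ := exists_lipschitzWith_dist_measureReal_Iic_lt hs hη
  have hlim := (tendstoInMeasure_iff_measureReal_dist.1
      (tendstoInMeasure_integral_spectralLaw hD hβ hμ hx hfb hf) (η / 2) (half_pos hη)).add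
    (tendstoInMeasure_iff_measureReal_dist.1
      (tendstoInMeasure_integral_spectralLaw hD hβ hμ hx hgb hg) (η / 2) (half_pos hη))
  rw [add_zero] at hlim
  refine squeeze_zero (fun _ => measureReal_nonneg) (fun n =>
    (measureReal_mono fun ω hω => ?_).trans (measureReal_union_le _ _)) hlim
  by_contra! hcon
  simp only [Set.mem_union, Set.mem_ofPred_eq, not_or, not_le] at hcon
  exact (hfg (L.spectralLaw (fun t => x t ω) n) hcon.1 hcon.2).not_ge hω

theorem isLSD_of_hasPairLimits (hB : L.PropertyB) (hL : L.LinkCond) {β : ℕ → ℝ}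
    (hβ : L.HasPairLimits β) {μ : ProbabilityMeasure ℝ} (hμ : IsMomentLimit β μ) :
    SymmLink.IsLSD.{u, w} L (μ : Measure ℝ) := by
  obtain ⟨D, -, hD⟩ := hB.exists_bound
  refine ⟨inferInstance, fun Ω _ P _ x => ⟨fun hx => ?_, fun hx => ?_, fun hx hcum => ?_,
    fun hx => esdTendstoInProbability_of_iid hD hβ hμ hx⟩⟩
  · filter_upwards [ae_tendsto_spectralLaw hD hβ hμ hx.inputA3] with ω hω s hs
    exact tendsto_esd_of_tendsto_spectralLaw hω hs
  · filter_upwards [ae_tendsto_spectralLaw hD hβ hμ hx] with ω hω s hs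
    exact tendsto_esd_of_tendsto_spectralLaw hω hs
  · filter_upwards [ae_tendsto_spectralLaw_of_iid hD hL hcum hβ hμ hx] with ω hω s hs
    exact tendsto_esd_of_tendsto_spectralLaw hω hs

end SymmLink

/-! ### Relabelled links -/

namespace SymmLink

variable {ι : Type u} {κ : Type v} {L : SymmLink ι} {ρ : ℕ → ι → κ}

lemma stepValue_mem_values (L : SymmLink ι) {n h : ℕ} (π : Fin (h + 1) → Fin n) (i : Fin h) :
    L.stepValue π i ∈ L.values n :=
  ⟨(π i.castSucc, π i.succ), rfl⟩

lemma values_map (L : SymmLink ι) (ρ : ℕ → ι → κ) (n : ℕ) :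
    (L.map ρ).values n = ρ n '' L.values n :=
  Set.range_comp (ρ n) fun p : Fin n × Fin n => L.toFun n p.1 p.2

lemma map_toFun_eq_iff (hρ : ∀ n, Set.InjOn (ρ n) (L.values n)) {n : ℕ} {t : ι}
    (ht : t ∈ L.values n) (i j : Fin n) :
    (L.map ρ).toFun n i j = ρ n t ↔ L.toFun n i j = t :=
  (hρ n).eq_iff ⟨(i, j), rfl⟩ ht

lemma map_stepValue_eq_iff (hρ : ∀ n, Set.InjOn (ρ n) (L.values n)) {n h : ℕ}
    (π : Fin (h + 1) → Fin n) (i j : Fin h) :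
    (L.map ρ).stepValue π i = (L.map ρ).stepValue π j ↔ L.stepValue π i = L.stepValue π j :=
  (hρ n).eq_iff (L.stepValue_mem_values π i) (L.stepValue_mem_values π j)

theorem PropertyB.map (hB : L.PropertyB) (hρ : ∀ n, Set.InjOn (ρ n) (L.values n)) :
    (L.map ρ).PropertyB := by
  refine (iSup_le fun n => iSup_le fun t => iSup_le fun ht => iSup_le fun k => ?_).trans_lt hB
  rw [values_map] at ht
  obtain ⟨t, ht, rfl⟩ := ht
  simp only [map_toFun_eq_iff hρ ht]
  exact le_iSup_of_le n (le_iSup_of_le t (le_iSup_of_le ht (le_iSup_of_le k le_rfl)))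

lemma numValues_map (hρ : ∀ n, Set.InjOn (ρ n) (L.values n)) (n : ℕ) :
    (L.map ρ).numValues n = L.numValues n := by
  rw [numValues, values_map, (hρ n).ncard_image, numValues]

lemma maxOccurrences_map_le (hρ : ∀ n, Set.InjOn (ρ n) (L.values n)) (n : ℕ) :
    (L.map ρ).maxOccurrences n ≤ L.maxOccurrences n := by
  refine ciSup_le' fun t => ?_
  by_cases ht : t ∈ (L.map ρ).values n
  · rw [values_map] at ht
    obtain ⟨t, ht, rfl⟩ := ht
    simp only [map_toFun_eq_iff hρ ht]
    exact L.ncard_label_le_maxOccurrences n t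
  · have hempty : {p : Fin n × Fin n | (L.map ρ).toFun n p.1 p.2 = t} = ∅ :=
      Set.eq_empty_of_forall_notMem fun p hp => ht ⟨p, hp⟩
    simp [hempty]

theorem LinkCond.map (hL : L.LinkCond) (hρ : ∀ n, Set.InjOn (ρ n) (L.values n)) :
    (L.map ρ).LinkCond := by
  have hnum : (L.map ρ).numValues = L.numValues := funext (numValues_map hρ)
  refine ⟨hnum ▸ hL.1, IsBigO.trans (IsBigO.of_norm_le fun n => ?_) hL.2⟩
  rw [hnum, Real.norm_of_nonneg (by positivity)]
  gcongr
  exact maxOccurrences_map_le hρ n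

theorem circuitsStar_map (hρ : ∀ n, Set.InjOn (ρ n) (L.values n)) {h : ℕ} (W : Word h) (n : ℕ) :
    (L.map ρ).circuitsStar W n = L.circuitsStar W n := by
  simp only [circuitsStar, map_stepValue_eq_iff hρ]

lemma pairCircuits_map (hρ : ∀ n, Set.InjOn (ρ n) (L.values n)) (h n : ℕ) :
    (L.map ρ).pairCircuits h n = L.pairCircuits h n := by
  simp only [pairCircuits, letterCount_congr (map_stepValue_eq_iff hρ _)]

theorem HasPairLimits.map {β : ℕ → ℝ} (hβ : L.HasPairLimits β)
    (hρ : ∀ n, Set.InjOn (ρ n) (L.values n)) : (L.map ρ).HasPairLimits β := by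
  simpa only [HasPairLimits, pairCircuits_map hρ] using hβ

theorem exists_isLSD_map (hB : L.PropertyB) (hL : L.LinkCond) (hW : L.WordLimitsExist)
    (hρ : ∀ n, Set.InjOn (ρ n) (L.values n)) :
    ∃ μ : Measure ℝ, SymmLink.IsLSD.{u, w} L μ ∧ SymmLink.IsLSD.{v, w} (L.map ρ) μ := by
  obtain ⟨D, -, hD⟩ := hB.exists_bound
  obtain ⟨β, hβ⟩ := hW.exists_hasPairLimits
  obtain ⟨μ, hμ⟩ := exists_isMomentLimit hD hβ
  exact ⟨μ, isLSD_of_hasPairLimits hB hL hβ hμ,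
    isLSD_of_hasPairLimits (hB.map hρ) (hL.map hρ) (hβ.map hρ) hμ⟩

end SymmLink

/-! ### Counting lattice points -/

section LatticePoints

variable {A : Type*}

lemma mem_span_range_basisFun_iff [Finite A] (y : A → ℝ) :
    y ∈ Submodule.span ℤ (Set.range (Pi.basisFun ℝ A)) ↔ ∃ x : A → ℤ, (fun a => (x a : ℝ)) = y := by
  simp only [Module.Basis.mem_span_iff_repr_mem, Pi.basisFun_repr, algebraMap_int_eq,
    eq_intCast, Set.mem_range, funext_iff, Classical.skolem]

open scoped Pointwise in
lemma ncard_inter_inv_smul_span_basisFun [Finite A] (s : Set (A → ℝ)) {n : ℕ} (hn : n ≠ 0) :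
    (s ∩ (n : ℝ)⁻¹ • (Submodule.span ℤ (Set.range (Pi.basisFun ℝ A)) : Set (A → ℝ))).ncard =
      {x : A → ℤ | (fun a => (x a : ℝ) / n) ∈ s}.ncard := by
  have hn' : (n : ℝ) ≠ 0 := Nat.cast_ne_zero.2 hn
  have hinj : Function.Injective fun (x : A → ℤ) a => (x a : ℝ) / n := fun x y hxy => by
    funext a
    exact Int.cast_injective ((div_left_inj' hn').1 (congrFun hxy a))
  rw [← Set.ncard_image_of_injective _ hinj]
  congr 1
  ext y
  simp only [Set.mem_inter_iff, Set.mem_inv_smul_set_iff₀ hn', SetLike.mem_coe,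
    mem_span_range_basisFun_iff, Set.mem_image, Set.mem_ofPred_eq]
  have hdiv (x : A → ℤ) : (fun a => (x a : ℝ)) = (n : ℝ) • y ↔ (fun a => (x a : ℝ) / n) = y := by
    simp only [funext_iff, Pi.smul_apply, smul_eq_mul, div_eq_iff hn', mul_comm]
  simp only [hdiv]
  constructor
  · rintro ⟨hy, x, rfl⟩
    exact ⟨x, hy, rfl⟩
  · rintro ⟨x, hx, rfl⟩
    exact ⟨hx, x, rfl⟩

variable [Fintype A]

theorem tendsto_ncard_lattice_points_of_convex {s : Set (A → ℝ)} (hs : Convex ℝ s)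
    (hb : Bornology.IsBounded s) (hm : MeasurableSet s) :
    Tendsto (fun n : ℕ => ({x : A → ℤ | (fun a => (x a : ℝ) / n) ∈ s}.ncard : ℝ) /
      (n : ℝ) ^ Fintype.card A) atTop (𝓝 (volume.real s)) := by
  refine (tendsto_card_div_pow_atTop_volume s hb hm (hs.addHaar_frontier volume)).congr' ?_
  filter_upwards [eventually_ne_atTop 0] with n hn
  rw [Nat.card_coe_set_eq, ncard_inter_inv_smul_span_basisFun s hn]

/-- The integer points of the box `[-n, n]^A` that satisfy the linear relation with coefficients
`c`. -/
def boxRelation (c : A → ℤ) (n : ℕ) : Set (A → ℤ) :=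
  {x | (∀ a, |x a| ≤ n) ∧ ∑ a, c a * x a = 0}

lemma finite_box (A : Type*) [Finite A] (n : ℕ) : {x : A → ℤ | ∀ a, |x a| ≤ n}.Finite :=
  (Set.Finite.pi fun _ : A => Set.finite_Icc (-(n : ℤ)) n).subset fun _ hx a _ => abs_le.1 (hx a)

lemma finite_boxRelation (c : A → ℤ) (n : ℕ) : (boxRelation c n).Finite :=
  (finite_box A n).subset fun _ hx => hx.1

lemma eq_of_sum_mul_eq_of_forall_ne {c x y : A → ℤ} {b : A} (hc : c b ≠ 0)
    (hsum : ∑ a, c a * x a = ∑ a, c a * y a) (hne : ∀ a ≠ b, x a = y a) : x = y := by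
  classical
  have hb : c b * x b = c b * y b := by
    rw [← Finset.add_sum_erase _ _ (Finset.mem_univ b),
      ← Finset.add_sum_erase _ (fun a => c a * y a) (Finset.mem_univ b),
      Finset.sum_congr rfl fun a ha => by rw [hne a (Finset.ne_of_mem_erase ha)]] at hsum
    exact add_right_cancel hsum
  funext a
  by_cases ha : a = b
  · exact ha ▸ mul_left_cancel₀ hc hb
  · exact hne a ha

lemma ncard_boxRelation_le {c : A → ℤ} {b : A} (hc : c b ≠ 0) (n : ℕ) :
    (boxRelation c n).ncard ≤ (2 * n + 1) ^ (Fintype.card A - 1) := by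
  classical
  let T : Finset ({a // a ≠ b} → ℤ) := Fintype.piFinset fun _ => Finset.Icc (-(n : ℤ)) n
  have hT : T.card = (2 * n + 1) ^ (Fintype.card A - 1) := by
    rw [Fintype.card_piFinset, Finset.prod_const, Finset.card_univ, Int.card_Icc,
      Fintype.card_subtype_compl, Fintype.card_subtype_eq]
    congr 1
    omega
  rw [← hT, ← Set.ncard_coe_finset]
  refine Set.ncard_le_ncard_of_injOn (fun x a => x a)
    (fun x hx => Fintype.mem_piFinset.2 fun a => Finset.mem_Icc.2 (abs_le.1 (hx.1 a)))
    (fun x hx y hy hxy => ?_) T.finite_toSet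
  exact eq_of_sum_mul_eq_of_forall_ne hc (hx.2.trans hy.2.symm) fun a ha => congrFun hxy ⟨a, ha⟩

lemma ncard_le_add_card_mul {B J : Type*} [Fintype J] {S T : Set B} {R : J → Set B} {M : ℕ}
    (hS : S ⊆ T ∪ ⋃ j, R j) (hT : T.Finite) (hR : ∀ j, (R j).Finite) (hM : ∀ j, (R j).ncard ≤ M) :
    S.ncard ≤ T.ncard + Fintype.card J * M :=
  calc S.ncard ≤ (T ∪ ⋃ j, R j).ncard := Set.ncard_le_ncard hS (hT.union (Set.finite_iUnion hR))
    _ ≤ T.ncard + (⋃ j, R j).ncard := Set.ncard_union_le _ _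
    _ ≤ T.ncard + ∑ j, (R j).ncard := by gcongr; exact Set.ncard_iUnion_le_of_fintype R
    _ ≤ T.ncard + Fintype.card J * M := by
        gcongr
        exact Finset.sum_le_card_nsmul _ _ M fun j _ => hM j

lemma tendsto_const_mul_pow_div_pow_succ (C : ℝ) (d : ℕ) :
    Tendsto (fun n : ℕ => C * (2 * n + 1) ^ d / (n : ℝ) ^ (1 + d)) atTop (𝓝 0) := by
  have hbase : Tendsto (fun n : ℕ => (2 + (n : ℝ)⁻¹) ^ d) atTop (𝓝 ((2 + 0) ^ d)) :=
    (tendsto_const_nhds.add tendsto_inv_atTop_nhds_zero_nat).pow d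
  have hprod := (hbase.const_mul C).mul (tendsto_inv_atTop_nhds_zero_nat (𝕜 := ℝ))
  rw [mul_zero] at hprod
  refine hprod.congr' ?_
  filter_upwards [eventually_ne_atTop 0] with n hn
  have hn' : (n : ℝ) ≠ 0 := Nat.cast_ne_zero.2 hn
  have hsplit : 2 + (n : ℝ)⁻¹ = (2 * n + 1) / n := by field_simp
  rw [hsplit, div_pow, pow_add, pow_one]
  field_simp

lemma tendsto_div_pow_of_le_add {a b : ℕ → ℕ} {C C' d : ℕ} {r : ℝ}
    (hab : ∀ n, a n ≤ b n + C * (2 * n + 1) ^ d) (hba : ∀ n, b n ≤ a n + C' * (2 * n + 1) ^ d)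
    (hb : Tendsto (fun n => (b n : ℝ) / (n : ℝ) ^ (1 + d)) atTop (𝓝 r)) :
    Tendsto (fun n => (a n : ℝ) / (n : ℝ) ^ (1 + d)) atTop (𝓝 r) := by
  have hlow := hb.sub (tendsto_const_mul_pow_div_pow_succ C' d)
  have hup := hb.add (tendsto_const_mul_pow_div_pow_succ C d)
  rw [sub_zero] at hlow
  rw [add_zero] at hup
  refine tendsto_of_tendsto_of_tendsto_of_le_of_le hlow hup (fun n => ?_) fun n => ?_
  · simp only [← sub_div]
    gcongr
    rw [sub_le_iff_le_add]
    exact_mod_cast hba n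
  · simp only [← add_div]
    gcongr
    exact_mod_cast hab n

end LatticePoints

/-! ### Paths with prescribed steps -/

section SignedPath

variable {I : Type*} {h : ℕ} {R : Type*} [CommRing R]

/-- The path that starts at `x none` and whose `j`-th step is `e j * x (some (f j))`. The points
`x : Option I → R` thus parametrize the paths whose steps at equal letters of `f` agree up to the
signs `e`. -/
def signedPath (f : Fin h → I) (e : Fin h → ℤˣ) (x : Option I → R) (i : Fin (h + 1)) : R :=
  x none + ∑ j with j.castSucc < i, ((e j : ℤ) : R) * x (some (f j))

variable (f : Fin h → I) (e : Fin h → ℤˣ)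

lemma signedPath_zero (x : Option I → R) : signedPath f e x 0 = x none := by
  simp [signedPath]

lemma signedPath_succ (x : Option I → R) (i : Fin h) :
    signedPath f e x i.succ = signedPath f e x i.castSucc + ((e i : ℤ) : R) * x (some (f i)) := by
  have hinsert : Finset.univ.filter (fun j : Fin h => j.castSucc < i.succ) =
      insert i (Finset.univ.filter fun j : Fin h => j.castSucc < i.castSucc) := by
    ext j
    simp only [Finset.mem_filter, Finset.mem_univ, true_and, Finset.mem_insert, Fin.lt_def,
      Fin.val_castSucc, Fin.val_succ, Fin.ext_iff]
    omega
  rw [signedPath, hinsert, Finset.sum_insert (by simp), signedPath]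
  ring

lemma signedPath_last (x : Option I → R) :
    signedPath f e x (Fin.last h) = x none + ∑ j, ((e j : ℤ) : R) * x (some (f j)) := by
  rw [signedPath, Finset.filter_true_of_mem fun j _ => Fin.castSucc_lt_last j]

lemma signedPath_intCast_div (x : Option I → ℤ) (n : ℝ) (i : Fin (h + 1)) :
    signedPath f e (fun a => (x a : ℝ) / n) i = ((signedPath f e x i : ℤ) : ℝ) / n := by
  simp only [signedPath, Int.cast_add, Int.cast_sum, Int.cast_mul, add_div, Finset.sum_div,
    mul_div_assoc, Int.cast_id]

variable {f e} in
lemma eq_signedPath {y : Fin (h + 1) → R} {x : Option I → R} (hzero : y 0 = x none)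
    (hstep : ∀ i : Fin h, y i.succ - y i.castSucc = ((e i : ℤ) : R) * x (some (f i)))
    (i : Fin (h + 1)) : y i = signedPath f e x i := by
  induction i using Fin.induction with
  | zero => rw [signedPath_zero, hzero]
  | succ i ih => rw [signedPath_succ, ← ih, ← hstep i, add_sub_cancel]

/-- The points whose signed path stays in `[0, 1)`: the polytope whose volume is the limit of a
Toeplitz word. -/
def unitPathRegion : Set (Option I → ℝ) := {x | ∀ i, signedPath f e x i ∈ Set.Ico (0 : ℝ) 1}

lemma unitPathRegion_eq_iInter :
    unitPathRegion f e = ⋂ i, (fun x => signedPath f e x i) ⁻¹' Set.Ico (0 : ℝ) 1 := by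
  ext x
  simp [unitPathRegion]

lemma isLinearMap_signedPath (i : Fin (h + 1)) :
    IsLinearMap ℝ fun x : Option I → ℝ => signedPath f e x i where
  map_add x y := by
    simp only [signedPath, Pi.add_apply, mul_add, Finset.sum_add_distrib]
    ring
  map_smul c x := by
    simp only [signedPath, Pi.smul_apply, smul_eq_mul, mul_add, Finset.mul_sum, mul_left_comm]

lemma convex_unitPathRegion : Convex ℝ (unitPathRegion f e) := by
  rw [unitPathRegion_eq_iInter]
  exact convex_iInter fun i => (convex_Ico 0 1).is_linear_preimage (isLinearMap_signedPath f e i)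

lemma measurableSet_unitPathRegion : MeasurableSet (unitPathRegion f e) := by
  rw [unitPathRegion_eq_iInter]
  refine MeasurableSet.iInter fun i => measurableSet_Ico.preimage ?_
  unfold signedPath
  fun_prop

variable {f e}

lemma isBounded_unitPathRegion {p : I → Fin h} (hp : ∀ a, f (p a) = a) (he : ∀ a, e (p a) = 1) :
    Bornology.IsBounded (unitPathRegion f e) := by
  have := Fintype.ofInjective p (Function.LeftInverse.injective hp)
  refine (Metric.isBounded_closedBall (x := (0 : Option I → ℝ)) (r := 1)).subset fun x hx => ?_
  rw [mem_closedBall_zero_iff, pi_norm_le_iff_of_nonneg zero_le_one]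
  rintro (_ | a)
  · have hstart := hx 0
    rw [signedPath_zero] at hstart
    rw [Real.norm_of_nonneg hstart.1]
    exact hstart.2.le
  · have hbefore := hx (p a).castSucc
    have hafter := hx (p a).succ
    rw [signedPath_succ, hp, he, Units.val_one, Int.cast_one, one_mul] at hafter
    rw [Real.norm_eq_abs, abs_le]
    constructor <;> linarith [hbefore.1, hbefore.2, hafter.1, hafter.2]

theorem tendsto_ncard_signedPath [Fintype I] {p : I → Fin h} (hp : ∀ a, f (p a) = a)
    (he : ∀ a, e (p a) = 1) :
    Tendsto (fun n : ℕ => ({x : Option I → ℤ | ∀ i, signedPath f e x i ∈ Set.Ico (0 : ℤ) n}.ncard :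
      ℝ) / (n : ℝ) ^ (1 + Fintype.card I)) atTop (𝓝 (volume.real (unitPathRegion f e))) := by
  have hlattice := tendsto_ncard_lattice_points_of_convex (convex_unitPathRegion f e)
    (isBounded_unitPathRegion hp he) (measurableSet_unitPathRegion f e)
  rw [Fintype.card_option, add_comm] at hlattice
  refine hlattice.congr' ?_
  filter_upwards [eventually_gt_atTop 0] with n hn
  have hn' : (0 : ℝ) < n := Nat.cast_pos.2 hn
  congr 3
  ext x
  simp only [Set.mem_ofPred_eq, unitPathRegion, signedPath_intCast_div, Set.mem_Ico,
    le_div_iff₀ hn', div_lt_one hn', zero_mul]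
  exact forall_congr' fun i => by norm_cast

end SignedPath

/-! ### Words of Toeplitz circuits -/

section ToeplitzCircuits

variable {I : Type*} {h n : ℕ} (f : Fin h → I) (p : I → Fin h)

/-- The signs `1` at the chosen positions `p a` of the letters `a`, and `-1` elsewhere. Only with
these signs do all the paths close up. -/
def oppositeSigns (i : Fin h) : ℤˣ := if i = p (f i) then 1 else -1

/-- The starting point of a path and its steps at the positions `p a`. -/
def pathCoords (π : Fin (h + 1) → Fin n) : Option I → ℤ
  | none => π 0
  | some a => (π (p a).succ : ℤ) - π (p a).castSucc

/-- The circuits whose Toeplitz labels match exactly as the letters of the word `f`. -/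
def toeplitzCircuits (n : ℕ) : Set (Fin (h + 1) → Fin n) :=
  {π | π 0 = π (Fin.last h) ∧
    ∀ i j, f i = f j ↔ toeplitzLink.stepValue π i = toeplitzLink.stepValue π j}

/-- The integer points whose signed path, with opposite signs at matched positions, stays in
`[0, n)`. -/
def latticePaths (n : ℕ) : Set (Option I → ℤ) :=
  {x | ∀ i, signedPath f (oppositeSigns f p) x i ∈ Set.Ico (0 : ℤ) n}

/-- The signs of the steps of `π` relative to the steps at the chosen positions are `e`. -/
def HasSigns (e : Fin h → ℤˣ) (π : Fin (h + 1) → Fin n) : Prop :=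
  ∀ i, (π i.succ : ℤ) - π i.castSucc = (e i : ℤ) * pathCoords p π (some (f i))

/-- The coefficients of the linear relation that says that the signed path closes up. -/
def closingCoeff [DecidableEq I] (e : Fin h → ℤˣ) : Option I → ℤ
  | none => 0
  | some a => ∑ j with f j = a, (e j : ℤ)

/-- The coefficients of the relation `x a + s * x b = 0`, where `q = (a, b, s)`. -/
def pairCoeff [DecidableEq I] (q : I × I × ℤˣ) : Option I → ℤ :=
  Pi.single (some q.1) 1 + Pi.single (some q.2.1) (q.2.2 : ℤ)

lemma toeplitzLink_stepValue (π : Fin (h + 1) → Fin n) (i : Fin h) :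
    toeplitzLink.stepValue π i = ((π i.succ : ℤ) - π i.castSucc).natAbs := by
  rw [← Int.natAbs_neg, neg_sub]
  rfl

variable {f p}

lemma oppositeSigns_apply (hp : ∀ a, f (p a) = a) (a : I) : oppositeSigns f p (p a) = 1 := by
  rw [oppositeSigns, if_pos (by rw [hp])]

lemma abs_pathCoords_le (π : Fin (h + 1) → Fin n) (a : Option I) : |pathCoords p π a| ≤ n := by
  rcases a with _ | a <;> simp only [pathCoords, abs_le] <;> omega

lemma abs_le_of_mem_latticePaths (hp : ∀ a, f (p a) = a) {x : Option I → ℤ}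
    (hx : x ∈ latticePaths f p n) (a : Option I) : |x a| ≤ n := by
  rw [abs_le]
  rcases a with _ | a
  · have hstart := hx 0
    rw [signedPath_zero, Set.mem_Ico] at hstart
    omega
  · have hbefore := hx (p a).castSucc
    have hafter := hx (p a).succ
    rw [signedPath_succ, hp, oppositeSigns_apply hp, Units.val_one, Int.cast_one, one_mul,
      Set.mem_Ico] at hafter
    rw [Set.mem_Ico] at hbefore
    omega

lemma HasSigns.cast_apply {e : Fin h → ℤˣ} {π : Fin (h + 1) → Fin n} (hπ : HasSigns f p e π)
    (i : Fin (h + 1)) : (π i : ℤ) = signedPath f e (pathCoords p π) i :=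
  eq_signedPath (y := fun i => (π i : ℤ)) rfl hπ i

lemma injOn_pathCoords (e : Fin h → ℤˣ) :
    Set.InjOn (pathCoords p) {π : Fin (h + 1) → Fin n | HasSigns f p e π} := by
  intro π hπ π' hπ' heq
  funext i
  have hcast : (π i : ℤ) = π' i := by
    rw [HasSigns.cast_apply hπ, HasSigns.cast_apply hπ', heq]
  exact Fin.ext (by exact_mod_cast hcast)

lemma exists_hasSigns (hp : ∀ a, f (p a) = a) {π : Fin (h + 1) → Fin n}
    (hπ : π ∈ toeplitzCircuits f n) :
    ∃ e : Fin h → ℤˣ, (∀ a, e (p a) = 1) ∧ HasSigns f p e π := by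
  have hsign (i : Fin h) : ∃ s : ℤˣ, (i = p (f i) → s = 1) ∧
      (π i.succ : ℤ) - π i.castSucc = (s : ℤ) * pathCoords p π (some (f i)) := by
    by_cases hi : i = p (f i)
    · refine ⟨1, fun _ => rfl, ?_⟩
      rw [pathCoords, ← hi, Units.val_one, one_mul]
    · have hlabel := (hπ.2 i (p (f i))).1 (hp _).symm
      rw [toeplitzLink_stepValue, toeplitzLink_stepValue, Int.natAbs_eq_natAbs_iff] at hlabel
      rcases hlabel with hsame | hopp
      · exact ⟨1, fun _ => rfl, by rw [hsame, pathCoords, Units.val_one, one_mul]⟩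
      · exact ⟨-1, fun h => (hi h).elim, by
          rw [hopp, pathCoords, Units.val_neg, Units.val_one, neg_one_mul]⟩
  choose e hone he using hsign
  exact ⟨e, fun a => hone _ (by rw [hp]), he⟩

variable [DecidableEq I]

lemma filter_eq_pair (hf : ∀ a, (Finset.univ.filter fun i => f i = a).card = 2)
    (hp : ∀ a, f (p a) = a) {i : Fin h} (hi : i ≠ p (f i)) :
    Finset.univ.filter (fun j => f j = f i) = {p (f i), i} := by
  refine (Finset.eq_of_subset_of_card_le (fun j hj => ?_) ?_).symm
  · rcases Finset.mem_insert.1 hj with rfl | hj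
    · simp [hp]
    · simp [Finset.mem_singleton.1 hj]
  · rw [hf, Finset.card_pair hi.symm]

lemma closingCoeff_some_of_ne (hf : ∀ a, (Finset.univ.filter fun i => f i = a).card = 2)
    (hp : ∀ a, f (p a) = a) (e : Fin h → ℤˣ) {i : Fin h} (hi : i ≠ p (f i)) :
    closingCoeff f e (some (f i)) = e (p (f i)) + e i := by
  rw [closingCoeff, filter_eq_pair hf hp hi, Finset.sum_pair hi.symm]

lemma closingCoeff_oppositeSigns (hf : ∀ a, (Finset.univ.filter fun i => f i = a).card = 2)
    (hp : ∀ a, f (p a) = a) : closingCoeff f (oppositeSigns f p) = 0 := by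
  funext a
  rcases a with _ | a
  · rfl
  · obtain ⟨i, hi, hne⟩ := Finset.exists_mem_ne (s := Finset.univ.filter fun i => f i = a)
      (by rw [hf]; norm_num) (p a)
    obtain rfl : f i = a := (Finset.mem_filter.1 hi).2
    rw [closingCoeff_some_of_ne hf hp _ hne, oppositeSigns_apply hp, oppositeSigns, if_neg hne]
    simp

lemma exists_closingCoeff_ne_zero (hf : ∀ a, (Finset.univ.filter fun i => f i = a).card = 2)
    (hp : ∀ a, f (p a) = a) {e : Fin h → ℤˣ} (he : ∀ a, e (p a) = 1)
    (hne : e ≠ oppositeSigns f p) : ∃ b, closingCoeff f e b ≠ 0 := by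
  obtain ⟨i, hi⟩ := Function.ne_iff.1 hne
  have hpos : i ≠ p (f i) := by
    intro h
    rw [oppositeSigns, if_pos h, h, he] at hi
    exact hi rfl
  rw [oppositeSigns, if_neg hpos] at hi
  refine ⟨some (f i), ?_⟩
  rw [closingCoeff_some_of_ne hf hp e hpos, he, (Int.units_eq_one_or (e i)).resolve_right hi]
  norm_num

variable [Fintype I]

lemma signedPath_last_eq_add_sum_closingCoeff (e : Fin h → ℤˣ) (x : Option I → ℤ) :
    signedPath f e x (Fin.last h) = x none + ∑ a, closingCoeff f e a * x a := by
  rw [signedPath_last, Fintype.sum_option, closingCoeff, zero_mul, zero_add]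
  congr 1
  rw [← Finset.sum_fiberwise_of_maps_to (t := Finset.univ) (g := f) fun j _ => Finset.mem_univ _]
  refine Finset.sum_congr rfl fun a _ => ?_
  rw [closingCoeff, Finset.sum_mul]
  exact Finset.sum_congr rfl fun j hj => by rw [(Finset.mem_filter.1 hj).2, Int.cast_id]

lemma HasSigns.mem_boxRelation {e : Fin h → ℤˣ} {π : Fin (h + 1) → Fin n}
    (hπ : HasSigns f p e π) (hclosed : π 0 = π (Fin.last h)) :
    pathCoords p π ∈ boxRelation (closingCoeff f e) n := by
  have hlast := hπ.cast_apply (Fin.last h)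
  rw [signedPath_last_eq_add_sum_closingCoeff, ← hclosed, pathCoords] at hlast
  exact ⟨abs_pathCoords_le π, left_eq_add.1 hlast⟩

lemma sum_pairCoeff_mul (q : I × I × ℤˣ) (x : Option I → ℤ) :
    ∑ a, pairCoeff q a * x a = x (some q.1) + q.2.2 * x (some q.2.1) := by
  simp [pairCoeff, add_mul, Finset.sum_add_distrib, Pi.single_apply]

lemma ncard_boxRelation_pairCoeff_le {q : I × I × ℤˣ} (hq : q.1 ≠ q.2.1) (n : ℕ) :
    (boxRelation (pairCoeff q) n).ncard ≤ (2 * n + 1) ^ Fintype.card I := by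
  have hcoeff : pairCoeff q (some q.1) ≠ 0 := by simp [pairCoeff, hq]
  simpa only [Fintype.card_option, Nat.add_sub_cancel] using ncard_boxRelation_le hcoeff n

lemma ncard_hasSigns_le (hf : ∀ a, (Finset.univ.filter fun i => f i = a).card = 2)
    (hp : ∀ a, f (p a) = a) {e : Fin h → ℤˣ} (he : ∀ a, e (p a) = 1)
    (hne : e ≠ oppositeSigns f p) (n : ℕ) :
    {π ∈ toeplitzCircuits f n | HasSigns f p e π}.ncard ≤ (2 * n + 1) ^ Fintype.card I := by
  obtain ⟨b, hb⟩ := exists_closingCoeff_ne_zero hf hp he hne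
  calc _ ≤ (boxRelation (closingCoeff f e) n).ncard :=
        Set.ncard_le_ncard_of_injOn (pathCoords p) (fun π hπ => hπ.2.mem_boxRelation hπ.1.1)
          ((injOn_pathCoords e).mono fun π hπ => hπ.2) (finite_boxRelation _ n)
    _ ≤ (2 * n + 1) ^ Fintype.card I := by
        simpa only [Fintype.card_option, Nat.add_sub_cancel] using ncard_boxRelation_le hb n

omit [Fintype I] in
lemma mem_image_pathCoords (hf : ∀ a, (Finset.univ.filter fun i => f i = a).card = 2)
    (hp : ∀ a, f (p a) = a) {x : Option I → ℤ} (hx : x ∈ latticePaths f p n)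
    (hinj : Function.Injective fun a => (x (some a)).natAbs) :
    x ∈ pathCoords p '' toeplitzCircuits f n := by
  have := Fintype.ofInjective p (Function.LeftInverse.injective hp)
  have hlift (i : Fin (h + 1)) :
      ∃ k : Fin n, (k : ℤ) = signedPath f (oppositeSigns f p) x i := by
    obtain ⟨hnonneg, hlt⟩ := hx i
    exact ⟨⟨_, (Int.toNat_lt hnonneg).2 hlt⟩, Int.toNat_of_nonneg hnonneg⟩
  choose π hπ using hlift
  have hstep (i : Fin h) :
      (π i.succ : ℤ) - π i.castSucc = (oppositeSigns f p i : ℤ) * x (some (f i)) := by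
    rw [hπ, hπ, signedPath_succ, add_sub_cancel_left, Int.cast_id]
  have hlabel (i : Fin h) : toeplitzLink.stepValue π i = (x (some (f i))).natAbs := by
    rw [toeplitzLink_stepValue, hstep, Int.natAbs_mul, Int.units_natAbs, one_mul]
  have hclosed : (π (Fin.last h) : ℤ) = π 0 := by
    rw [hπ, hπ, signedPath_last_eq_add_sum_closingCoeff, closingCoeff_oppositeSigns hf hp,
      signedPath_zero]
    simp
  refine ⟨π, ⟨Fin.ext (by exact_mod_cast hclosed.symm), fun i j => ?_⟩, ?_⟩
  · rw [hlabel, hlabel]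
    exact hinj.eq_iff.symm
  · funext a
    rcases a with _ | a
    · rw [pathCoords, hπ, signedPath_zero]
    · rw [pathCoords, hstep, hp, oppositeSigns_apply hp, Units.val_one, one_mul]

lemma ncard_latticePaths_le (hf : ∀ a, (Finset.univ.filter fun i => f i = a).card = 2)
    (hp : ∀ a, f (p a) = a) (n : ℕ) :
    (latticePaths f p n).ncard ≤ (toeplitzCircuits f n).ncard +
      Fintype.card {q : I × I × ℤˣ // q.1 ≠ q.2.1} * (2 * n + 1) ^ Fintype.card I := by
  refine (ncard_le_add_card_mul (T := pathCoords p '' toeplitzCircuits f n)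
    (R := fun q : {q : I × I × ℤˣ // q.1 ≠ q.2.1} => boxRelation (pairCoeff q.1) n)
    (fun x hx => ?_) (Set.toFinite _) (fun q => finite_boxRelation _ n)
    fun q => ncard_boxRelation_pairCoeff_le q.2 n).trans
    (Nat.add_le_add_right (Set.ncard_image_le (Set.toFinite _)) _)
  by_cases hinj : Function.Injective fun a => (x (some a)).natAbs
  · exact Or.inl (mem_image_pathCoords hf hp hx hinj)
  · obtain ⟨a, b, habs, hab⟩ := Function.not_injective_iff.1 hinj
    have hbox := abs_le_of_mem_latticePaths hp hx
    refine Or.inr (Set.mem_iUnion.2 ?_)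
    rcases Int.natAbs_eq_natAbs_iff.1 habs with heq | heq
    · exact ⟨⟨(a, b, -1), hab⟩, hbox, by rw [sum_pairCoeff_mul]; simp [heq]⟩
    · exact ⟨⟨(a, b, 1), hab⟩, hbox, by rw [sum_pairCoeff_mul]; simp [heq]⟩

lemma ncard_toeplitzCircuits_le (hf : ∀ a, (Finset.univ.filter fun i => f i = a).card = 2)
    (hp : ∀ a, f (p a) = a) (n : ℕ) :
    (toeplitzCircuits f n).ncard ≤ (latticePaths f p n).ncard +
      Fintype.card {e : Fin h → ℤˣ // (∀ a, e (p a) = 1) ∧ e ≠ oppositeSigns f p} *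
        (2 * n + 1) ^ Fintype.card I := by
  refine (ncard_le_add_card_mul
    (T := {π ∈ toeplitzCircuits f n | HasSigns f p (oppositeSigns f p) π})
    (R := fun e : {e : Fin h → ℤˣ // (∀ a, e (p a) = 1) ∧ e ≠ oppositeSigns f p} =>
      {π ∈ toeplitzCircuits f n | HasSigns f p e.1 π})
    (fun π hπ => ?_) (Set.toFinite _) (fun _ => Set.toFinite _)
    fun e => ncard_hasSigns_le hf hp e.2.1 e.2.2 n).trans (Nat.add_le_add_right ?_ _)
  · obtain ⟨e, he, hsigns⟩ := exists_hasSigns hp hπ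
    by_cases heq : e = oppositeSigns f p
    · exact Or.inl ⟨hπ, heq ▸ hsigns⟩
    · exact Or.inr (Set.mem_iUnion.2 ⟨⟨e, he, heq⟩, hπ, hsigns⟩)
  · refine Set.ncard_le_ncard_of_injOn (pathCoords p) (fun π hπ i => ?_)
      ((injOn_pathCoords (oppositeSigns f p)).mono fun π hπ => hπ.2)
      ((finite_box _ n).subset fun x hx => abs_le_of_mem_latticePaths hp hx)
    rw [← hπ.2.cast_apply i]
    exact ⟨by positivity, by exact_mod_cast (π i).2⟩

theorem exists_tendsto_ncard_toeplitzCircuits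
    (hf : ∀ a, (Finset.univ.filter fun i => f i = a).card = 2) :
    ∃ r : ℝ, Tendsto (fun n : ℕ => ((toeplitzCircuits f n).ncard : ℝ) /
      (n : ℝ) ^ (1 + Fintype.card I)) atTop (𝓝 r) := by
  have hsurj : Function.Surjective f := fun a => by
    obtain ⟨i, hi⟩ := Finset.card_pos.1 ((hf a).symm ▸ Nat.zero_lt_two)
    exact ⟨i, (Finset.mem_filter.1 hi).2⟩
  have hp := Function.surjInv_eq hsurj
  exact ⟨_, tendsto_div_pow_of_le_add (ncard_toeplitzCircuits_le hf hp)
    (ncard_latticePaths_le hf hp) (tendsto_ncard_signedPath hp (oppositeSigns_apply hp))⟩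

end ToeplitzCircuits

/-! ### The Toeplitz link -/

lemma Word.PairMatched.card_filter_rangeFactorization {h : ℕ} {W : Word h} (hW : W.PairMatched)
    [DecidableEq (Set.range W.letter)] (a : Set.range W.letter) :
    (Finset.univ.filter fun i => Set.rangeFactorization W.letter i = a).card = 2 := by
  obtain ⟨_, i, rfl⟩ := a
  rw [← hW i, ← Set.ncard_coe_finset]
  congr 1
  ext j
  simp [Set.rangeFactorization, Subtype.ext_iff]

lemma Word.PairMatched.card_range_letter {k : ℕ} {W : Word (2 * k)} (hW : W.PairMatched)
    [Fintype (Set.range W.letter)] : Fintype.card (Set.range W.letter) = k := by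
  classical
  have hfiber := Finset.card_eq_sum_card_fiberwise (f := Set.rangeFactorization W.letter)
    (s := Finset.univ) (t := Finset.univ) fun i _ => Finset.mem_coe.2 (Finset.mem_univ _)
  simp only [hW.card_filter_rangeFactorization, Finset.sum_const, Finset.card_univ,
    Fintype.card_fin, smul_eq_mul] at hfiber
  omega

theorem toeplitzLink_wordLimitsExist : toeplitzLink.WordLimitsExist := by
  classical
  intro k W hW
  have hcircuits (n : ℕ) :
      toeplitzLink.circuits W n = toeplitzCircuits (Set.rangeFactorization W.letter) n := by
    simp only [SymmLink.circuits, toeplitzCircuits, Set.rangeFactorization, Subtype.mk.injEq]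
  obtain ⟨r, hr⟩ := exists_tendsto_ncard_toeplitzCircuits hW.card_filter_rangeFactorization
  rw [hW.card_range_letter] at hr
  exact ⟨r, by simpa only [hcircuits] using hr⟩

lemma ncard_toeplitzLink_row_le (n : ℕ) (k : Fin n) (t : ℕ) :
    {l : Fin n | toeplitzLink.toFun n k l = t}.ncard ≤ 2 :=
  calc _ ≤ ({(k : ℤ) + t, (k : ℤ) - t} : Set ℤ).ncard := by
        refine Set.ncard_le_ncard_of_injOn (fun l : Fin n => (l : ℤ)) (fun l hl => ?_)
          (fun l _ l' _ h => Fin.ext (Nat.cast_injective (R := ℤ) h)) (Set.toFinite _)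
        have hlabel : ((k : ℤ) - l).natAbs = t := hl
        rw [Set.mem_insert_iff, Set.mem_singleton_iff]
        omega
    _ ≤ 2 := (Set.ncard_insert_le _ _).trans (by rw [Set.ncard_singleton])

theorem toeplitzLink_propertyB : toeplitzLink.PropertyB := by
  refine (iSup_le fun n => iSup_le fun t => iSup_le fun _ => iSup_le fun k => ?_).trans_lt
    (ENat.natCast_lt_top 2)
  rw [← Set.Finite.cast_ncard_eq (Set.toFinite _)]
  exact_mod_cast ncard_toeplitzLink_row_le n k t

lemma toeplitzLink_values (n : ℕ) : toeplitzLink.values n = Set.Iio n := by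
  ext t
  constructor
  · rintro ⟨⟨i, j⟩, rfl⟩
    change ((i : ℤ) - j).natAbs < n
    omega
  · intro ht
    exact ⟨(⟨t, ht⟩, ⟨0, Nat.zero_lt_of_lt ht⟩), by simp [toeplitzLink]⟩

lemma toeplitzLink_numValues : toeplitzLink.numValues = id := by
  funext n
  rw [SymmLink.numValues, toeplitzLink_values, ← Finset.coe_Iio, Set.ncard_coe_finset,
    Nat.card_Iio, id]

lemma toeplitzLink_maxOccurrences_le (n : ℕ) : toeplitzLink.maxOccurrences n ≤ 2 * n := by
  refine ciSup_le' fun t => (ncard_le_mul_ncard_image _ Prod.fst 2 fun k _ => ?_).trans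
    (Nat.mul_le_mul_left 2 ?_)
  · refine (Set.ncard_le_ncard_of_injOn Prod.snd
      (t := {l : Fin n | toeplitzLink.toFun n k l = t}) ?_ ?_).trans
      (ncard_toeplitzLink_row_le n k t)
    · rintro ⟨i, j⟩ ⟨hlabel, rfl⟩
      exact hlabel
    · rintro ⟨i, j⟩ ⟨-, rfl⟩ ⟨i', j'⟩ ⟨-, hfst⟩ hsnd
      exact Prod.ext hfst.symm hsnd
  · exact (Set.ncard_le_card _).trans_eq (Nat.card_fin n)

theorem toeplitzLink_linkCond : toeplitzLink.LinkCond := by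
  refine ⟨toeplitzLink_numValues ▸ tendsto_id,
    IsBigO.of_bound 2 (Eventually.of_forall fun n => ?_)⟩
  rw [toeplitzLink_numValues, id, Real.norm_of_nonneg (by positivity),
    Real.norm_of_nonneg (by positivity)]
  calc (n : ℝ) * toeplitzLink.maxOccurrences n ≤ n * ((2 * n : ℕ) : ℝ) := by
        gcongr
        exact toeplitzLink_maxOccurrences_le n
    _ = 2 * (n : ℝ) ^ 2 := by
        push_cast
        ring

lemma squaredDifferenceLink_eq_map :
    squaredDifferenceLink = toeplitzLink.map fun _ m => m ^ 2 := by
  have htoFun : squaredDifferenceLink.toFun = (toeplitzLink.map fun _ m => m ^ 2).toFun := by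
    funext n i j
    exact Int.natAbs_pow _ 2
  cases h : squaredDifferenceLink
  cases h' : toeplitzLink.map fun _ m => m ^ 2
  simpa only [h, h', SymmLink.mk.injEq] using htoFun

theorem mainTheorem5 :
    (∀ (ι : Type u) (κ : Type v) (LX : SymmLink ι) (ρ : ℕ → ι → κ),
      LX.PropertyB → LX.LinkCond → LX.WordLimitsExist →
      (∀ n, Set.InjOn (ρ n) (LX.values n)) →
        (LX.map ρ).PropertyB ∧ (LX.map ρ).LinkCond ∧
        (∀ (h : ℕ) (W : Word h) (n : ℕ), LX.circuitsStar W n = (LX.map ρ).circuitsStar W n) ∧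
        ∃ μ : Measure ℝ,
          SymmLink.IsLSD.{u, w} LX μ ∧ SymmLink.IsLSD.{v, w} (LX.map ρ) μ) ∧
    (toeplitzLink.PropertyB ∧ toeplitzLink.LinkCond ∧ toeplitzLink.WordLimitsExist ∧
      ∃ μ : Measure ℝ,
        SymmLink.IsLSD.{0, w} toeplitzLink μ ∧ SymmLink.IsLSD.{0, w} squaredDifferenceLink μ) := by
  refine ⟨fun ι κ LX ρ hB hL hW hρ => ⟨hB.map hρ, hL.map hρ,
    fun h W n => (SymmLink.circuitsStar_map hρ W n).symm, SymmLink.exists_isLSD_map hB hL hW hρ⟩,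
    toeplitzLink_propertyB, toeplitzLink_linkCond, toeplitzLink_wordLimitsExist, ?_⟩
  rw [squaredDifferenceLink_eq_map]
  exact SymmLink.exists_isLSD_map toeplitzLink_propertyB toeplitzLink_linkCond
    toeplitzLink_wordLimitsExist fun n => (Nat.pow_left_injective two_ne_zero).injOn
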